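/- Let $\mathrm{Ai}$ be the Airy function, regarded as an entire function. There is a continuous integrable function $g:\mathbb R\to\mathbb R$ with Fourier transform $$\int_{-\infty}^{\infty}e^{iux}g(x)\,dx=\frac{2^{1/3}}{\mathrm{Ai}(i2^{-1/3}u)},\qquad u\in\mathbb R,$$ and there is a continuous function $p:(0,\infty)\to\mathbb R$ such that $p_0(u)=p(u)-(2\pi u^3)^{-1/2}$ has Laplace transform $$\int_0^\infty e^{-su}p_0(u)\,du=\frac{2^{2/3}\,\mathrm{Ai}'(2^{-1/3}s)}{\mathrm{Ai}(2^{-1/3}s)}+2^{1/2}\sqrt s,\qquad s>0,$$ where the integral converges absolutely. Let $g$ and $p$ be any such functions and let $$\phi(x)=2\int_0^\infty\frac{g(x+u)\,u\,p(u)}{g(x)}\,du,\qquad x\in\mathbb R,$$ be the integrated jump intensity. Then: (i) $\mathrm{Ai}$ has a largest zero $\tilde a_1$ on the negative half-line, and $p(t)\sim 2e^{2^{1/3}\tilde a_1t}$ as $t\to\infty$; (ii) $p(t)\sim(2\pi t^3)^{-1/2}$ as $t\downarrow0$; (iii) $\phi(t)\sim 2t^2$ as $t\to-\infty$, and $\phi(t)\sim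 1/t$ as $t\to\infty$. Here $f\sim h$ means that $f/h\to1$ in the indicated limit. -/

import Mathlib

open Filter Topology MeasureTheory Set Asymptotics

/-- The Airy function `Ai`, as an entire function, by its standard contour integral
`Ai z = (2πi)⁻¹ ∫ exp (t ^ 3 / 3 - z * t) dt`, where the contour runs from `∞ e^{-iπ/3}` to `0` along
the ray `t = r e^{-iπ/3}` and from `0` to `∞ e^{iπ/3}` along the ray `t = r e^{iπ/3}`
(on both rays `t ^ 3 = -r ^ 3`). -/
noncomputable def airyAi (z : ℂ) : ℂ :=
  (2 * (Real.pi : ℂ) * Complex.I)⁻¹ *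
    ∫ r in Ioi (0 : ℝ),
      (Complex.exp (Complex.I * Real.pi / 3) *
          Complex.exp (-(r : ℂ) ^ 3 / 3 - z * (r * Complex.exp (Complex.I * Real.pi / 3)))
        - Complex.exp (-(Complex.I * Real.pi / 3)) *
          Complex.exp (-(r : ℂ) ^ 3 / 3 - z * (r * Complex.exp (-(Complex.I * Real.pi / 3)))))

/-- `g` is the (continuous, integrable) function with Fourier transform
`∫ e^{iux} g(x) dx = 2^{1/3} / Ai (i 2^{-1/3} u)`, `u ∈ ℝ`. -/
structure IsJumpG (g : ℝ → ℝ) : Prop where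
  continuous : Continuous g
  integrable : Integrable g
  fourier : ∀ u : ℝ,
    ∫ x : ℝ, Complex.exp (Complex.I * u * x) * (g x : ℂ)
      = (((2 : ℝ) ^ (1 / 3 : ℝ) : ℝ) : ℂ)
        / airyAi (Complex.I * (((2 : ℝ) ^ (-(1 / 3) : ℝ) : ℝ) : ℂ) * u)

/-- `p` is the (continuous) function on `(0, ∞)` of the form `p u = p₀ u + (2πu³)^{-1/2}`, where
`p₀` has Laplace transform
`∫₀^∞ e^{-su} p₀(u) du = 2^{2/3} Ai' (2^{-1/3} s) / Ai (2^{-1/3} s) + 2^{1/2} √s`, `s > 0`. -/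
structure IsJumpP (p : ℝ → ℝ) : Prop where
  continuousOn : ContinuousOn p (Ioi 0)
  integrableOn : ∀ s : ℝ, 0 < s →
    IntegrableOn
      (fun u : ℝ => Real.exp (-(s * u)) * (p u - (Real.sqrt (2 * Real.pi * u ^ 3))⁻¹)) (Ioi 0)
  laplace : ∀ s : ℝ, 0 < s →
    ((∫ u in Ioi (0 : ℝ),
        Real.exp (-(s * u)) * (p u - (Real.sqrt (2 * Real.pi * u ^ 3))⁻¹) : ℝ) : ℂ)
      = (((2 : ℝ) ^ (2 / 3 : ℝ) : ℝ) : ℂ)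
          * deriv airyAi ((((2 : ℝ) ^ (-(1 / 3) : ℝ) * s : ℝ)) : ℂ)
          / airyAi ((((2 : ℝ) ^ (-(1 / 3) : ℝ) * s : ℝ)) : ℂ)
        + ((Real.sqrt 2 * Real.sqrt s : ℝ) : ℂ)

/-- The integrated jump intensity `φ(x) = 2 ∫₀^∞ g(x+u) u p(u) / g(x) du`. -/
noncomputable def jumpIntensity (g p : ℝ → ℝ) (x : ℝ) : ℝ :=
  2 * ∫ u in Ioi (0 : ℝ), g (x + u) * u * p u / g x

/-! Put k = 2^{1/3}. By injectivity of the Fourier and Laplace transforms on continuous functions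
(`IsJumpG.eq`, `IsJumpP.eqOn`) it suffices to treat one explicit pair. It is g(x) = k² G(kx) with G
= `airyRecip`, whose bilateral Laplace transform is 1/Ai, and p(u) = 2 S(ku)/(ku), where S =
`sizeBiased` has Laplace transform -(Ai'/Ai)'.

Facts about Ai. Moving the contour to the vertical line through the saddle gives 2π Ai(w²) =
e^{-2w³/3} ∫ e^{-ws² - is³/3} ds for Re w > 0 (`two_pi_mul_airyAi_sq`). Comparison with a pure
Gaussian yields Ai'/Ai = -√z + O(1/|z|) and upper bounds for 1/Ai, uniformly in the sector Re z ≥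
-|z|/4. Airy's equation y'' = zy shows that the zeros are real, negative and simple, and that one
exists; hence there is a largest zero a, and some ε > 0 such that a is the only zero with Re z > a -
ε.

The density p. Write Ai'/Ai = 1/(z - a) + r(z) - √(z + β), where the shift β > 0 makes the root
holomorphic on Re z > a - ε. There r is holomorphic too, and r' = O(|z|^{-3/2}) is integrable on
vertical lines. Inverting term by term, S(u) = u e^{au} + e^{-βu}(4πu)^{-1/2} + remainder. A line to
the left of a makes the remainder O(e^{(a-ε/2)u}); the line Re z = 1/u makes it O(u^{1/4}) near 0.
Both asymptotics of p follow.

The function g. For x → -∞ the contour is pushed left past the simple pole of 1/Ai at a, so that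
G(x) e^{ax} → 1/Ai'(a) (`tendsto_airyRecip_atBot`). For x → +∞ the exponent 2z^{3/2}/3 - zx has its
saddle at z = x², and Laplace's method gives G(x) ~ 2x e^{-x³/3} (`tendsto_airyRecip_atTop`).

The intensity. Up to scaling, φ is N(x) = ∫ G(x+t) S(t)/G(x) dt. For x = -Y and t = Yv the factors
e^{at} cancel and the integrand divided by Y tends to v on v < 1 and to 0 on v > 1, so N ~ x²/2. For
x = X and t = v/X² the ratio of G's tends to e^{-v} and only the singularity of S at 0 is seen, so N
~ (2X)^{-1} (`tendsto_normIntensity_atBot`, `tendsto_normIntensity_atTop`). Dominated convergence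
justifies both limits, and k³ = 2 turns them into 2t² and 1/t. -/

/-! ### Integrals of exponentials of cubics -/

/-- Beyond r = 3(2M+1) the cubic beats the quadratic term; below it everything is bounded. The
resulting majorant e^{-r} is uniform over coefficients of size at most M, as differentiation under
the integral requires. -/
lemma cubic_bound {M r : ℝ} (hM : 0 ≤ M) (hr : 0 ≤ r) :
    -r ^ 3 / 3 + M * r ^ 2 + M * r + M ≤ (30 * (2 * M + 1) ^ 3) - r := by
  rcases le_total (3 * (2 * M + 1)) r with h | h
  · have h1 : 0 ≤ r ^ 2 * (r - 3 * (2 * M + 1)) := mul_nonneg (sq_nonneg r) (by linarith)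
    have h2 : 0 ≤ (M + 1) * (r * (r - 1)) :=
      mul_nonneg (by linarith) (mul_nonneg hr (by linarith))
    have h3 : (0 : ℝ) ≤ M ^ 3 := by positivity
    nlinarith [sq_nonneg M]
  · have h1 : r ^ 2 ≤ (3 * (2 * M + 1)) ^ 2 := pow_le_pow_left₀ hr h 2
    have h2 : M * r ^ 2 ≤ M * (3 * (2 * M + 1)) ^ 2 := mul_le_mul_of_nonneg_left h1 hM
    have h3 : (M + 1) * r ≤ (M + 1) * (3 * (2 * M + 1)) :=
      mul_le_mul_of_nonneg_left h (by linarith)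
    have h4 : 0 ≤ r ^ 3 := by positivity
    have h5 : (0 : ℝ) ≤ M ^ 3 := by positivity
    nlinarith [sq_nonneg M]

lemma integrableOn_pow_mul_exp_neg (n : ℕ) :
    IntegrableOn (fun r : ℝ => r ^ n * Real.exp (-r)) (Ioi 0) := by
  have := Real.GammaIntegral_convergent (s := n + 1) (by positivity)
  refine this.congr_fun (fun r hr => ?_) measurableSet_Ioi
  simp [mul_comm]

/-- The exponential of a cubic polynomial in `r`, with decaying leading term. -/
noncomputable def cubicExp (α β γ : ℂ) (r : ℝ) : ℂ :=
  Complex.exp (-(r : ℂ) ^ 3 / 3 + α * r ^ 2 + β * r + γ)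

lemma norm_cubicExp_le {α β γ : ℂ} {M r : ℝ} (hr : 0 ≤ r)
    (hα : ‖α‖ ≤ M) (hβ : ‖β‖ ≤ M) (hγ : ‖γ‖ ≤ M) :
    ‖cubicExp α β γ r‖ ≤ Real.exp (30 * (2 * M + 1) ^ 3) * Real.exp (-r) := by
  have hM : 0 ≤ M := (norm_nonneg _).trans hα
  rw [cubicExp, Complex.norm_exp, ← Real.exp_add]
  apply Real.exp_le_exp.2
  have e1 : (α * (r : ℂ) ^ 2).re ≤ M * r ^ 2 := by
    refine (Complex.re_le_norm _).trans ?_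
    rw [norm_mul, norm_pow, Complex.norm_real, Real.norm_of_nonneg hr]
    gcongr
  have e2 : (β * (r : ℂ)).re ≤ M * r := by
    refine (Complex.re_le_norm _).trans ?_
    rw [norm_mul, Complex.norm_real, Real.norm_of_nonneg hr]
    gcongr
  have e3 : γ.re ≤ M := (Complex.re_le_norm _).trans hγ
  have e4 : (-(r : ℂ) ^ 3 / 3).re = -r ^ 3 / 3 := by
    rw [show (-(r : ℂ) ^ 3 / 3) = ((-r ^ 3 / 3 : ℝ) : ℂ) by push_cast; ring, Complex.ofReal_re]
  have := cubic_bound hM hr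
  simp only [Complex.add_re, e4]
  linarith

@[fun_prop]
lemma continuous_cubicExp (α β γ : ℂ) : Continuous (cubicExp α β γ) := by
  unfold cubicExp; fun_prop

lemma integrableOn_pow_mul_cubicExp (n : ℕ) (α β γ : ℂ) :
    IntegrableOn (fun r : ℝ => (r : ℂ) ^ n * cubicExp α β γ r) (Ioi 0) := by
  set M := max ‖α‖ (max ‖β‖ ‖γ‖)
  refine Integrable.mono' ((integrableOn_pow_mul_exp_neg n).const_mul
    (Real.exp (30 * (2 * M + 1) ^ 3))) (by fun_prop) ?_
  refine (ae_restrict_iff' measurableSet_Ioi).2 (Eventually.of_forall fun r hr => ?_)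
  have hr' : (0 : ℝ) ≤ r := le_of_lt hr
  have := norm_cubicExp_le (r := r) (M := M) hr' (le_max_left _ _ : ‖α‖ ≤ M)
    ((le_max_left _ _).trans (le_max_right _ _) : ‖β‖ ≤ M)
    ((le_max_right _ _).trans (le_max_right _ _) : ‖γ‖ ≤ M)
  rw [norm_mul, norm_pow, Complex.norm_real, Real.norm_of_nonneg hr']
  calc r ^ n * ‖cubicExp α β γ r‖
      ≤ r ^ n * (Real.exp (30 * (2 * M + 1) ^ 3) * Real.exp (-r)) := by gcongr
    _ = Real.exp (30 * (2 * M + 1) ^ 3) * (r ^ n * Real.exp (-r)) := by ring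

/-- Stated for coefficients depending on a parameter because it serves twice: for the derivative of
Ai in z, and for moving the vertex of the contour. -/
lemma hasDerivAt_integral_cubicExp (n : ℕ) {α β γ α' β' γ' : ℂ → ℂ}
    (hα : ∀ c, HasDerivAt α (α' c) c) (hβ : ∀ c, HasDerivAt β (β' c) c)
    (hγ : ∀ c, HasDerivAt γ (γ' c) c)
    (cα : Continuous α') (cβ : Continuous β') (cγ : Continuous γ') (c : ℂ) :
    HasDerivAt (fun c => ∫ r in Ioi (0 : ℝ), (r : ℂ) ^ n * cubicExp (α c) (β c) (γ c) r)
      (∫ r in Ioi (0 : ℝ), (r : ℂ) ^ n * ((α' c * r ^ 2 + β' c * r + γ' c) *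
        cubicExp (α c) (β c) (γ c) r)) c := by
  have bdd : ∀ f : ℂ → ℂ, Continuous f → ∃ M, ∀ x ∈ Metric.closedBall c 1, ‖f x‖ ≤ M :=
    fun f hf => (isCompact_closedBall c 1).exists_bound_of_continuousOn hf.continuousOn
  have cont : ∀ {f f' : ℂ → ℂ}, (∀ c, HasDerivAt f (f' c) c) → Continuous f := fun h =>
    continuous_iff_continuousAt.2 fun c => (h c).continuousAt
  obtain ⟨M1, h1⟩ := bdd α (cont hα)
  obtain ⟨M2, h2⟩ := bdd β (cont hβ)
  obtain ⟨M3, h3⟩ := bdd γ (cont hγ)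
  obtain ⟨M4, h4⟩ := bdd α' cα
  obtain ⟨M5, h5⟩ := bdd β' cβ
  obtain ⟨M6, h6⟩ := bdd γ' cγ
  have mem : Metric.ball c 1 ⊆ Metric.closedBall c 1 := Metric.ball_subset_closedBall
  set M := max M1 (max M2 M3) with hM
  set E := Real.exp (30 * (2 * M + 1) ^ 3) with hE
  refine (hasDerivAt_integral_of_dominated_loc_of_deriv_le (𝕜 := ℂ)
    (bound := fun r => E * (M4 * (r ^ (n + 2) * Real.exp (-r)) + M5 * (r ^ (n + 1) * Real.exp (-r))
      + M6 * (r ^ n * Real.exp (-r))))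
    (F := fun c r => (r : ℂ) ^ n * cubicExp (α c) (β c) (γ c) r)
    (F' := fun c r => (r : ℂ) ^ n * ((α' c * r ^ 2 + β' c * r + γ' c) *
        cubicExp (α c) (β c) (γ c) r))
    (Metric.ball_mem_nhds c one_pos) ?_ (integrableOn_pow_mul_cubicExp n _ _ _) ?_ ?_ ?_ ?_).2
  · exact Eventually.of_forall fun x => by fun_prop
  · fun_prop
  · refine (ae_restrict_iff' measurableSet_Ioi).2 (Eventually.of_forall fun r hr x hx => ?_)
    have hr' : (0 : ℝ) ≤ r := le_of_lt hr
    have hx' := mem hx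
    have hb := norm_cubicExp_le (M := M) hr' ((h1 x hx').trans (le_max_left _ _))
      ((h2 x hx').trans ((le_max_left _ _).trans (le_max_right _ _)))
      ((h3 x hx').trans ((le_max_right _ _).trans (le_max_right _ _)))
    have hp : ‖α' x * (r : ℂ) ^ 2 + β' x * r + γ' x‖ ≤ M4 * r ^ 2 + M5 * r + M6 := by
      refine (norm_add_le _ _).trans (add_le_add ((norm_add_le _ _).trans (add_le_add ?_ ?_))
        (h6 x hx'))
      · rw [norm_mul, norm_pow, Complex.norm_real, Real.norm_of_nonneg hr']
        gcongr; exact h4 x hx'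
      · rw [norm_mul, Complex.norm_real, Real.norm_of_nonneg hr']
        gcongr; exact h5 x hx'
    rw [norm_mul, norm_mul, norm_pow, Complex.norm_real, Real.norm_of_nonneg hr']
    calc r ^ n * (‖α' x * (r : ℂ) ^ 2 + β' x * r + γ' x‖ * ‖cubicExp (α x) (β x) (γ x) r‖)
        ≤ r ^ n * ((M4 * r ^ 2 + M5 * r + M6) * (E * Real.exp (-r))) := by
          have := (norm_nonneg _).trans hp
          gcongr
      _ = _ := by ring
  · exact ((((integrableOn_pow_mul_exp_neg (n + 2)).const_mul M4).add
      ((integrableOn_pow_mul_exp_neg (n + 1)).const_mul M5)).add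
      ((integrableOn_pow_mul_exp_neg n).const_mul M6)).const_mul E
  · refine Eventually.of_forall fun r x _ => ?_
    refine HasDerivAt.const_mul _ ?_
    have := ((((hα x).mul_const ((r : ℂ) ^ 2)).const_add (-(r : ℂ) ^ 3 / 3)).fun_add
      ((hβ x).mul_const (r : ℂ))).fun_add (hγ x)
    exact this.cexp.congr_deriv (by rw [cubicExp]; ring)

lemma tendsto_pow_mul_cubicExp (n : ℕ) (α β γ : ℂ) :
    Tendsto (fun r : ℝ => (r : ℂ) ^ n * cubicExp α β γ r) atTop (𝓝 0) := by
  set M := max ‖α‖ (max ‖β‖ ‖γ‖)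
  have h : Tendsto (fun r : ℝ => Real.exp (30 * (2 * M + 1) ^ 3) * (r ^ n * Real.exp (-r)))
      atTop (𝓝 0) := by
    simpa using (Real.tendsto_pow_mul_exp_neg_atTop_nhds_zero n).const_mul
      (Real.exp (30 * (2 * M + 1) ^ 3))
  refine squeeze_zero_norm' ?_ h
  filter_upwards [eventually_ge_atTop 0] with r hr
  have := norm_cubicExp_le (r := r) (M := M) hr (le_max_left _ _ : ‖α‖ ≤ M)
    ((le_max_left _ _).trans (le_max_right _ _) : ‖β‖ ≤ M)
    ((le_max_right _ _).trans (le_max_right _ _) : ‖γ‖ ≤ M)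
  rw [norm_mul, norm_pow, Complex.norm_real, Real.norm_of_nonneg hr]
  calc r ^ n * ‖cubicExp α β γ r‖
      ≤ r ^ n * (Real.exp (30 * (2 * M + 1) ^ 3) * Real.exp (-r)) := by gcongr
    _ = Real.exp (30 * (2 * M + 1) ^ 3) * (r ^ n * Real.exp (-r)) := by ring

/-- The integrand is an exact derivative, so only the value at r = 0 survives. This is the
integration by parts behind Airy's equation and behind the independence of the vertex. -/
lemma integral_deriv_cubicExp (α β γ : ℂ) :
    ∫ r in Ioi (0 : ℝ), (-(r : ℂ) ^ 2 + 2 * α * r + β) * cubicExp α β γ r = -Complex.exp γ := by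
  have hd : ∀ r ∈ Ici (0 : ℝ), HasDerivAt (cubicExp α β γ)
      ((-(r : ℂ) ^ 2 + 2 * α * r + β) * cubicExp α β γ r) r := by
    intro r _
    have h0 : HasDerivAt (fun r : ℝ => (r : ℂ)) 1 r := Complex.ofRealCLM.hasDerivAt
    have := (((((h0.fun_pow 3).fun_neg.div_const 3).fun_add ((h0.fun_pow 2).const_mul α)).fun_add
      (h0.const_mul β)).add_const γ).cexp
    exact this.congr_deriv (by rw [cubicExp]; push_cast; ring)
  have hi : IntegrableOn (fun r : ℝ => (-(r : ℂ) ^ 2 + 2 * α * r + β) * cubicExp α β γ r)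
      (Ioi 0) := by
    have := (((integrableOn_pow_mul_cubicExp 2 α β γ).const_mul (-1)).add
      ((integrableOn_pow_mul_cubicExp 1 α β γ).const_mul (2 * α))).add
      ((integrableOn_pow_mul_cubicExp 0 α β γ).const_mul β)
    refine IntegrableOn.congr_fun this (fun r _ => ?_) measurableSet_Ioi
    simp only [Pi.add_apply]
    ring
  rw [integral_Ioi_of_hasDerivAt_of_tendsto' hd hi
    (by simpa using tendsto_pow_mul_cubicExp 0 α β γ)]
  simp [cubicExp]

/-! ### Airy's equation and conjugation symmetry -/

/-- `rayInt ω n z = ∫ r ^ n exp (- r ^ 3 / 3 - z ω r) dr` over the half line. -/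
noncomputable def rayInt (ω : ℂ) (n : ℕ) (z : ℂ) : ℂ :=
  ∫ r in Ioi (0 : ℝ), (r : ℂ) ^ n * cubicExp 0 (-(ω * z)) 0 r

lemma hasDerivAt_rayInt (ω : ℂ) (n : ℕ) (z : ℂ) :
    HasDerivAt (rayInt ω n) (-ω * rayInt ω (n + 1) z) z := by
  have := hasDerivAt_integral_cubicExp n (α := fun _ => 0) (β := fun z => -(ω * z))
    (γ := fun _ => 0) (α' := fun _ => 0) (β' := fun _ => -ω) (γ' := fun _ => 0)
    (fun c => hasDerivAt_const _ _) (fun c => ((hasDerivAt_id c).const_mul ω).fun_neg.congr_deriv (by simp))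
    (fun c => hasDerivAt_const _ _) continuous_const continuous_const continuous_const z
  refine this.congr_deriv ?_
  rw [rayInt, ← integral_const_mul]
  congr 1; ext r; ring

lemma rayInt_two (ω z : ℂ) : rayInt ω 2 z = 1 - ω * z * rayInt ω 0 z := by
  have h := integral_deriv_cubicExp 0 (-(ω * z)) 0
  have h2 := integrableOn_pow_mul_cubicExp 2 0 (-(ω * z)) 0
  have h0 := integrableOn_pow_mul_cubicExp 0 0 (-(ω * z)) 0
  have : ∀ r : ℝ, (-(r : ℂ) ^ 2 + 2 * 0 * r + -(ω * z)) * cubicExp 0 (-(ω * z)) 0 r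
      = -((r : ℂ) ^ 2 * cubicExp 0 (-(ω * z)) 0 r)
        - ω * z * ((r : ℂ) ^ 0 * cubicExp 0 (-(ω * z)) 0 r) := fun r => by ring
  simp only [this] at h
  rw [integral_sub (Integrable.fun_neg h2) (h0.const_mul _), integral_neg, integral_const_mul] at h
  simp only [rayInt]
  rw [Complex.exp_zero] at h
  linear_combination -h

/-- The sixth root of unity `e ^ (iπ/3)`. -/
noncomputable def sixthRoot : ℂ := Complex.exp (Complex.I * Real.pi / 3)

/-- The sixth root of unity `e ^ (-iπ/3)`. -/
noncomputable def sixthRoot' : ℂ := Complex.exp (-(Complex.I * Real.pi / 3))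

lemma sixthRoot_cube : sixthRoot ^ 3 = -1 := by
  rw [sixthRoot, ← Complex.exp_nat_mul, ← Complex.exp_pi_mul_I]; congr 1; push_cast; ring

lemma sixthRoot'_cube : sixthRoot' ^ 3 = -1 := by
  rw [sixthRoot', Complex.exp_neg, inv_pow, ← sixthRoot, sixthRoot_cube]; norm_num

lemma conj_sixthRoot : (starRingEnd ℂ) sixthRoot = sixthRoot' := by
  rw [sixthRoot, sixthRoot', ← Complex.exp_conj]
  simp [neg_div, Complex.conj_ofNat]

lemma sixthRoot_eq : sixthRoot = 1 / 2 + (Real.sqrt 3 / 2 : ℝ) * Complex.I := by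
  rw [sixthRoot, show Complex.I * (Real.pi : ℂ) / 3 = ((Real.pi / 3 : ℝ) : ℂ) * Complex.I by
    push_cast; ring, Complex.exp_mul_I, ← Complex.ofReal_cos, ← Complex.ofReal_sin,
    Real.cos_pi_div_three, Real.sin_pi_div_three]
  push_cast; ring

lemma airyAi_eq_rayInt (z : ℂ) : airyAi z = (2 * (Real.pi : ℂ) * Complex.I)⁻¹ *
    (sixthRoot * rayInt sixthRoot 0 z - sixthRoot' * rayInt sixthRoot' 0 z) := by
  rw [airyAi]
  congr 1
  simp only [rayInt]
  rw [← integral_const_mul, ← integral_const_mul, ← integral_sub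
    ((integrableOn_pow_mul_cubicExp 0 _ _ _).const_mul _)
    ((integrableOn_pow_mul_cubicExp 0 _ _ _).const_mul _)]
  congr 1; ext r
  rw [← sixthRoot, ← sixthRoot']
  simp only [cubicExp, pow_zero, one_mul]
  congr 3 <;> ring

/-- The derivative of the Airy function, as a contour integral. -/
noncomputable def airyAi' (z : ℂ) : ℂ := (2 * (Real.pi : ℂ) * Complex.I)⁻¹ *
    (sixthRoot' ^ 2 * rayInt sixthRoot' 1 z - sixthRoot ^ 2 * rayInt sixthRoot 1 z)

lemma hasDerivAt_airyAi (z : ℂ) : HasDerivAt airyAi (airyAi' z) z := by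
  have h : airyAi = fun z => (2 * (Real.pi : ℂ) * Complex.I)⁻¹ *
      (sixthRoot * rayInt sixthRoot 0 z - sixthRoot' * rayInt sixthRoot' 0 z) :=
    funext airyAi_eq_rayInt
  rw [h]
  refine HasDerivAt.congr_deriv ((((hasDerivAt_rayInt sixthRoot 0 z).const_mul sixthRoot).fun_sub
    ((hasDerivAt_rayInt sixthRoot' 0 z).const_mul sixthRoot')).const_mul
    ((2 * (Real.pi : ℂ) * Complex.I)⁻¹)) ?_
  rw [airyAi']; ring

lemma hasDerivAt_airyAi' (z : ℂ) : HasDerivAt airyAi' (z * airyAi z) z := by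
  refine HasDerivAt.congr_deriv ((((hasDerivAt_rayInt sixthRoot' 1 z).const_mul (sixthRoot' ^ 2)).fun_sub
    ((hasDerivAt_rayInt sixthRoot 1 z).const_mul (sixthRoot ^ 2))).const_mul
    ((2 * (Real.pi : ℂ) * Complex.I)⁻¹)) ?_
  rw [airyAi_eq_rayInt, rayInt_two, rayInt_two]
  -- As ω³ = -1 on both rays, the two boundary terms at r = 0 cancel, leaving y'' = zy.
  linear_combination (2 * (Real.pi : ℂ) * Complex.I)⁻¹ *
    ((1 - sixthRoot * z * rayInt sixthRoot 0 z) * sixthRoot_cube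
    - (1 - sixthRoot' * z * rayInt sixthRoot' 0 z) * sixthRoot'_cube)

lemma deriv_airyAi : deriv airyAi = airyAi' := funext fun z => (hasDerivAt_airyAi z).deriv

lemma differentiable_airyAi : Differentiable ℂ airyAi :=
  fun z => (hasDerivAt_airyAi z).differentiableAt

lemma conj_rayInt (ω : ℂ) (n : ℕ) (z : ℂ) : (starRingEnd ℂ) (rayInt ω n z)
    = rayInt ((starRingEnd ℂ) ω) n ((starRingEnd ℂ) z) := by
  rw [rayInt, rayInt, ← integral_conj]
  congr 1; ext r
  simp [cubicExp, ← Complex.exp_conj, Complex.conj_ofNat]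

lemma airyAi_conj (z : ℂ) : airyAi ((starRingEnd ℂ) z) = (starRingEnd ℂ) (airyAi z) := by
  have h' : (starRingEnd ℂ) sixthRoot' = sixthRoot := by
    rw [← conj_sixthRoot, Complex.conj_conj]
  rw [airyAi_eq_rayInt, airyAi_eq_rayInt]
  simp only [map_mul, map_sub, conj_rayInt, conj_sixthRoot, h', map_inv₀, Complex.conj_I,
    Complex.conj_ofReal, map_ofNat]
  rw [mul_neg, inv_neg]; ring

lemma airyAi'_conj (z : ℂ) : airyAi' ((starRingEnd ℂ) z) = (starRingEnd ℂ) (airyAi' z) := by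
  have h' : (starRingEnd ℂ) sixthRoot' = sixthRoot := by
    rw [← conj_sixthRoot, Complex.conj_conj]
  rw [airyAi', airyAi']
  simp only [map_mul, map_sub, conj_rayInt, conj_sixthRoot, h', map_inv₀, Complex.conj_I,
    Complex.conj_ofReal, map_ofNat, map_pow]
  rw [mul_neg, inv_neg]; ring

/-! ### Deforming the contour to the vertical line through the saddle -/

/-- The integral of `exp (t ^ 3 / 3 - z t)` over the ray from `c` in direction `ω`. -/
noncomputable def shiftedRay (ω z c : ℂ) : ℂ :=
  ∫ r in Ioi (0 : ℝ), cubicExp (c * ω ^ 2) ((c ^ 2 - z) * ω) (c ^ 3 / 3 - z * c) r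

/-- The derivative is minus the integrand at the starting point c and does not depend on the
direction ω. The difference of two rays issuing from c is therefore constant in c, which makes the
vertex of the Airy contour free. -/
lemma hasDerivAt_shiftedRay {ω : ℂ} (hω : ω ^ 3 = -1) (z c : ℂ) :
    HasDerivAt (fun c => ω * shiftedRay ω z c) (-Complex.exp (c ^ 3 / 3 - z * c)) c := by
  have := hasDerivAt_integral_cubicExp 0 (α := fun c => c * ω ^ 2) (β := fun c => (c ^ 2 - z) * ω)
    (γ := fun c => c ^ 3 / 3 - z * c) (α' := fun _ => ω ^ 2) (β' := fun c => 2 * c * ω)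
    (γ' := fun c => c ^ 2 - z)
    (fun c => by simpa using (hasDerivAt_id c).mul_const (ω ^ 2))
    (fun c => by simpa using (((hasDerivAt_id c).fun_pow 2).sub_const z).mul_const ω)
    (fun c => by
      exact ((((hasDerivAt_id c).fun_pow 3).div_const 3).fun_sub
        ((hasDerivAt_id c).const_mul z)).congr_deriv (by simp))
    (by fun_prop) (by fun_prop) (by fun_prop) c
  have h2 := this.const_mul ω
  simp only [pow_zero, one_mul] at h2
  refine h2.congr_deriv ?_
  rw [← integral_const_mul, ← integral_deriv_cubicExp (c * ω ^ 2) ((c ^ 2 - z) * ω)]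
  congr 1; ext r
  linear_combination ((r : ℂ) ^ 2 * cubicExp (c * ω ^ 2) ((c ^ 2 - z) * ω)
    (c ^ 3 / 3 - z * c) r) * hω

lemma airyAi_eq_shiftedRay (z c : ℂ) : airyAi z = (2 * (Real.pi : ℂ) * Complex.I)⁻¹ *
    (sixthRoot * shiftedRay sixthRoot z c - sixthRoot' * shiftedRay sixthRoot' z c) := by
  have hd : ∀ c, HasDerivAt (fun c => sixthRoot * shiftedRay sixthRoot z c
      - sixthRoot' * shiftedRay sixthRoot' z c) 0 c := fun c => by
    simpa using (hasDerivAt_shiftedRay sixthRoot_cube z c).fun_sub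
      (hasDerivAt_shiftedRay sixthRoot'_cube z c)
  have := is_const_of_deriv_eq_zero (fun c => (hd c).differentiableAt) (fun c => (hd c).deriv) c 0
  rw [this, airyAi_eq_rayInt]
  simp only [rayInt, shiftedRay]
  congr 3 <;> · congr 1; ext r; simp [mul_comm]

/-- The segment from `e ^ (iπ/3)` to `i`. -/
noncomputable def rotPath (t : ℝ) : ℂ := (1 - t) * sixthRoot + t * Complex.I

lemma rotPath_re (t : ℝ) : (rotPath t).re = (1 - t) / 2 := by
  simp [rotPath, sixthRoot_eq]; ring

lemma rotPath_im (t : ℝ) : (rotPath t).im = (1 - t) * (Real.sqrt 3 / 2) + t := by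
  simp [rotPath, sixthRoot_eq]

lemma sqrt_three_bounds : (1 : ℝ) ≤ Real.sqrt 3 ∧ Real.sqrt 3 ≤ 2 ∧ Real.sqrt 3 ^ 2 = 3 := by
  refine ⟨?_, ?_, Real.sq_sqrt (by norm_num)⟩
  · rw [Real.le_sqrt] <;> norm_num
  · rw [Real.sqrt_le_left] <;> norm_num

lemma rotPath_im_sq {t : ℝ} (ht : t ∈ Icc (0 : ℝ) 1) : 3 / 4 ≤ (rotPath t).im ^ 2 := by
  obtain ⟨h1, h2, h3⟩ := sqrt_three_bounds
  have h : Real.sqrt 3 / 2 ≤ (rotPath t).im := by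
    rw [rotPath_im]; nlinarith [ht.1, ht.2]
  nlinarith

lemma rotPath_re_sq {t : ℝ} (ht : t ∈ Icc (0 : ℝ) 1) : (rotPath t).re ^ 2 ≤ 1 / 4 := by
  rw [rotPath_re]; nlinarith [ht.1, ht.2]

lemma norm_rotPath_le {t : ℝ} (ht : t ∈ Icc (0 : ℝ) 1) : ‖rotPath t‖ ≤ 2 := by
  obtain ⟨h1, h2, h3⟩ := sqrt_three_bounds
  have e1 := Complex.norm_le_abs_re_add_abs_im (rotPath t)
  have e2 : |(rotPath t).re| ≤ 1 := by
    rw [rotPath_re, abs_le]; constructor <;> linarith [ht.1, ht.2]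
  have e3 : |(rotPath t).im| ≤ 1 := by
    rw [rotPath_im, abs_le]; constructor <;> nlinarith [ht.1, ht.2]
  linarith

/-- On the segment Re λ² ≤ -1/2 and Re λ³ ≤ 0. The quadratic term alone supplies the decay, since at
λ = i the cubic one is purely oscillatory. -/
lemma norm_exp_rotPath_le {w t r : ℝ} (hw : 0 ≤ w) (ht : t ∈ Icc (0 : ℝ) 1) (hr : 0 ≤ r) :
    ‖Complex.exp (w * rotPath t ^ 2 * r ^ 2 + rotPath t ^ 3 * r ^ 3 / 3)‖
      ≤ Real.exp (-(w / 2) * r ^ 2) := by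
  rw [Complex.norm_exp]
  apply Real.exp_le_exp.2
  have hx := rotPath_re_sq ht
  have hy := rotPath_im_sq ht
  have hx0 : 0 ≤ (rotPath t).re := by rw [rotPath_re]; linarith [ht.2]
  set l := rotPath t
  have e : ((w : ℂ) * l ^ 2 * r ^ 2 + l ^ 3 * r ^ 3 / 3).re
      = w * (l.re ^ 2 - l.im ^ 2) * r ^ 2 + l.re * (l.re ^ 2 - 3 * l.im ^ 2) * r ^ 3 / 3 := by
    rw [show (w : ℂ) * l ^ 2 * r ^ 2 + l ^ 3 * r ^ 3 / 3
      = ((w * r ^ 2 : ℝ) : ℂ) * l ^ 2 + ((r ^ 3 / 3 : ℝ) : ℂ) * l ^ 3 by push_cast; ring]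
    simp only [Complex.add_re, pow_succ, pow_zero, one_mul,
      Complex.mul_re, Complex.mul_im, Complex.ofReal_re, Complex.ofReal_im]
    ring
  rw [e]
  have h1 : w * r ^ 2 * (l.re ^ 2 - l.im ^ 2) ≤ w * r ^ 2 * (-1 / 2) :=
    mul_le_mul_of_nonneg_left (by linarith) (by positivity)
  have h2 : 0 ≤ (l.re * (r ^ 3 / 3)) * (3 * l.im ^ 2 - l.re ^ 2) :=
    mul_nonneg (by positivity) (by linarith)
  nlinarith

lemma integrable_pow_mul_exp_neg_mul_sq {b : ℝ} (hb : 0 < b) (n : ℕ) :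
    Integrable fun x : ℝ => x ^ n * Real.exp (-b * x ^ 2) := by
  have := integrable_rpow_mul_exp_neg_mul_sq hb (s := n) (by
    have : (0 : ℝ) ≤ n := n.cast_nonneg
    linarith)
  simpa using this

lemma tendsto_mul_exp_rotPath {w t : ℝ} (hw : 0 < w) (ht : t ∈ Icc (0 : ℝ) 1) :
    Tendsto (fun r : ℝ => (r : ℂ) *
      Complex.exp (w * rotPath t ^ 2 * r ^ 2 + rotPath t ^ 3 * r ^ 3 / 3)) atTop (𝓝 0) := by
  have h := (rpow_mul_exp_neg_mul_sq_isLittleO_exp_neg (b := w / 2) (by positivity) 1)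
  have h' : Tendsto (fun r : ℝ => r * Real.exp (-(w / 2) * r ^ 2)) atTop (𝓝 0) := by
    have := h.trans_tendsto (by
      have := (Real.tendsto_exp_atBot).comp
        (tendsto_id.const_mul_atTop_of_neg (show -(1 / 2 : ℝ) < 0 by norm_num))
      exact this)
    simpa using this
  refine squeeze_zero_norm' ?_ h'
  filter_upwards [eventually_ge_atTop 0] with r hr
  rw [norm_mul, Complex.norm_real, Real.norm_of_nonneg hr]
  exact mul_le_mul_of_nonneg_left (norm_exp_rotPath_le hw.le ht hr) hr

/-- Rotation of a ray without Cauchy's theorem: for F entire, ∂/∂t [λ F(λr)] = λ' ∂/∂r [r F(λr)].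
The right side integrates to 0 over the half line, so the integral along the direction λ(t) is
constant in t. -/
lemma integral_rotPath_const {w : ℝ} (hw : 0 < w) :
    sixthRoot * ∫ r in Ioi (0 : ℝ), Complex.exp (w * sixthRoot ^ 2 * r ^ 2 - r ^ 3 / 3)
      = Complex.I * ∫ r in Ioi (0 : ℝ), Complex.exp (-w * r ^ 2 - Complex.I * r ^ 3 / 3) := by
  set G : ℝ → ℝ → ℂ := fun t r => rotPath t *
    Complex.exp (w * rotPath t ^ 2 * r ^ 2 + rotPath t ^ 3 * r ^ 3 / 3) with hG
  set G' : ℝ → ℝ → ℂ := fun t r => (Complex.I - sixthRoot) *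
    ((1 + 2 * w * rotPath t ^ 2 * r ^ 2 + rotPath t ^ 3 * r ^ 3) *
    Complex.exp (w * rotPath t ^ 2 * r ^ 2 + rotPath t ^ 3 * r ^ 3 / 3)) with hG'
  have hcont : Continuous rotPath := by unfold rotPath; fun_prop
  have hder : ∀ t, HasDerivAt rotPath (Complex.I - sixthRoot) t := fun t => by
    have h0 : HasDerivAt (fun r : ℝ => (r : ℂ)) 1 t := Complex.ofRealCLM.hasDerivAt
    exact (((h0.const_sub 1).mul_const sixthRoot).fun_add (h0.mul_const Complex.I)).congr_deriv
      (by ring)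
  have hw2 : (0 : ℝ) < w / 2 := by positivity
  have hgi := integrable_pow_mul_exp_neg_mul_sq hw2
  have hint : ∀ t ∈ Icc (0 : ℝ) 1, Integrable (G t) (volume.restrict (Ioi 0)) := fun t ht => by
    refine Integrable.mono' ((hgi 0).const_mul 2).integrableOn (by fun_prop) ?_
    refine (ae_restrict_iff' measurableSet_Ioi).2 (Eventually.of_forall fun r hr => ?_)
    rw [norm_mul]
    have := norm_exp_rotPath_le hw.le ht (le_of_lt hr)
    have := norm_rotPath_le ht
    rw [pow_zero, one_mul]
    gcongr
  set bd : ℝ → ℝ := fun r => 3 * (r ^ 0 * Real.exp (-(w / 2) * r ^ 2)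
    + 8 * w * (r ^ 2 * Real.exp (-(w / 2) * r ^ 2)) + 8 * (r ^ 3 * Real.exp (-(w / 2) * r ^ 2)))
  have hbd : Integrable bd (volume.restrict (Ioi 0)) :=
    ((((hgi 0).add ((hgi 2).const_mul (8 * w))).add ((hgi 3).const_mul 8)).const_mul 3).integrableOn
  have hle : ∀ r ∈ Ioi (0 : ℝ), ∀ t ∈ Icc (0 : ℝ) 1, ‖G' t r‖ ≤ bd r := fun r hr t ht => by
    have hr' : (0 : ℝ) ≤ r := le_of_lt hr
    have h1 := norm_exp_rotPath_le hw.le ht hr'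
    have h2 := norm_rotPath_le ht
    have h3 : ‖Complex.I - sixthRoot‖ ≤ 3 := by
      refine (norm_sub_le _ _).trans ?_
      have := norm_rotPath_le (t := 0) (by simp)
      simp only [rotPath, Complex.ofReal_zero, sub_zero, one_mul, zero_mul, add_zero] at this
      rw [Complex.norm_I]; linarith
    have h4 : ‖(1 + 2 * (w : ℂ) * rotPath t ^ 2 * r ^ 2 + rotPath t ^ 3 * r ^ 3)‖
        ≤ 1 + 2 * w * 2 ^ 2 * r ^ 2 + 2 ^ 3 * r ^ 3 := by
      refine (norm_add₃_le).trans ?_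
      simp only [norm_mul, norm_pow, Complex.norm_real, Real.norm_of_nonneg hr',
        Real.norm_of_nonneg hw.le, norm_one, Complex.norm_ofNat]
      gcongr
    simp only [hG', norm_mul]
    calc _ ≤ 3 * ((1 + 2 * w * 2 ^ 2 * r ^ 2 + 2 ^ 3 * r ^ 3) * Real.exp (-(w / 2) * r ^ 2)) := by
          gcongr
      _ = bd r := by simp only [bd]; ring
  have hd : ∀ t ∈ Ioo (0 : ℝ) 1, HasDerivAt (fun t => ∫ r in Ioi (0 : ℝ), G t r)
      (∫ r in Ioi (0 : ℝ), G' t r) t := fun t ht =>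
    (hasDerivAt_integral_of_dominated_loc_of_deriv_le (𝕜 := ℝ) (bound := bd) (F := G) (F' := G')
      (Ioo_mem_nhds ht.1 ht.2) (Eventually.of_forall fun x => by fun_prop)
      (hint t (Ioo_subset_Icc_self ht)) (by fun_prop)
      ((ae_restrict_iff' measurableSet_Ioi).2 (Eventually.of_forall fun r hr x hx =>
        hle r hr x (Ioo_subset_Icc_self hx))) hbd
      (Eventually.of_forall fun r x _ => by
        have h := ((hder x).fun_pow 2).const_mul (w : ℂ) |>.mul_const ((r : ℂ) ^ 2)
        have h' := (((hder x).fun_pow 3).mul_const ((r : ℂ) ^ 3)).div_const 3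
        exact ((hder x).fun_mul (h.fun_add h').cexp).congr_deriv (by
          simp only [hG']; push_cast; ring))).2
  have hzero : ∀ t ∈ Icc (0 : ℝ) 1, ∫ r in Ioi (0 : ℝ), G' t r = 0 := fun t ht => by
    simp only [hG']
    rw [integral_const_mul]
    refine mul_eq_zero_of_right _ ?_
    have hd : ∀ r ∈ Ici (0 : ℝ), HasDerivAt (fun r : ℝ => (r : ℂ) *
        Complex.exp (w * rotPath t ^ 2 * r ^ 2 + rotPath t ^ 3 * r ^ 3 / 3))
        ((1 + 2 * w * rotPath t ^ 2 * r ^ 2 + rotPath t ^ 3 * r ^ 3) *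
        Complex.exp (w * rotPath t ^ 2 * r ^ 2 + rotPath t ^ 3 * r ^ 3 / 3)) r := fun r _ => by
      have h0 : HasDerivAt (fun r : ℝ => (r : ℂ)) 1 r := Complex.ofRealCLM.hasDerivAt
      have h := (h0.fun_pow 2).const_mul (w * rotPath t ^ 2)
      have h' := ((h0.fun_pow 3).const_mul (rotPath t ^ 3)).div_const 3
      exact (h0.fun_mul (h.fun_add h').cexp).congr_deriv (by push_cast; ring)
    rw [integral_Ioi_of_hasDerivAt_of_tendsto' hd ?_ (tendsto_mul_exp_rotPath hw ht)]
    · simp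
    · have hne : Complex.I - sixthRoot ≠ 0 := by
        intro h
        have := congrArg Complex.re h
        simp [sixthRoot_eq] at this
      have : Integrable (G' t) (volume.restrict (Ioi 0)) := Integrable.mono' hbd (by fun_prop)
        ((ae_restrict_iff' measurableSet_Ioi).2 (Eventually.of_forall fun r hr => hle r hr t ht))
      refine (this.const_mul (Complex.I - sixthRoot)⁻¹).congr (Eventually.of_forall fun r => ?_)
      simp only [hG']
      rw [inv_mul_cancel_left₀ hne]
  -- The derivative is controlled only for 0 < t < 1; continuity carries the constancy to the two
  -- endpoints.
  have hc : ContinuousOn (fun t => ∫ r in Ioi (0 : ℝ), G t r) (Icc 0 1) := by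
    refine continuousOn_of_dominated (bound := fun r => 2 * (r ^ 0 * Real.exp (-(w / 2) * r ^ 2)))
      (fun t ht => (hint t ht).1) (fun t ht => ?_) ((hgi 0).const_mul 2).integrableOn ?_
    · refine (ae_restrict_iff' measurableSet_Ioi).2 (Eventually.of_forall fun r hr => ?_)
      rw [norm_mul]
      have := norm_exp_rotPath_le hw.le ht (le_of_lt hr)
      have := norm_rotPath_le ht
      rw [pow_zero, one_mul]
      gcongr
    · refine Eventually.of_forall fun r => ?_
      fun_prop
  have hEqOn : EqOn (fun t => ∫ r in Ioi (0 : ℝ), G t r) (fun _ => ∫ r in Ioi (0 : ℝ), G (1 / 2) r)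
      (Icc 0 1) := by
    have hd0 : ∀ t ∈ Ioo (0 : ℝ) 1, HasDerivAt (fun t => ∫ r in Ioi (0 : ℝ), G t r) 0 t :=
      fun t ht => hzero t (Ioo_subset_Icc_self ht) ▸ hd t ht
    refine EqOn.of_subset_closure (s := Ioo 0 1) (fun t ht => ?_) hc continuousOn_const
      Ioo_subset_Icc_self (by rw [closure_Ioo (by norm_num)])
    exact isOpen_Ioo.is_const_of_deriv_eq_zero isPreconnected_Ioo
      (fun t ht => (hd0 t ht).differentiableAt.differentiableWithinAt)
      (fun t ht => (hd0 t ht).deriv) ht (by norm_num)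
  have hEq := (hEqOn (right_mem_Icc.2 zero_le_one)).trans (hEqOn (left_mem_Icc.2 zero_le_one)).symm
  simp only [hG, rotPath, integral_const_mul] at hEq
  simp only [Complex.ofReal_one, sub_self, zero_mul, one_mul, zero_add, Complex.ofReal_zero,
    sub_zero, add_zero, sixthRoot_cube, Complex.I_sq, Complex.I_pow_three] at hEq
  rw [show (∫ r in Ioi (0 : ℝ), Complex.exp (w * sixthRoot ^ 2 * r ^ 2 - r ^ 3 / 3))
    = ∫ r in Ioi (0 : ℝ), Complex.exp (w * sixthRoot ^ 2 * r ^ 2 + -1 * r ^ 3 / 3) by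
      congr 1; ext r; congr 1; ring, ← hEq]
  congr 2; ext r; congr 1; ring

/-! ### The Gaussian form of Ai -/

/-- The Gaussian-type integral `∫ exp (-w s² - i s³ / 3) ds` over the real line. -/
noncomputable def airyGauss (w : ℂ) : ℂ :=
  ∫ s : ℝ, Complex.exp (-w * s ^ 2 - Complex.I * s ^ 3 / 3)

lemma norm_airyGauss_integrand (w : ℂ) (s : ℝ) :
    ‖Complex.exp (-w * s ^ 2 - Complex.I * s ^ 3 / 3)‖ = Real.exp (-w.re * s ^ 2) := by
  rw [Complex.norm_exp]
  congr 1
  rw [show -w * (s : ℂ) ^ 2 - Complex.I * s ^ 3 / 3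
    = ((s ^ 2 : ℝ) : ℂ) * (-w) - ((s ^ 3 / 3 : ℝ) : ℂ) * Complex.I by push_cast; ring]
  rw [Complex.sub_re, Complex.re_ofReal_mul, Complex.re_ofReal_mul, Complex.I_re, Complex.neg_re]
  ring

lemma integrable_pow_mul_airyGauss (n : ℕ) {w : ℂ} (hw : 0 < w.re) :
    Integrable fun s : ℝ => (s : ℂ) ^ n * Complex.exp (-w * s ^ 2 - Complex.I * s ^ 3 / 3) := by
  refine (integrable_pow_mul_exp_neg_mul_sq hw n).mono (by fun_prop)
    (Eventually.of_forall fun s => ?_)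
  rw [norm_mul, norm_airyGauss_integrand, norm_mul, Real.norm_of_nonneg (Real.exp_pos _).le,
    norm_pow, norm_pow, Complex.norm_real]

/-- The derivative of `airyGauss`. -/
noncomputable def airyGauss' (w : ℂ) : ℂ :=
  -∫ s : ℝ, (s : ℂ) ^ 2 * Complex.exp (-w * s ^ 2 - Complex.I * s ^ 3 / 3)

lemma hasDerivAt_airyGauss {w : ℂ} (hw : 0 < w.re) :
    HasDerivAt airyGauss (airyGauss' w) w := by
  rw [airyGauss', ← integral_neg]
  have hw2 : 0 < w.re / 2 := by positivity
  refine (hasDerivAt_integral_of_dominated_loc_of_deriv_le (𝕜 := ℂ) (s := {z | w.re / 2 < z.re})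
    (F := fun (w : ℂ) (s : ℝ) => Complex.exp (-w * s ^ 2 - Complex.I * s ^ 3 / 3))
    (F' := fun (w : ℂ) (s : ℝ) => -((s : ℂ) ^ 2 *
      Complex.exp (-w * s ^ 2 - Complex.I * s ^ 3 / 3)))
    (bound := fun s => s ^ 2 * Real.exp (-(w.re / 2) * s ^ 2))
    ((isOpen_lt continuous_const Complex.continuous_re).mem_nhds (by simp [hw]))
    (Eventually.of_forall fun z => by fun_prop) ?_ (by fun_prop) ?_
    (integrable_pow_mul_exp_neg_mul_sq hw2 2) ?_).2
  · simpa using integrable_pow_mul_airyGauss 0 hw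
  · refine Eventually.of_forall fun s z (hz : w.re / 2 < z.re) => ?_
    rw [norm_neg, norm_mul, norm_airyGauss_integrand, norm_pow, Complex.norm_real, Real.norm_eq_abs,
      sq_abs]
    gcongr
  · refine Eventually.of_forall fun s z _ => ?_
    exact ((((hasDerivAt_id z).fun_neg.mul_const ((s : ℂ) ^ 2)).sub_const _).cexp).congr_deriv
      (by simp; ring)

/-- With the vertex at the saddle c = w of t³/3 - w²t the linear term vanishes and the value there
is -2w³/3. Rotating the two rays to ±i gives the two halves of the Gaussian integral; the lower ray
is the conjugate of the upper one. -/
lemma two_pi_mul_airyAi_sq_of_pos {w : ℝ} (hw : 0 < w) : 2 * Real.pi * airyAi ((w : ℂ) ^ 2)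
    = Complex.exp (-2 * (w : ℂ) ^ 3 / 3) * airyGauss w := by
  have key := integral_rotPath_const hw
  have h1 : ∀ ω : ℂ, ω ^ 3 = -1 → shiftedRay ω ((w : ℂ) ^ 2) w = Complex.exp (-2 * (w : ℂ) ^ 3 / 3) *
      ∫ r in Ioi (0 : ℝ), Complex.exp (w * ω ^ 2 * r ^ 2 - r ^ 3 / 3) := by
    intro ω _
    rw [shiftedRay, ← integral_const_mul]
    congr 1; ext r
    rw [cubicExp, ← Complex.exp_add]; congr 1; ring
  have key' : sixthRoot' * ∫ r in Ioi (0 : ℝ), Complex.exp (w * sixthRoot' ^ 2 * r ^ 2 - r ^ 3 / 3)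
      = -Complex.I * ∫ r in Ioi (0 : ℝ), Complex.exp (-w * r ^ 2 + Complex.I * r ^ 3 / 3) := by
    have := congrArg (starRingEnd ℂ) key
    simp only [map_mul, conj_sixthRoot, ← integral_conj, ← Complex.exp_conj, map_sub, map_div₀,
      map_pow, Complex.conj_ofReal, Complex.conj_I, map_neg, Complex.conj_ofNat] at this
    rw [this]
    congr 2; ext r; congr 1; ring
  have hsplit : airyGauss w = (∫ r in Ioi (0 : ℝ), Complex.exp (-w * r ^ 2 - Complex.I * r ^ 3 / 3))
      + ∫ r in Ioi (0 : ℝ), Complex.exp (-w * r ^ 2 + Complex.I * r ^ 3 / 3) := by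
    have hi := integrable_pow_mul_airyGauss 0 (w := w) (by simpa using hw)
    simp only [pow_zero, one_mul] at hi
    rw [airyGauss, ← integral_add_compl (s := Ioi (0 : ℝ)) measurableSet_Ioi hi, compl_Ioi]
    congr 1
    rw [← neg_zero, ← integral_comp_neg_Ioi]
    simp only [neg_zero]
    congr 1; ext r; congr 1; push_cast; ring
  rw [airyAi_eq_shiftedRay _ w, h1 _ sixthRoot_cube, h1 _ sixthRoot'_cube, hsplit]
  have hpi : (Real.pi : ℂ) ≠ 0 := by exact_mod_cast Real.pi_ne_zero
  have hc : 2 * (Real.pi : ℂ) * (2 * Real.pi * Complex.I)⁻¹ = -Complex.I := by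
    rw [mul_inv, ← mul_assoc, mul_inv_cancel₀ (by simp), one_mul, Complex.inv_I]
  rw [← mul_assoc, hc]
  linear_combination -Complex.I * Complex.exp (-2 * (w : ℂ) ^ 3 / 3) * (key - key') -
    Complex.exp (-2 * (w : ℂ) ^ 3 / 3) *
    ((∫ r in Ioi (0 : ℝ), Complex.exp (-w * r ^ 2 - Complex.I * r ^ 3 / 3))
      + ∫ r in Ioi (0 : ℝ), Complex.exp (-w * r ^ 2 + Complex.I * r ^ 3 / 3)) * Complex.I_sq

/-- The Airy function as a Gaussian integral off the negative real axis. -/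
theorem two_pi_mul_airyAi_sq {w : ℂ} (hw : 0 < w.re) : 2 * Real.pi * airyAi (w ^ 2)
    = Complex.exp (-2 * w ^ 3 / 3) * airyGauss w := by
  have ho : IsOpen {w : ℂ | 0 < w.re} := isOpen_lt continuous_const Complex.continuous_re
  have a1 : AnalyticOnNhd ℂ (fun w => 2 * Real.pi * airyAi (w ^ 2)) {w : ℂ | 0 < w.re} := by
    refine DifferentiableOn.analyticOnNhd (fun w _ => ?_) ho
    exact ((differentiable_airyAi.comp (differentiable_id.pow 2)).const_mul _
      w).differentiableWithinAt
  have a2 : AnalyticOnNhd ℂ (fun w => Complex.exp (-2 * w ^ 3 / 3) * airyGauss w)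
      {w : ℂ | 0 < w.re} := by
    refine DifferentiableOn.analyticOnNhd (fun w hw => ?_) ho
    refine (DifferentiableAt.mul (by fun_prop)
      (hasDerivAt_airyGauss hw).differentiableAt).differentiableWithinAt
  -- Identity theorem: both sides are analytic on Re w > 0 and agree at 1 + 1/(n+1), which
  -- accumulates at 1.
  refine a1.eqOn_of_preconnected_of_frequently_eq a2
    (convex_halfSpace_re_gt 0).isPreconnected (z₀ := 1) (by simp) ?_ hw
  have ht : Tendsto (fun n : ℕ => ((1 + 1 / ((n : ℝ) + 1) : ℝ) : ℂ)) atTop (𝓝[≠] 1) := by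
    refine tendsto_nhdsWithin_iff.2 ⟨?_, Eventually.of_forall fun n => ?_⟩
    · have := (tendsto_one_div_add_atTop_nhds_zero_nat (𝕜 := ℝ)).const_add 1
      rw [add_zero] at this
      have h1 := (Complex.continuous_ofReal.tendsto 1).comp this
      rw [Complex.ofReal_one] at h1
      exact h1
    · have : (0 : ℝ) < 1 / ((n : ℝ) + 1) := by positivity
      simp only [mem_compl_iff, mem_singleton_iff]
      exact_mod_cast (by linarith : (1 + 1 / ((n : ℝ) + 1)) > 1).ne'
  refine ht.frequently (Frequently.of_forall fun n => ?_)
  exact two_pi_mul_airyAi_sq_of_pos (by positivity)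

/-- The absolute Gaussian moments. -/
noncomputable def gaussMoment (n : ℕ) : ℝ := ∫ s : ℝ, |s| ^ n * Real.exp (-s ^ 2)

lemma gaussMoment_nonneg (n : ℕ) : 0 ≤ gaussMoment n :=
  integral_nonneg fun s => by positivity

lemma integrable_abs_pow_mul_exp {a : ℝ} (ha : 0 < a) (n : ℕ) :
    Integrable fun s : ℝ => |s| ^ n * Real.exp (-a * s ^ 2) := by
  refine (integrable_pow_mul_exp_neg_mul_sq ha n).norm.congr (Eventually.of_forall fun s => ?_)
  simp

lemma integral_abs_pow_mul_exp {a : ℝ} (ha : 0 < a) (n : ℕ) :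
    ∫ s : ℝ, |s| ^ n * Real.exp (-a * s ^ 2) = gaussMoment n / Real.sqrt a ^ (n + 1) := by
  have hs : 0 < Real.sqrt a := Real.sqrt_pos.2 ha
  have h := Measure.integral_comp_mul_left (fun s : ℝ => |s| ^ n * Real.exp (-s ^ 2)) (Real.sqrt a)
  have e : ∀ s : ℝ, |Real.sqrt a * s| ^ n * Real.exp (-(Real.sqrt a * s) ^ 2)
      = Real.sqrt a ^ n * (|s| ^ n * Real.exp (-a * s ^ 2)) := fun s => by
    rw [abs_mul, mul_pow, mul_pow, Real.sq_sqrt ha.le, abs_of_pos hs]; ring_nf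
  simp only [e] at h
  rw [integral_const_mul, abs_of_pos (inv_pos.2 hs), smul_eq_mul] at h
  rw [gaussMoment, pow_succ]
  field_simp
  field_simp at h
  linarith

/-- Dropping the phase e^{-is³/3} costs at most |s|³/3 pointwise, and what is left is an exact
Gaussian integral. -/
lemma norm_airyGauss_sub_le {w : ℂ} (hw : 0 < w.re) :
    ‖airyGauss w - (Real.pi / w) ^ (1 / 2 : ℂ)‖ ≤ gaussMoment 3 / Real.sqrt w.re ^ 4 := by
  have hi := integrable_pow_mul_airyGauss 0 hw
  simp only [pow_zero, one_mul] at hi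
  rw [← integral_gaussian_complex hw, airyGauss, ← integral_sub hi (integrable_cexp_neg_mul_sq hw),
    ← integral_abs_pow_mul_exp hw 3]
  refine norm_integral_le_of_norm_le (integrable_abs_pow_mul_exp hw 3)
    (Eventually.of_forall fun s => ?_)
  have e : Complex.exp (-w * s ^ 2 - Complex.I * s ^ 3 / 3) - Complex.exp (-w * s ^ 2)
      = Complex.exp (-w * s ^ 2) * (Complex.exp (Complex.I * ((-(s ^ 3 / 3) : ℝ) : ℂ)) - 1) := by
    rw [mul_sub, ← Complex.exp_add, mul_one]; congr 2; push_cast; ring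
  rw [e, norm_mul, norm_cexp_neg_mul_sq, mul_comm]
  gcongr
  refine Real.norm_exp_I_mul_ofReal_sub_one_le.trans ?_
  rw [norm_neg, Real.norm_eq_abs, abs_div, abs_pow, abs_of_pos (by norm_num : (0 : ℝ) < 3)]
  have : 0 ≤ |s| ^ 3 := by positivity
  linarith

lemma norm_airyGauss_le {w : ℂ} (hw : 0 < w.re) :
    ‖airyGauss w‖ ≤ gaussMoment 0 / Real.sqrt w.re ^ 1 := by
  rw [airyGauss, ← integral_abs_pow_mul_exp hw 0]
  refine norm_integral_le_of_norm_le (integrable_abs_pow_mul_exp hw 0)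
    (Eventually.of_forall fun s => ?_)
  rw [norm_airyGauss_integrand, pow_zero, one_mul]

lemma norm_airyGauss'_le {w : ℂ} (hw : 0 < w.re) :
    ‖airyGauss' w‖ ≤ gaussMoment 2 / Real.sqrt w.re ^ 3 := by
  rw [airyGauss', norm_neg, ← integral_abs_pow_mul_exp hw 2]
  refine norm_integral_le_of_norm_le (integrable_abs_pow_mul_exp hw 2)
    (Eventually.of_forall fun s => ?_)
  rw [norm_mul, norm_airyGauss_integrand, norm_pow, Complex.norm_real, Real.norm_eq_abs]

/-! ### Uniform asymptotics in a wide sector -/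

/-- The principal square root. -/
noncomputable def csqrt (z : ℂ) : ℂ := z ^ (1 / 2 : ℂ)

lemma csqrt_sq (z : ℂ) : csqrt z ^ 2 = z := by
  rw [csqrt, ← Complex.cpow_nat_mul]; simp

lemma norm_csqrt (z : ℂ) : ‖csqrt z‖ = Real.sqrt ‖z‖ := by
  rw [← csqrt_sq z, norm_pow, Real.sqrt_sq (norm_nonneg _), csqrt_sq]

lemma csqrt_ne_zero {z : ℂ} (hz : z ≠ 0) : csqrt z ≠ 0 := by
  intro h; apply hz; rw [← csqrt_sq z, h]; simp

lemma csqrt_re_nonneg (z : ℂ) : 0 ≤ (csqrt z).re := by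
  rcases eq_or_ne z 0 with rfl | hz
  · simp [csqrt]
  rw [csqrt, Complex.cpow_def_of_ne_zero hz, Complex.exp_re]
  have e : (Complex.log z * (1 / 2)).im = Complex.arg z / 2 := by
    rw [show Complex.log z * (1 / 2) = ((1 / 2 : ℝ) : ℂ) * Complex.log z by push_cast; ring,
      Complex.im_ofReal_mul, Complex.log_im]; ring
  rw [e]
  have h1 := Complex.neg_pi_lt_arg z
  have h2 := Complex.arg_le_pi z
  have := Real.cos_nonneg_of_mem_Icc (x := Complex.arg z / 2) ⟨by linarith, by linarith⟩
  positivity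

/-- Half-angle formula: if √z = p + iq then |z| = p² + q² and Re z = p² - q². Lower bounds for Re √z
are drawn from it. -/
lemma two_mul_csqrt_re_sq (z : ℂ) : 2 * (csqrt z).re ^ 2 = ‖z‖ + z.re := by
  have h1 : ‖z‖ = (csqrt z).re ^ 2 + (csqrt z).im ^ 2 := by
    rw [← Real.sq_sqrt (norm_nonneg z), ← norm_csqrt, Complex.sq_norm, Complex.normSq_apply]; ring
  have h2 : z.re = (csqrt z).re ^ 2 - (csqrt z).im ^ 2 := by
    conv_lhs => rw [← csqrt_sq z, pow_two, Complex.mul_re]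
    ring
  linarith

lemma csqrt_re_pos {z : ℂ} (hz : z ∈ Complex.slitPlane) : 0 < (csqrt z).re := by
  rcases (csqrt_re_nonneg z).lt_or_eq with h | h
  · exact h
  exfalso
  have := two_mul_csqrt_re_sq z
  rw [← h] at this
  have h0 : ‖z‖ = -z.re := by linarith
  rw [Complex.mem_slitPlane_iff] at hz
  have h1 : ‖z‖ ^ 2 = z.re ^ 2 + z.im ^ 2 := by
    rw [Complex.sq_norm, Complex.normSq_apply]; ring
  rw [h0] at h1
  have h2 : z.im = 0 := by nlinarith
  rcases hz with hz | hz
  · linarith [norm_nonneg z]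
  · exact hz h2

lemma hasDerivAt_csqrt {z : ℂ} (hz : z ∈ Complex.slitPlane) :
    HasDerivAt csqrt (1 / (2 * csqrt z)) z := by
  have hz0 := Complex.slitPlane_ne_zero hz
  have := (hasDerivAt_id z).cpow_const (c := (1 / 2 : ℂ)) hz
  refine this.congr_deriv ?_
  have h2 := csqrt_ne_zero hz0
  have h3 := csqrt_sq z
  rw [id, Complex.cpow_sub _ _ hz0, Complex.cpow_one, ← csqrt]
  field_simp
  exact h3

/-- The sector `Re z ≥ -|z| / 4`, on which the Airy asymptotics are uniform. -/
def wideSector : Set ℂ := {z | -‖z‖ / 4 ≤ z.re}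

lemma wideSector_slitPlane {z : ℂ} (hz : z ∈ wideSector) (h0 : z ≠ 0) :
    z ∈ Complex.slitPlane := by
  rw [Complex.mem_slitPlane_iff]
  by_contra! h
  have h1 : ‖z‖ = -z.re := by
    rw [← abs_of_nonpos h.1, Complex.norm_eq_sqrt_sq_add_sq, h.2]
    simp [Real.sqrt_sq_eq_abs]
  have h2 : -‖z‖ / 4 ≤ z.re := hz
  have h3 : 0 < ‖z‖ := norm_pos_iff.2 h0
  linarith

/-- Here 2(Re √z)² = |z| + Re z ≥ 3|z|/4. So √z stays in a proper subsector of Re w > 0, where Re w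
may be traded for |w|. -/
lemma csqrt_wideSector {z : ℂ} (hz : z ∈ wideSector) : ‖csqrt z‖ / 2 ≤ (csqrt z).re := by
  have h1 := two_mul_csqrt_re_sq z
  have h2 : -‖z‖ / 4 ≤ z.re := hz
  have h3 : ‖csqrt z‖ ^ 2 = ‖z‖ := by rw [← norm_pow, csqrt_sq]
  have h4 := csqrt_re_nonneg z
  refine abs_le_of_sq_le_sq' (by nlinarith [norm_nonneg z]) h4 |>.2

/-- The main term √(π/w) has modulus at least (3/2)|w|^{-1/2}, while the error is O(|w|^{-2}). For
large |w| a lower bound |w|^{-1/2} remains, so Ai cannot vanish there. -/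
lemma airyGauss_sector_bounds : ∃ R > 1, ∃ C > 0, ∀ w : ℂ, ‖w‖ / 2 ≤ w.re → R ≤ ‖w‖ →
    1 / Real.sqrt ‖w‖ ≤ ‖airyGauss w‖ ∧ ‖airyGauss w‖ ≤ C ∧
    ‖airyGauss' w‖ ≤ C / Real.sqrt ‖w‖ ^ 3 ∧
    ‖airyGauss w - (Real.pi / w) ^ (1 / 2 : ℂ)‖ ≤ C / ‖w‖ ^ 2 := by
  -- 16 = 2⁴: the loss in √(Re w) ≥ √|w|/2, raised to powers up to 4.
  set C := 16 * (gaussMoment 0 + gaussMoment 2 + gaussMoment 3) + 1 with hC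
  have p0 := gaussMoment_nonneg 0
  have p2 := gaussMoment_nonneg 2
  have p3 := gaussMoment_nonneg 3
  refine ⟨2 * C + 2, by linarith, C, by positivity, fun w hw hR => ?_⟩
  have hn : 0 < ‖w‖ := by linarith
  have hwr : 0 < w.re := by linarith
  have hsq : Real.sqrt ‖w‖ / 2 ≤ Real.sqrt w.re := by
    rw [Real.le_sqrt' (by positivity), div_pow, Real.sq_sqrt hn.le]; linarith
  have hs : 0 < Real.sqrt ‖w‖ := Real.sqrt_pos.2 hn
  have hs1 : 1 ≤ Real.sqrt ‖w‖ := by rw [Real.one_le_sqrt]; linarith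
  have key : ∀ (n k : ℕ), k ≤ 4 → gaussMoment n / Real.sqrt w.re ^ k
      ≤ 16 * gaussMoment n / Real.sqrt ‖w‖ ^ k := fun n k hk => by
    have h1 : (Real.sqrt ‖w‖ / 2) ^ k ≤ Real.sqrt w.re ^ k := by gcongr
    have h2 : (2 : ℝ) ^ k ≤ 16 := by
      calc (2 : ℝ) ^ k ≤ 2 ^ 4 := pow_le_pow_right₀ (by norm_num) hk
        _ = 16 := by norm_num
    calc gaussMoment n / Real.sqrt w.re ^ k ≤ gaussMoment n / (Real.sqrt ‖w‖ / 2) ^ k := by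
          have := gaussMoment_nonneg n
          gcongr
      _ = 2 ^ k * gaussMoment n / Real.sqrt ‖w‖ ^ k := by rw [div_pow]; field_simp
      _ ≤ _ := by have := gaussMoment_nonneg n; gcongr
  have e4 : Real.sqrt ‖w‖ ^ 4 = ‖w‖ ^ 2 := by
    rw [show (4 : ℕ) = 2 * 2 by norm_num, pow_mul, Real.sq_sqrt hn.le]
  have b4 : ‖airyGauss w - (Real.pi / w) ^ (1 / 2 : ℂ)‖ ≤ C / ‖w‖ ^ 2 := by
    refine (norm_airyGauss_sub_le hwr).trans ((key 3 4 le_rfl).trans ?_)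
    rw [e4]
    gcongr
    linarith
  refine ⟨?_, ?_, ?_, b4⟩
  · have hm : ‖((Real.pi : ℂ) / w) ^ (1 / 2 : ℂ)‖ = Real.sqrt Real.pi / Real.sqrt ‖w‖ := by
      rw [← csqrt, norm_csqrt, norm_div, Complex.norm_real, Real.norm_of_nonneg Real.pi_pos.le,
        Real.sqrt_div Real.pi_pos.le]
    have h1 := norm_sub_norm_le (((Real.pi : ℂ) / w) ^ (1 / 2 : ℂ)) (airyGauss w)
    rw [norm_sub_rev, hm] at h1
    have hpi : (3 / 2 : ℝ) ≤ Real.sqrt Real.pi := by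
      rw [Real.le_sqrt' (by norm_num)]; linarith [Real.pi_gt_three]
    have h2 : (3 / 2) / Real.sqrt ‖w‖ ≤ Real.sqrt Real.pi / Real.sqrt ‖w‖ := by gcongr
    have h3 : C / ‖w‖ ^ 2 ≤ (1 / 2) / Real.sqrt ‖w‖ := by
      rw [div_le_div_iff₀ (by positivity) hs, ← e4]
      have h5 : C ≤ Real.sqrt ‖w‖ ^ 2 / 2 := by rw [Real.sq_sqrt hn.le]; linarith
      calc C * Real.sqrt ‖w‖ ≤ Real.sqrt ‖w‖ ^ 2 / 2 * Real.sqrt ‖w‖ ^ 2 := by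
            gcongr; nlinarith
        _ = _ := by ring
    have h4 : (3 / 2) / Real.sqrt ‖w‖ = 1 / Real.sqrt ‖w‖ + (1 / 2) / Real.sqrt ‖w‖ := by ring
    linarith
  · refine (norm_airyGauss_le hwr).trans ((key 0 1 (by norm_num)).trans ?_)
    rw [pow_one]
    refine (div_le_self (by positivity) hs1).trans (by linarith)
  · refine (norm_airyGauss'_le hwr).trans ((key 2 3 (by norm_num)).trans ?_)
    gcongr
    linarith

lemma two_pi_mul_airyAi'_sq {w : ℂ} (hw : 0 < w.re) : 2 * Real.pi * airyAi' (w ^ 2) * (2 * w)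
    = Complex.exp (-2 * w ^ 3 / 3) * (airyGauss' w - 2 * w ^ 2 * airyGauss w) := by
  have h1 : HasDerivAt (fun w => 2 * Real.pi * airyAi (w ^ 2))
      (2 * Real.pi * airyAi' (w ^ 2) * (2 * w)) w := by
    have := ((hasDerivAt_airyAi (w ^ 2)).comp w ((hasDerivAt_id w).fun_pow 2)).const_mul
      (2 * (Real.pi : ℂ))
    exact this.congr_deriv (by simp; ring)
  have h2 : HasDerivAt (fun w => Complex.exp (-2 * w ^ 3 / 3) * airyGauss w)
      (Complex.exp (-2 * w ^ 3 / 3) * (airyGauss' w - 2 * w ^ 2 * airyGauss w)) w := by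
    have := (((((hasDerivAt_id w).fun_pow 3).const_mul (-2)).div_const 3).cexp).fun_mul
      (hasDerivAt_airyGauss hw)
    exact this.congr_deriv (by simp; ring)
  have ho : IsOpen {w : ℂ | 0 < w.re} := isOpen_lt continuous_const Complex.continuous_re
  refine h1.unique (h2.congr_of_eventuallyEq ?_)
  filter_upwards [ho.mem_nhds hw] with v hv using two_pi_mul_airyAi_sq hv

lemma airyAi_eq_airyGauss {z : ℂ} (hz : z ∈ Complex.slitPlane) : airyAi z =
    (2 * Real.pi : ℂ)⁻¹ * (Complex.exp (-2 * csqrt z ^ 3 / 3) * airyGauss (csqrt z)) := by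
  have := two_pi_mul_airyAi_sq (csqrt_re_pos hz)
  rw [csqrt_sq] at this
  rw [← this, inv_mul_cancel_left₀ (by simp)]

lemma airyAi'_eq_airyGauss {z : ℂ} (hz : z ∈ Complex.slitPlane) : airyAi' z =
    (2 * Real.pi : ℂ)⁻¹ * (Complex.exp (-2 * csqrt z ^ 3 / 3) *
      (airyGauss' (csqrt z) / (2 * csqrt z) - csqrt z * airyGauss (csqrt z))) := by
  have := two_pi_mul_airyAi'_sq (csqrt_re_pos hz)
  rw [csqrt_sq] at this
  have h0 := csqrt_ne_zero (Complex.slitPlane_ne_zero hz)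
  have hpi : (Real.pi : ℂ) ≠ 0 := by exact_mod_cast Real.pi_ne_zero
  have h3 : airyAi' z = (2 * Real.pi : ℂ)⁻¹ * (2 * csqrt z)⁻¹ *
      (2 * Real.pi * airyAi' z * (2 * csqrt z)) := by field_simp
  rw [h3, this]
  field_simp
  rw [csqrt_sq]

/-- Logarithmic derivative of the Airy function in a wide sector. -/
theorem airy_logDeriv_bound : ∃ R > 1, ∃ C > 0, ∀ z ∈ wideSector, R ≤ ‖z‖ →
    airyAi z ≠ 0 ∧ ‖airyAi' z / airyAi z + csqrt z‖ ≤ C / ‖z‖ := by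
  obtain ⟨R, hR, C, hC, h⟩ := airyGauss_sector_bounds
  refine ⟨R ^ 2, one_lt_pow₀ hR (by norm_num), C, hC, fun z hz hzR => ?_⟩
  have hz0 : z ≠ 0 := by
    rintro rfl; rw [norm_zero] at hzR; nlinarith
  have hsl := wideSector_slitPlane hz hz0
  have hw : R ≤ ‖csqrt z‖ := by
    rw [norm_csqrt]; exact Real.le_sqrt_of_sq_le hzR
  obtain ⟨h1, -, h3, -⟩ := h _ (csqrt_wideSector hz) hw
  have hwn : 0 < ‖csqrt z‖ := by linarith
  have hs : 0 < Real.sqrt ‖csqrt z‖ := Real.sqrt_pos.2 hwn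
  have hA : airyGauss (csqrt z) ≠ 0 := norm_pos_iff.1 (lt_of_lt_of_le (by positivity) h1)
  have hw0 := csqrt_ne_zero hz0
  have hpi : (2 * Real.pi : ℂ)⁻¹ ≠ 0 := by simp
  refine ⟨?_, ?_⟩
  · rw [airyAi_eq_airyGauss hsl]
    exact mul_ne_zero hpi (mul_ne_zero (Complex.exp_ne_zero _) hA)
  -- The exponential prefactors cancel in the quotient and the term -√z is exact; only
  -- airyGauss'/(2w · airyGauss) at w = √z has to be estimated.
  · have e : airyAi' z / airyAi z + csqrt z
        = airyGauss' (csqrt z) / (2 * csqrt z * airyGauss (csqrt z)) := by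
      rw [airyAi'_eq_airyGauss hsl, airyAi_eq_airyGauss hsl,
        mul_div_mul_left _ _ hpi, mul_div_mul_left _ _ (Complex.exp_ne_zero _)]
      field_simp
      ring
    rw [e, norm_div, norm_mul, norm_mul, Complex.norm_ofNat]
    have hzw : ‖z‖ = ‖csqrt z‖ ^ 2 := by rw [← norm_pow, csqrt_sq]
    rw [div_le_iff₀ (by positivity)]
    refine h3.trans ?_
    rw [hzw]
    calc C / Real.sqrt ‖csqrt z‖ ^ 3 ≤ 2 * (C / Real.sqrt ‖csqrt z‖ ^ 3) := by
          have : 0 ≤ C / Real.sqrt ‖csqrt z‖ ^ 3 := by positivity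
          linarith
      _ = C / ‖csqrt z‖ ^ 2 * (2 * ‖csqrt z‖ * (1 / Real.sqrt ‖csqrt z‖)) := by
          have e2 := Real.sq_sqrt hwn.le
          set s := Real.sqrt ‖csqrt z‖
          rw [← e2]; field_simp
      _ ≤ _ := by gcongr

lemma re_csqrt_cube (z : ℂ) :
    (csqrt z ^ 3).re = 3 * (csqrt z).re * z.re - 2 * (csqrt z).re ^ 3 := by
  have h2 : z.re = (csqrt z).re ^ 2 - (csqrt z).im ^ 2 := by
    conv_lhs => rw [← csqrt_sq z, pow_two, Complex.mul_re]
    ring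
  rw [h2]
  simp only [pow_succ, pow_zero, one_mul, Complex.mul_re, Complex.mul_im]
  ring

lemma im_eq_csqrt (z : ℂ) : z.im = 2 * (csqrt z).re * (csqrt z).im := by
  conv_lhs => rw [← csqrt_sq z, pow_two, Complex.mul_im]
  ring

lemma norm_exp_csqrt_cube (z : ℂ) (k : ℝ) : ‖Complex.exp (k * csqrt z ^ 3 / 3)‖
    = Real.exp (k / 3 * (csqrt z ^ 3).re) := by
  rw [Complex.norm_exp]
  congr 1
  rw [show (k : ℂ) * csqrt z ^ 3 / 3 = ((k / 3 : ℝ) : ℂ) * csqrt z ^ 3 by push_cast; ring,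
    Complex.re_ofReal_mul]

lemma exists_pow_mul_exp_neg_le (n : ℕ) {b : ℝ} (hb : 0 < b) :
    ∃ C > 0, ∀ t : ℝ, 0 ≤ t → t ^ n * Real.exp (-b * t) ≤ C := by
  refine ⟨n.factorial / b ^ n, by positivity, fun t ht => ?_⟩
  have h := Real.pow_div_factorial_le_exp (b * t) (by positivity) n
  rw [neg_mul, Real.exp_neg, ← div_eq_mul_inv, div_le_div_iff₀ (Real.exp_pos _) (by positivity)]
  rw [div_le_iff₀ (by positivity), mul_pow] at h
  linarith

lemma exists_inv_airyGauss_bound : ∃ R > 1, ∀ z ∈ wideSector, R ≤ ‖z‖ → airyAi z ≠ 0 ∧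
    ‖(airyAi z)⁻¹‖ ≤ 2 * Real.pi * Real.sqrt ‖z‖ * Real.exp (2 / 3 * (csqrt z ^ 3).re) := by
  obtain ⟨R, hR, C, hC, h⟩ := airyGauss_sector_bounds
  refine ⟨R ^ 2, one_lt_pow₀ hR (by norm_num), fun z hz hzR => ?_⟩
  have hz0 : z ≠ 0 := by
    rintro rfl; rw [norm_zero] at hzR; nlinarith
  have hsl := wideSector_slitPlane hz hz0
  have hw : R ≤ ‖csqrt z‖ := by
    rw [norm_csqrt]; exact Real.le_sqrt_of_sq_le hzR
  obtain ⟨h1, -, -, -⟩ := h _ (csqrt_wideSector hz) hw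
  have hwn : 1 < ‖csqrt z‖ := by linarith
  have hs : 1 < Real.sqrt ‖csqrt z‖ := by rw [Real.lt_sqrt] <;> linarith
  have hA : airyGauss (csqrt z) ≠ 0 := norm_pos_iff.1 (lt_of_lt_of_le (by positivity) h1)
  have hpi : (2 * Real.pi : ℂ)⁻¹ ≠ 0 := by simp
  rw [airyAi_eq_airyGauss hsl]
  refine ⟨mul_ne_zero hpi (mul_ne_zero (Complex.exp_ne_zero _) hA), ?_⟩
  rw [mul_inv, inv_inv, mul_inv, ← Complex.exp_neg,
    show -(-2 * csqrt z ^ 3 / 3) = ((2 : ℝ) : ℂ) * csqrt z ^ 3 / 3 by push_cast; ring, norm_mul,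
    norm_mul, norm_mul (Complex.exp _), norm_exp_csqrt_cube, Complex.norm_real,
    Real.norm_of_nonneg Real.pi_pos.le, Complex.norm_ofNat, norm_inv]
  have h2 : ‖airyGauss (csqrt z)‖⁻¹ ≤ Real.sqrt ‖z‖ := by
    rw [← norm_csqrt]
    refine (inv_anti₀ (by positivity) h1).trans ?_
    rw [one_div, inv_inv]
    have := Real.sq_sqrt (norm_nonneg (csqrt z))
    nlinarith
  calc _ ≤ 2 * Real.pi * (Real.exp (2 / 3 * (csqrt z ^ 3).re) * Real.sqrt ‖z‖) := by gcongr
    _ = _ := by ring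

lemma strip_wideSector {z : ℂ} {c : ℝ} (h1 : -c ≤ z.re) (h2 : 4 * c ≤ ‖z‖) : z ∈ wideSector := by
  rw [wideSector, mem_ofPred_eq]; linarith

/-- Decay of `1 / Ai` in vertical strips. -/
theorem airy_inv_strip_bound (c : ℝ) : ∃ R > 0, ∃ C > 0, ∀ z : ℂ, |z.re| ≤ c → R ≤ ‖z‖ →
    airyAi z ≠ 0 ∧ ‖(airyAi z)⁻¹‖ ≤ C / ‖z‖ ^ 2 := by
  obtain ⟨R, hR, h⟩ := exists_inv_airyGauss_bound
  -- With t = √|z|: the power 5 is one t from the bound on 1/Ai plus t⁴ = |z|², and 1/12 comes from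
  -- (2/3)(t³/8) ≥ t/12.
  obtain ⟨C, hC, hC'⟩ := exists_pow_mul_exp_neg_le 5 (b := 1 / 12) (by norm_num)
  refine ⟨max R (12 * |c|), lt_max_of_lt_left (by linarith), 2 * Real.pi * C, by positivity,
    fun z hz hzR => ?_⟩
  have hzR1 : R ≤ ‖z‖ := (le_max_left _ _).trans hzR
  have hzR2 : 12 * |c| ≤ ‖z‖ := (le_max_right _ _).trans hzR
  have hc := le_abs_self c
  obtain ⟨hz1, hz2⟩ := abs_le.1 hz
  obtain ⟨hne, hb⟩ := h z (strip_wideSector (c := |c|) (by linarith) (by linarith [abs_nonneg c]))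
    hzR1
  refine ⟨hne, hb.trans ?_⟩
  have hz0 : 0 < ‖z‖ := by linarith
  have hzs := Real.sq_sqrt hz0.le
  set t := Real.sqrt ‖z‖ with ht
  have ht1 : 1 ≤ t := by rw [ht, Real.one_le_sqrt]; linarith
  have ha := two_mul_csqrt_re_sq z
  have ha0 := csqrt_re_nonneg z
  have hlow : t / 2 ≤ (csqrt z).re := by
    refine (abs_le_of_sq_le_sq' ?_ ha0).2
    nlinarith [abs_nonneg c]
  -- In a strip Re z is negligible against (Re √z)² ~ |z|/2, so √z³ has large negative real part.
  have hcube : (csqrt z ^ 3).re ≤ -(t ^ 3 / 8) := by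
    rw [re_csqrt_cube]
    set a := (csqrt z).re
    have h1 : 3 * z.re ≤ a ^ 2 := by nlinarith [abs_nonneg c]
    have h2 : a * (3 * z.re) ≤ a * a ^ 2 := mul_le_mul_of_nonneg_left h1 ha0
    have h3 : (t / 2) ^ 3 ≤ a ^ 3 := pow_le_pow_left₀ (by positivity) hlow 3
    nlinarith
  have e1 : Real.exp (2 / 3 * (csqrt z ^ 3).re) ≤ Real.exp (-(1 / 12) * t) := by
    apply Real.exp_le_exp.2
    have : t ≤ t ^ 3 := le_self_pow₀ ht1 (by norm_num)
    linarith
  have e2 := hC' t (by linarith)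
  rw [le_div_iff₀ (by positivity), ← hzs]
  calc 2 * Real.pi * t * Real.exp (2 / 3 * (csqrt z ^ 3).re) * (t ^ 2) ^ 2
      ≤ 2 * Real.pi * t * Real.exp (-(1 / 12) * t) * (t ^ 2) ^ 2 := by gcongr
    _ = 2 * Real.pi * (t ^ 5 * Real.exp (-(1 / 12) * t)) := by ring
    _ ≤ _ := by gcongr

/-- Exponential decay of `Ai` and `Ai'` along horizontal half lines. -/
theorem airy_horizontal_decay (z₀ : ℂ) : ∃ C > 0, ∀ᶠ x : ℝ in atTop,
    ‖airyAi (z₀ + x)‖ ≤ C * Real.exp (-(1 / 2) * x) ∧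
    ‖airyAi' (z₀ + x)‖ ≤ C * Real.exp (-(1 / 2) * x) := by
  obtain ⟨R, hR, C, hC, h⟩ := airyGauss_sector_bounds
  obtain ⟨D, hD, hD'⟩ := exists_pow_mul_exp_neg_le 1 (b := 1 / 6) (by norm_num)
  set E := Real.exp (2 / 3 * (|z₀.re| + z₀.im ^ 2)) with hE
  refine ⟨(2 * Real.pi)⁻¹ * (2 * E * C * (1 + 2 * D)), by positivity, ?_⟩
  filter_upwards [eventually_ge_atTop (R ^ 2 + 4 * ‖z₀‖ + 1)] with x hx
  set z := z₀ + x with hz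
  have hz₀ := norm_nonneg z₀
  have hre : z.re = z₀.re + x := by simp [hz]
  have him : z.im = z₀.im := by simp [hz]
  have habs := abs_le.1 (Complex.abs_re_le_norm z₀)
  have hR2 : 1 < R ^ 2 := one_lt_pow₀ hR (by norm_num)
  have hrepos : R ^ 2 ≤ z.re := by linarith [habs.1]
  have hnorm : z.re ≤ ‖z‖ := Complex.re_le_norm z
  have hx0 : 0 ≤ x := by linarith
  have hnorm2 : ‖z‖ ≤ 2 * x := by
    have := norm_add_le z₀ (x : ℂ)
    rw [Complex.norm_real, Real.norm_of_nonneg hx0] at this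
    linarith
  have hws : z ∈ wideSector := by
    rw [wideSector, mem_ofPred_eq]; linarith
  have hz0 : z ≠ 0 := by
    rw [← norm_pos_iff]; linarith
  have hsl := wideSector_slitPlane hws hz0
  have hw : R ≤ ‖csqrt z‖ := by
    rw [norm_csqrt]; exact Real.le_sqrt_of_sq_le (by linarith)
  obtain ⟨-, h2, h3, -⟩ := h _ (csqrt_wideSector hws) hw
  have hw1 : 1 < ‖csqrt z‖ := by linarith
  have hs1 : 1 ≤ Real.sqrt ‖csqrt z‖ := by rw [Real.one_le_sqrt]; linarith
  have hws2 : ‖csqrt z‖ ≤ 2 * x := by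
    refine le_trans ?_ hnorm2
    rw [norm_csqrt, Real.sqrt_le_left (by linarith)]
    nlinarith
  have ha := two_mul_csqrt_re_sq z
  have ha0 := csqrt_re_nonneg z
  have ha1 : 1 ≤ (csqrt z).re := by
    refine (abs_le_of_sq_le_sq' ?_ ha0).2
    nlinarith
  -- With √z = a + ib, Re √z³ = a³ - 3ab². On the half line 2ab = Im z₀ is fixed, so for a ≥ 1 the
  -- negative term is bounded.
  have hcube : x - |z₀.re| - z₀.im ^ 2 ≤ (csqrt z ^ 3).re := by
    have hi := im_eq_csqrt z
    rw [him] at hi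
    have e : (csqrt z ^ 3).re = (csqrt z).re ^ 3 - 3 * (csqrt z).re * (csqrt z).im ^ 2 := by
      simp only [pow_succ, pow_zero, one_mul, Complex.mul_re, Complex.mul_im]
      ring
    rw [e, hi]
    set a := (csqrt z).re
    set b := (csqrt z).im
    have h1 : a ^ 2 ≤ a ^ 3 := pow_le_pow_right₀ ha1 (by norm_num)
    have h2 : 0 ≤ a * (a - 1) * b ^ 2 :=
      mul_nonneg (mul_nonneg ha0 (by linarith)) (sq_nonneg b)
    have h3 : 0 ≤ a * b ^ 2 := by positivity
    have h4 := neg_abs_le z₀.re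
    nlinarith
  have hexp : ‖Complex.exp (-2 * csqrt z ^ 3 / 3)‖ ≤ E * Real.exp (-(2 / 3) * x) := by
    rw [show (-2 * csqrt z ^ 3 / 3 : ℂ) = ((-2 : ℝ) : ℂ) * csqrt z ^ 3 / 3 by push_cast; ring,
      norm_exp_csqrt_cube, hE, ← Real.exp_add]
    apply Real.exp_le_exp.2
    linarith
  -- The surplus rate 2/3 - 1/2 = 1/6 absorbs the factor linear in x in the bound for Ai'.
  have hsplit : Real.exp (-(2 / 3) * x) = Real.exp (-(1 / 6) * x) * Real.exp (-(1 / 2) * x) := by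
    rw [← Real.exp_add]; congr 1; ring
  have hle1 : Real.exp (-(1 / 6) * x) ≤ 1 := Real.exp_le_one_iff.2 (by linarith)
  have hDx := hD' x hx0
  rw [pow_one] at hDx
  have hpi : ‖(2 * Real.pi : ℂ)⁻¹‖ = (2 * Real.pi)⁻¹ := by
    rw [norm_inv, norm_mul, Complex.norm_real, Complex.norm_ofNat,
      Real.norm_of_nonneg Real.pi_pos.le]
  rw [airyAi_eq_airyGauss hsl, airyAi'_eq_airyGauss hsl]
  simp only [norm_mul _ (_ * _), hpi, norm_mul (Complex.exp _)]
  have hA' : ‖airyGauss' (csqrt z) / (2 * csqrt z) - csqrt z * airyGauss (csqrt z)‖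
      ≤ C + 2 * x * C := by
    refine (norm_sub_le _ _).trans (add_le_add ?_ ?_)
    · rw [norm_div, norm_mul, Complex.norm_ofNat]
      refine (div_le_self (norm_nonneg _) (by linarith)).trans (h3.trans ?_)
      exact div_le_self hC.le (one_le_pow₀ hs1)
    · rw [norm_mul]; gcongr
  have hE0 : 0 < E := Real.exp_pos _
  constructor
  · rw [mul_assoc]
    refine mul_le_mul_of_nonneg_left ?_ (by positivity)
    calc _ ≤ E * Real.exp (-(2 / 3) * x) * C := by gcongr
      _ = E * C * Real.exp (-(1 / 6) * x) * Real.exp (-(1 / 2) * x) := by rw [hsplit]; ring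
      _ ≤ E * C * 1 * Real.exp (-(1 / 2) * x) := by gcongr
      _ ≤ _ := by
        refine mul_le_mul_of_nonneg_right ?_ (Real.exp_pos _).le
        have : 0 ≤ E * C := by positivity
        have : 0 ≤ E * C * D := by positivity
        linarith
  · rw [mul_assoc]
    refine mul_le_mul_of_nonneg_left ?_ (by positivity)
    calc _ ≤ E * Real.exp (-(2 / 3) * x) * (C + 2 * x * C) := by gcongr
      _ = E * C * (Real.exp (-(1 / 6) * x) + 2 * (x * Real.exp (-(1 / 6) * x)))
          * Real.exp (-(1 / 2) * x) := by rw [hsplit]; ring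
      _ ≤ E * C * (1 + 2 * D) * Real.exp (-(1 / 2) * x) := by gcongr
      _ ≤ _ := by
        refine mul_le_mul_of_nonneg_right ?_ (Real.exp_pos _).le
        have : 0 ≤ E * C * (1 + 2 * D) := by positivity
        linarith

/-- Provides the point at which a derivative of constant sign is nonzero in the arguments on zeros
below. -/
lemma airyAi_ne_zero_horizontal (z₀ : ℂ) : ∀ᶠ x : ℝ in atTop, airyAi (z₀ + x) ≠ 0 := by
  obtain ⟨R, hR, C, hC, h⟩ := airy_logDeriv_bound
  filter_upwards [eventually_ge_atTop (R + 2 * ‖z₀‖)] with x hx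
  have h1 := Complex.abs_re_le_norm z₀
  have hre : (z₀ + x).re = z₀.re + x := by simp
  have h2 := Complex.re_le_norm (z₀ + x)
  have := neg_abs_le z₀.re
  have h3 := norm_nonneg z₀
  refine (h _ ?_ (by linarith)).1
  rw [wideSector, mem_ofPred_eq]; linarith

/-! ### Zeros of the Airy function -/

/-- A function with nonnegative derivative which is nonnegative at `0` and tends to `0` at infinity
has zero derivative. -/
lemma deriv_eq_zero_of_monotone_of_tendsto_zero {f f' : ℝ → ℝ} (hd : ∀ x, HasDerivAt f (f' x) x)
    (hf' : ∀ x, 0 < x → 0 ≤ f' x) (h0 : 0 ≤ f 0) (hlim : Tendsto f atTop (𝓝 0)) :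
    ∀ x, 0 < x → f' x = 0 := by
  have hmono : MonotoneOn f (Ici 0) := by
    refine monotoneOn_of_hasDerivWithinAt_nonneg (convex_Ici 0)
      (fun x _ => (hd x).continuousAt.continuousWithinAt)
      (fun x _ => (hd x).hasDerivWithinAt) fun x hx => hf' x ?_
    simpa using hx
  have hzero : ∀ x ∈ Ioi (0 : ℝ), f x = 0 := fun x hx => by
    have hx' : (0 : ℝ) ≤ x := le_of_lt hx
    refine le_antisymm ?_ (h0.trans (hmono (mem_Ici.2 le_rfl) hx' hx'))
    refine ge_of_tendsto hlim ?_
    filter_upwards [eventually_ge_atTop x] with y hy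
    exact hmono hx' (hx'.trans hy) hy
  intro x hx
  have : f =ᶠ[𝓝 x] fun _ => 0 := by
    filter_upwards [Ioi_mem_nhds hx] with y hy using hzero y hy
  exact (hd x).unique ((hasDerivAt_const x 0).congr_of_eventuallyEq this)

lemma hasDerivAt_airyAi_shift (z₀ : ℂ) (x : ℝ) :
    HasDerivAt (fun x : ℝ => airyAi (z₀ + x)) (airyAi' (z₀ + x)) x := by
  have h0 : HasDerivAt (fun r : ℝ => z₀ + (r : ℂ)) 1 x :=
    (Complex.ofRealCLM.hasDerivAt (x := x)).const_add z₀
  simpa [Function.comp_def] using (hasDerivAt_airyAi (z₀ + x)).comp x h0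

lemma hasDerivAt_airyAi'_shift (z₀ : ℂ) (x : ℝ) :
    HasDerivAt (fun x : ℝ => airyAi' (z₀ + x)) ((z₀ + x) * airyAi (z₀ + x)) x := by
  have h0 : HasDerivAt (fun r : ℝ => z₀ + (r : ℂ)) 1 x :=
    (Complex.ofRealCLM.hasDerivAt (x := x)).const_add z₀
  simpa [Function.comp_def] using (hasDerivAt_airyAi' (z₀ + x)).comp x h0

lemma tendsto_mul_exp_neg_half (C : ℝ) : Tendsto (fun x : ℝ => C * ((1 + x) *
    (Real.exp (-(1 / 2) * x) * Real.exp (-(1 / 2) * x)))) atTop (𝓝 0) := by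
  have h1 := Real.tendsto_pow_mul_exp_neg_atTop_nhds_zero 1
  have h0 := Real.tendsto_pow_mul_exp_neg_atTop_nhds_zero 0
  have := (h0.add h1).const_mul C
  simp only [add_zero, mul_zero] at this
  refine this.congr fun x => ?_
  rw [← Real.exp_add, show -(1 / 2) * x + -(1 / 2) * x = -x by ring]
  ring

lemma tendsto_airyAi'_mul_conj (z₀ : ℂ) :
    Tendsto (fun x : ℝ => airyAi' (z₀ + x) * (starRingEnd ℂ) (airyAi (z₀ + x))) atTop (𝓝 0) := by
  obtain ⟨C, hC, h⟩ := airy_horizontal_decay z₀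
  refine squeeze_zero_norm' ?_ (tendsto_mul_exp_neg_half (C * C))
  filter_upwards [h, eventually_ge_atTop 0] with x hx hx0
  rw [norm_mul, RCLike.norm_conj]
  calc _ ≤ (C * Real.exp (-(1 / 2) * x)) * (C * Real.exp (-(1 / 2) * x)) := by
        gcongr; exacts [hx.2, hx.1]
    _ = C * C * (1 * (Real.exp (-(1 / 2) * x) * Real.exp (-(1 / 2) * x))) := by ring
    _ ≤ _ := by gcongr; linarith

/-- Energy identity from Airy's equation. The imaginary part of the derivative is Im z₀ |Ai|², of
constant sign, and the real part is nonnegative for x > 0 when Re z₀ ≥ 0. -/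
lemma hasDerivAt_airyAi'_mul_conj (z₀ : ℂ) (x : ℝ) :
    HasDerivAt (fun x : ℝ => airyAi' (z₀ + x) * (starRingEnd ℂ) (airyAi (z₀ + x)))
    ((z₀ + x) * (‖airyAi (z₀ + x)‖ ^ 2 : ℝ) + (‖airyAi' (z₀ + x)‖ ^ 2 : ℝ)) x := by
  have h1 := (hasDerivAt_airyAi_shift z₀ x).star
  refine ((hasDerivAt_airyAi'_shift z₀ x).fun_mul h1).congr_deriv ?_
  push_cast
  rw [← Complex.mul_conj', ← Complex.mul_conj']
  simp only [RCLike.star_def]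
  ring

/-- The zeros of the Airy function are real and negative. -/
theorem airyAi_zero_real {z₀ : ℂ} (h : airyAi z₀ = 0) : z₀.im = 0 ∧ z₀.re < 0 := by
  have hd := hasDerivAt_airyAi'_mul_conj z₀
  have hlim := tendsto_airyAi'_mul_conj z₀
  obtain ⟨x, hx, hx0⟩ := ((airyAi_ne_zero_horizontal z₀).and (eventually_gt_atTop 0)).exists
  have hn : 0 < ‖airyAi (z₀ + x)‖ ^ 2 := by positivity
  have him : ∀ x : ℝ, HasDerivAt (fun x : ℝ => (airyAi' (z₀ + x) *
      (starRingEnd ℂ) (airyAi (z₀ + x))).im) (z₀.im * ‖airyAi (z₀ + x)‖ ^ 2) x := fun x => by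
    refine (Complex.imCLM.hasFDerivAt.comp_hasDerivAt x (hd x)).congr_deriv ?_
    rw [Complex.imCLM_apply, Complex.add_im, Complex.im_mul_ofReal, Complex.ofReal_im]
    simp
  have hre : ∀ x : ℝ, HasDerivAt (fun x : ℝ => (airyAi' (z₀ + x) *
      (starRingEnd ℂ) (airyAi (z₀ + x))).re)
      ((z₀.re + x) * ‖airyAi (z₀ + x)‖ ^ 2 + ‖airyAi' (z₀ + x)‖ ^ 2) x := fun x => by
    refine (Complex.reCLM.hasFDerivAt.comp_hasDerivAt x (hd x)).congr_deriv ?_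
    rw [Complex.reCLM_apply, Complex.add_re, Complex.re_mul_ofReal, Complex.ofReal_re]
    simp
  have limim : Tendsto (fun x : ℝ => (airyAi' (z₀ + x) *
      (starRingEnd ℂ) (airyAi (z₀ + x))).im) atTop (𝓝 0) :=
    (Complex.continuous_im.tendsto' 0 0 rfl).comp hlim
  have limre : Tendsto (fun x : ℝ => (airyAi' (z₀ + x) *
      (starRingEnd ℂ) (airyAi (z₀ + x))).re) atTop (𝓝 0) :=
    (Complex.continuous_re.tendsto' 0 0 rfl).comp hlim
  -- At a zero z₀ the energy vanishes at x = 0 as well as at infinity. A monotone function with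
  -- these end values is constant, so its derivative vanishes, contradicting Ai(z₀ + x) ≠ 0 unless
  -- Im z₀ = 0; likewise Re z₀ ≥ 0 is excluded.
  refine ⟨?_, ?_⟩
  · rcases le_total 0 z₀.im with hs | hs
    · have := deriv_eq_zero_of_monotone_of_tendsto_zero him (fun x _ => by positivity)
        (by simp [h]) limim x hx0
      simpa [hn.ne', hx] using this
    · have := deriv_eq_zero_of_monotone_of_tendsto_zero (fun x => (him x).fun_neg)
        (fun x _ => by
          have : 0 ≤ -z₀.im * ‖airyAi (z₀ + x)‖ ^ 2 := mul_nonneg (by linarith) (by positivity)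
          linarith) (by simp [h]) (by simpa using limim.neg) x hx0
      simpa [hn.ne', hx] using this
  · by_contra! hs
    have := deriv_eq_zero_of_monotone_of_tendsto_zero hre (fun x hx => by positivity)
      (by simp [h]) limre x hx0
    have : 0 < (z₀.re + x) * ‖airyAi (z₀ + x)‖ ^ 2 := by positivity
    have : 0 ≤ ‖airyAi' (z₀ + x)‖ ^ 2 := by positivity
    linarith

lemma airyAi_ofReal (x : ℝ) : airyAi x = ((airyAi x).re : ℂ) := by
  have := airyAi_conj x
  rw [Complex.conj_ofReal] at this
  exact (Complex.conj_eq_iff_re.1 this.symm).symm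

lemma airyAi'_ofReal (x : ℝ) : airyAi' x = ((airyAi' x).re : ℂ) := by
  have := airyAi'_conj x
  rw [Complex.conj_ofReal] at this
  exact (Complex.conj_eq_iff_re.1 this.symm).symm

lemma hasDerivAt_airyAi_re (x : ℝ) :
    HasDerivAt (fun x : ℝ => (airyAi x).re) (airyAi' x).re x := by
  have := hasDerivAt_airyAi_shift 0 x
  simp only [zero_add] at this
  exact Complex.reCLM.hasFDerivAt.comp_hasDerivAt x this

lemma hasDerivAt_airyAi'_re (x : ℝ) :
    HasDerivAt (fun x : ℝ => (airyAi' x).re) (x * (airyAi x).re) x := by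
  have := hasDerivAt_airyAi'_shift 0 x
  simp only [zero_add] at this
  exact (Complex.reCLM.hasFDerivAt.comp_hasDerivAt x this).congr_deriv (by simp)

/-- The zeros of the Airy function are simple. -/
theorem airyAi'_ne_zero {z₀ : ℂ} (h : airyAi z₀ = 0) : airyAi' z₀ ≠ 0 := by
  obtain ⟨him, -⟩ := airyAi_zero_real h
  obtain ⟨a, rfl⟩ : ∃ a : ℝ, z₀ = a := ⟨z₀.re, by apply Complex.ext <;> simp [him]⟩
  intro h'
  obtain ⟨x, hx, hx0⟩ := ((airyAi_ne_zero_horizontal a).and (eventually_gt_atTop 0)).exists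
  -- By Airy's equation y Ai(y)² - Ai'(y)² has derivative Ai(y)². At a double zero it would start
  -- from 0 and also tend to 0.
  have hd : ∀ x : ℝ, HasDerivAt (fun x : ℝ => (a + x) * (airyAi ((a + x : ℝ) : ℂ)).re ^ 2
      - (airyAi' ((a + x : ℝ) : ℂ)).re ^ 2) ((airyAi ((a + x : ℝ) : ℂ)).re ^ 2) x := fun x => by
    have h1 := (hasDerivAt_airyAi_re (a + x)).comp_const_add a x
    have h2 := (hasDerivAt_airyAi'_re (a + x)).comp_const_add a x
    refine ((((hasDerivAt_id x).const_add a).fun_mul (h1.fun_pow 2)).fun_sub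
      (h2.fun_pow 2)).congr_deriv ?_
    simp
    ring
  have hlim : Tendsto (fun x : ℝ => (a + x) * (airyAi ((a + x : ℝ) : ℂ)).re ^ 2
      - (airyAi' ((a + x : ℝ) : ℂ)).re ^ 2) atTop (𝓝 0) := by
    obtain ⟨C, hC, hb⟩ := airy_horizontal_decay a
    refine squeeze_zero_norm' ?_ (tendsto_mul_exp_neg_half ((|a| + 1) * (C * C)))
    filter_upwards [hb, eventually_ge_atTop 0] with x hx hx0
    push_cast
    have e1 : |(airyAi (a + x)).re| ^ 2 ≤ (C * Real.exp (-(1 / 2) * x)) ^ 2 := by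
      gcongr; exact (Complex.abs_re_le_norm _).trans hx.1
    have e2 : |(airyAi' (a + x)).re| ^ 2 ≤ (C * Real.exp (-(1 / 2) * x)) ^ 2 := by
      gcongr; exact (Complex.abs_re_le_norm _).trans hx.2
    refine (norm_sub_le _ _).trans ?_
    rw [norm_mul, norm_pow, norm_pow, Real.norm_eq_abs, Real.norm_eq_abs, Real.norm_eq_abs]
    have e3 : |a + x| ≤ |a| + x := (abs_add_le _ _).trans (by rw [abs_of_nonneg hx0])
    have ha := abs_nonneg a
    calc _ ≤ (|a| + x) * (C * Real.exp (-(1 / 2) * x)) ^ 2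
          + (C * Real.exp (-(1 / 2) * x)) ^ 2 := by gcongr
      _ = C * C * ((|a| + x + 1) * (Real.exp (-(1 / 2) * x) * Real.exp (-(1 / 2) * x))) := by ring
      _ ≤ C * C * (((|a| + 1) * (1 + x)) *
          (Real.exp (-(1 / 2) * x) * Real.exp (-(1 / 2) * x))) := by
        gcongr; nlinarith
      _ = _ := by ring
  have := deriv_eq_zero_of_monotone_of_tendsto_zero hd (fun x _ => by positivity)
    (by simp [h, h']) hlim x hx0
  have h0 : (airyAi ((a + x : ℝ) : ℂ)).re = 0 := by simpa using this
  apply hx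
  rw [← Complex.ofReal_add, airyAi_ofReal, h0, Complex.ofReal_zero]

/-- A positive solution of `v'' = -x v` on `(0, ∞)` does not exist. -/
lemma not_forall_pos_of_airy_ode {v v' : ℝ → ℝ} (h1 : ∀ x, HasDerivAt v (v' x) x)
    (h2 : ∀ x, HasDerivAt v' (-x * v x) x) : ¬ ∀ x, 0 ≤ x → 0 < v x := by
  intro hpos
  have hanti : AntitoneOn v' (Ici 0) := by
    refine antitoneOn_of_hasDerivWithinAt_nonpos (convex_Ici 0)
      (fun x _ => (h2 x).continuousAt.continuousWithinAt)
      (fun x _ => (h2 x).hasDerivWithinAt) fun x hx => ?_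
    have hx' : 0 < x := by simpa using hx
    have := hpos x hx'.le
    nlinarith
  have ineq : ∀ x y : ℝ, 0 ≤ x → x ≤ y → v y - v x ≤ v' x * (y - x) := fun x y hx hxy => by
    refine Convex.image_sub_le_mul_sub_of_deriv_le (convex_Ici x)
      (fun z _ => (h1 z).continuousAt.continuousWithinAt)
      (fun z _ => (h1 z).differentiableAt.differentiableWithinAt) (fun z hz => ?_) x
      (mem_Ici.2 le_rfl) y hxy hxy
    rw [(h1 z).deriv]
    have hz' : x < z := by simpa using hz
    exact hanti hx (hx.trans hz'.le) hz'.le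
  -- v is concave: with negative slope at x it lies below its tangent, which reaches 0 at the point
  -- y.
  have hv' : ∀ x, 0 ≤ x → 0 ≤ v' x := fun x hx => by
    by_contra! hneg
    set y := x + v x / (-v' x) with hy
    have hyx : x ≤ y := by
      rw [hy]; have := hpos x hx; have : 0 ≤ v x / (-v' x) := by
        apply div_nonneg this.le; linarith
      linarith
    have h := ineq x y hx hyx
    have e : v' x * (y - x) = -v x := by rw [hy]; have := hneg.ne; field_simp; ring
    have := hpos y (hx.trans hyx)
    linarith
  have hmono : MonotoneOn v (Ici 0) := by
    refine monotoneOn_of_hasDerivWithinAt_nonneg (convex_Ici 0)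
      (fun x _ => (h1 x).continuousAt.continuousWithinAt)
      (fun x _ => (h1 x).hasDerivWithinAt) fun x hx => hv' x ?_
    have hx' : 0 < x := by simpa using hx
    exact hx'.le
  have hv0 := hpos 0 le_rfl
  -- For x ≥ 1 the slope falls at rate at least v(0). By this y it has lost v'(1) + 1 and is
  -- negative.
  set y := 1 + (v' 1 + 1) / v 0 with hy
  have hv1 := hv' 1 zero_le_one
  have hy1 : 1 ≤ y := by
    rw [hy]; have : 0 ≤ (v' 1 + 1) / v 0 := by positivity
    linarith
  have := Convex.image_sub_le_mul_sub_of_deriv_le (convex_Ici 1) (f := v') (C := -v 0)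
    (fun z _ => (h2 z).continuousAt.continuousWithinAt)
    (fun z _ => (h2 z).differentiableAt.differentiableWithinAt) (fun z hz => by
      rw [(h2 z).deriv]
      have hz' : 1 < z := by simpa using hz
      have h3 : v 0 ≤ v z := hmono (mem_Ici.2 le_rfl) (mem_Ici.2 (by linarith)) (by linarith)
      nlinarith) 1 (mem_Ici.2 le_rfl) y hy1 hy1
  have e : -v 0 * (y - 1) = -(v' 1 + 1) := by rw [hy]; field_simp; ring
  have := hv' y (by linarith)
  linarith

/-- Without a real zero Ai would keep one sign on ℝ, and ±Ai(-x) would be a positive solution of v''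
= -xv. -/
lemma exists_airyAi_zero : ∃ x : ℝ, airyAi x = 0 := by
  by_contra! hne
  have hre : ∀ x : ℝ, (airyAi x).re ≠ 0 := fun x h => hne x (by rw [airyAi_ofReal, h]; simp)
  have hcont : Continuous fun x : ℝ => (airyAi x).re :=
    continuous_iff_continuousAt.2 fun x => (hasDerivAt_airyAi_re x).continuousAt
  have h1 : ∀ x : ℝ, HasDerivAt (fun x : ℝ => (airyAi ((-x : ℝ) : ℂ)).re)
      (-(airyAi' ((-x : ℝ) : ℂ)).re) x := fun x => by
    simpa [Function.comp_def] using (hasDerivAt_airyAi_re (-x)).comp x (hasDerivAt_neg x)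
  have h2 : ∀ x : ℝ, HasDerivAt (fun x : ℝ => -(airyAi' ((-x : ℝ) : ℂ)).re)
      (-x * (airyAi ((-x : ℝ) : ℂ)).re) x := fun x => by
    simpa [Function.comp_def] using ((hasDerivAt_airyAi'_re (-x)).comp x (hasDerivAt_neg x)).fun_neg
  rcases lt_or_gt_of_ne (hre 0) with h0 | h0
  · refine not_forall_pos_of_airy_ode (fun x => (h1 x).neg) (fun x => (h2 x).neg.congr_deriv ?_) ?_
    · simp
    · intro x _
      by_contra! hx
      obtain ⟨y, -, hy⟩ := intermediate_value_univ (0 : ℝ) (-x) hcont |>.trans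
        (image_univ.symm.subset) ⟨h0.le, by simpa using hx⟩
      exact hre y hy
  · refine not_forall_pos_of_airy_ode h1 h2 ?_
    intro x _
    by_contra! hx
    obtain ⟨y, -, hy⟩ := intermediate_value_univ (-x) (0 : ℝ) hcont |>.trans
        (image_univ.symm.subset) ⟨hx, h0.le⟩
    exact hre y hy

/-- There is a largest zero, and a gap to its left free of other zeros. -/
theorem exists_largest_zero : ∃ a : ℝ, IsGreatest {x : ℝ | x < 0 ∧ airyAi (x : ℂ) = 0} a ∧
    ∃ ε > 0, ∀ z : ℂ, a - ε < z.re → airyAi z = 0 → z = a := by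
  obtain ⟨x₀, hx₀⟩ := exists_airyAi_zero
  have hneg : ∀ x : ℝ, airyAi x = 0 → x < 0 := fun x hx => by simpa using (airyAi_zero_real hx).2
  have hcont : Continuous fun x : ℝ => airyAi x :=
    differentiable_airyAi.continuous.comp Complex.continuous_ofReal
  -- All zeros are negative reals, so only those in [x₀, 0] compete with the known zero x₀.
  have hcomp : IsCompact ({x : ℝ | airyAi x = 0} ∩ Icc x₀ 0) :=
    isCompact_Icc.inter_left (isClosed_singleton.preimage hcont)
  obtain ⟨a, ⟨ha, ha'⟩, hmax⟩ := hcomp.exists_isGreatest ⟨x₀, hx₀, le_rfl, (hneg _ hx₀).le⟩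
  have hgr : ∀ x : ℝ, airyAi x = 0 → x ≤ a := fun x hx => by
    rcases le_total x x₀ with h | h
    · exact h.trans ha'.1
    · exact hmax ⟨hx, h, (hneg x hx).le⟩
  refine ⟨a, ⟨⟨hneg a ha, ha⟩, fun x hx => hgr x hx.2⟩, ?_⟩
  have hiso : ∀ᶠ z in 𝓝[≠] (a : ℂ), airyAi z ≠ 0 := by
    have h := (hasDerivAt_airyAi a).eventually_ne (c := 0) (airyAi'_ne_zero ha)
    exact h
  rw [eventually_nhdsWithin_iff, Metric.eventually_nhds_iff] at hiso
  obtain ⟨ε, hε, h⟩ := hiso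
  -- A zero with Re z > a - ε is real and at most a, hence in the ball of radius ε where a is the
  -- only zero.
  refine ⟨ε, hε, fun z hz hz0 => ?_⟩
  obtain ⟨him, -⟩ := airyAi_zero_real hz0
  obtain ⟨x, rfl⟩ : ∃ x : ℝ, z = x := ⟨z.re, by apply Complex.ext <;> simp [him]⟩
  by_contra hne
  refine h (y := (x : ℂ)) ?_ hne hz0
  rw [Complex.ofReal_re] at hz
  have := hgr x hz0
  rw [Complex.dist_eq, ← Complex.ofReal_sub, Complex.norm_real, Real.norm_eq_abs, abs_lt]
  constructor <;> linarith

/-! ### Contour shifts, Fourier inversion and the inverse Laplace transform -/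

/-- The integral of a holomorphic function over vertical lines does not depend on the line. -/
theorem integral_vertical_line_eq {f : ℂ → ℂ} {c d : ℝ} (hcd : c ≤ d)
    (hf : DifferentiableOn ℂ f {z | c ≤ z.re ∧ z.re ≤ d})
    (hc : Integrable fun y : ℝ => f (c + y * Complex.I))
    (hd : Integrable fun y : ℝ => f (d + y * Complex.I)) {b : ℝ → ℝ}
    (hb : Tendsto b atTop (𝓝 0))
    (hfb : ∀ᶠ T : ℝ in atTop, ∀ x ∈ Icc c d, ‖f (x + T * Complex.I)‖ ≤ b T ∧
      ‖f (x + (-T : ℝ) * Complex.I)‖ ≤ b T) :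
    ∫ y : ℝ, f (c + y * Complex.I) = ∫ y : ℝ, f (d + y * Complex.I) := by
  have lc := intervalIntegral_tendsto_integral hc tendsto_neg_atTop_atBot tendsto_id
  have ld := intervalIntegral_tendsto_integral hd tendsto_neg_atTop_atBot tendsto_id
  have key : ∀ T : ℝ, (∫ x in c..d, f (x + (-T : ℝ) * Complex.I)) -
      (∫ x in c..d, f (x + T * Complex.I)) + Complex.I • (∫ y in -T..T, f (d + y * Complex.I)) -
      Complex.I • (∫ y in -T..T, f (c + y * Complex.I)) = 0 := fun T => by
    have := Complex.integral_boundary_rect_eq_zero_of_differentiableOn f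
      (c + (-T : ℝ) * Complex.I) (d + T * Complex.I) (hf.mono ?_)
    · simpa using this
    · intro z hz
      rw [Complex.mem_reProdIm] at hz
      have h := hz.1
      simp [uIcc_of_le hcd] at h
      exact h
  have hz1 : Tendsto (fun T : ℝ => ∫ x in c..d, f (x + (-T : ℝ) * Complex.I)) atTop (𝓝 0) := by
    refine squeeze_zero_norm' (a := fun T => b T * |d - c|) ?_ (by simpa using hb.mul_const |d - c|)
    filter_upwards [hfb] with T hT
    refine intervalIntegral.norm_integral_le_of_norm_le_const fun x hx => (hT x ?_).2
    rw [uIoc_of_le hcd] at hx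
    exact ⟨hx.1.le, hx.2⟩
  have hz2 : Tendsto (fun T : ℝ => ∫ x in c..d, f (x + T * Complex.I)) atTop (𝓝 0) := by
    refine squeeze_zero_norm' (a := fun T => b T * |d - c|) ?_ (by simpa using hb.mul_const |d - c|)
    filter_upwards [hfb] with T hT
    refine intervalIntegral.norm_integral_le_of_norm_le_const fun x hx => (hT x ?_).1
    rw [uIoc_of_le hcd] at hx
    exact ⟨hx.1.le, hx.2⟩
  have hlim := ((hz1.sub hz2).add (ld.const_smul Complex.I)).sub (lc.const_smul Complex.I)
  simp only [id_eq, key, sub_zero, zero_add] at hlim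
  have h0 := tendsto_nhds_unique hlim tendsto_const_nhds
  rw [← smul_sub, smul_eq_zero] at h0
  exact (sub_eq_zero.1 (h0.resolve_left Complex.I_ne_zero)).symm

lemma fourier_eq_angular (h : ℝ → ℂ) (ξ : ℝ) : FourierTransform.fourier h ξ =
    ∫ v : ℝ, Complex.exp (-Complex.I * (2 * Real.pi * ξ : ℝ) * v) * h v := by
  rw [Real.fourier_eq']
  congr 1; ext v
  rw [smul_eq_mul]; congr 2
  simp only [RCLike.inner_apply, conj_trivial]
  push_cast; ring

/-- Fourier inversion in angular frequency. -/
theorem fourier_inversion_angular {h : ℝ → ℂ} (hi : Integrable h)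
    (hH : Integrable fun y : ℝ => ∫ v : ℝ, Complex.exp (-Complex.I * y * v) * h v) {u : ℝ}
    (hc : ContinuousAt h u) :
    ∫ y : ℝ, Complex.exp (Complex.I * u * y) * ∫ v : ℝ, Complex.exp (-Complex.I * y * v) * h v
      = 2 * Real.pi * h u := by
  have hpi : (0 : ℝ) < 2 * Real.pi := by positivity
  have hF : FourierTransform.fourier h = fun ξ : ℝ =>
      (fun y : ℝ => ∫ v : ℝ, Complex.exp (-Complex.I * y * v) * h v) (2 * Real.pi * ξ) :=
    funext fun ξ => fourier_eq_angular h ξ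
  have hFi : Integrable (FourierTransform.fourier h) := by
    rw [hF]; exact hH.comp_mul_left' hpi.ne'
  have := hi.fourierInv_fourier_eq hFi hc
  rw [Real.fourierInv_eq', hF] at this
  have e := Measure.integral_comp_mul_left (fun y : ℝ => Complex.exp (Complex.I * u * y) *
    ∫ v : ℝ, Complex.exp (-Complex.I * y * v) * h v) (2 * Real.pi)
  rw [abs_of_pos (inv_pos.2 hpi)] at e
  have e2 : ∫ x : ℝ, Complex.exp (Complex.I * u * (2 * Real.pi * x : ℝ)) *
      (∫ v : ℝ, Complex.exp (-Complex.I * (2 * Real.pi * x : ℝ) * v) * h v) = h u := by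
    rw [← this]
    congr 1; ext ξ
    rw [smul_eq_mul]; congr 2
    simp only [RCLike.inner_apply, conj_trivial]
    push_cast; ring
  rw [e2] at e
  rw [e, Complex.real_smul, ← mul_assoc]
  push_cast
  rw [mul_inv_cancel₀ (by simp), one_mul]

/-- Holomorphic on `Re z > α`, with decay of order `3/2` on smaller half planes. -/
structure IsLaplaceImage (α : ℝ) (K : ℂ → ℂ) : Prop where
  diff : DifferentiableOn ℂ K {z | α < z.re}
  decay : ∀ c > α, ∃ C > 0, ∀ z : ℂ, c ≤ z.re → ‖K z‖ ≤ C * (1 + ‖z‖) ^ (-(3 / 2) : ℝ)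

lemma integrable_one_add_abs {r : ℝ} (hr : 1 < r) :
    Integrable fun y : ℝ => (1 + |y|) ^ (-r) := by
  have := integrable_one_add_norm (E := ℝ) (μ := volume) (r := r) (by simpa using hr)
  simpa using this

lemma line_re (c y : ℝ) : ((c : ℂ) + y * Complex.I).re = c := by simp
lemma line_im (c y : ℝ) : ((c : ℂ) + y * Complex.I).im = y := by simp

lemma abs_le_norm_line (c y : ℝ) : |y| ≤ ‖(c : ℂ) + y * Complex.I‖ := by
  have := Complex.abs_im_le_norm (c + y * Complex.I)
  rwa [line_im] at this

lemma continuous_line {K : ℂ → ℂ} {U : Set ℂ} (hK : ContinuousOn K U) {c : ℝ}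
    (hc : ∀ y : ℝ, (c : ℂ) + y * Complex.I ∈ U) :
    Continuous fun y : ℝ => K (c + y * Complex.I) := by
  rw [← continuousOn_univ]
  exact hK.comp (by fun_prop) fun y _ => hc y

namespace IsLaplaceImage

variable {α : ℝ} {K : ℂ → ℂ}

lemma continuous_line (hK : IsLaplaceImage α K) {c : ℝ} (hc : α < c) :
    Continuous fun y : ℝ => K (c + y * Complex.I) :=
  _root_.continuous_line hK.diff.continuousOn fun y => by simpa using hc

lemma norm_le_line {C c d : ℝ} (hC : 0 < C)
    (h : ∀ z : ℂ, c ≤ z.re → ‖K z‖ ≤ C * (1 + ‖z‖) ^ (-(3 / 2) : ℝ)) (hd : c ≤ d) (y : ℝ) :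
    ‖K (d + y * Complex.I)‖ ≤ C * (1 + |y|) ^ (-(3 / 2) : ℝ) := by
  refine (h _ (by simpa using hd)).trans ?_
  refine mul_le_mul_of_nonneg_left ?_ hC.le
  exact Real.rpow_le_rpow_of_nonpos (by positivity) (by linarith [abs_le_norm_line d y])
    (by norm_num)

lemma integrable_line (hK : IsLaplaceImage α K) {c : ℝ} (hc : α < c) :
    Integrable fun y : ℝ => K (c + y * Complex.I) := by
  obtain ⟨C, hC, h⟩ := hK.decay c hc
  exact Integrable.mono' ((integrable_one_add_abs (r := 3 / 2) (by norm_num)).const_mul C)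
    (hK.continuous_line hc).aestronglyMeasurable
    (Eventually.of_forall fun y => norm_le_line hC h le_rfl y)

/-- The inverse Laplace transform along the line `Re z = c`. -/
noncomputable def _root_.invLaplace (K : ℂ → ℂ) (c u : ℝ) : ℂ :=
  (2 * Real.pi : ℂ)⁻¹ * (Complex.exp (c * u) *
    ∫ y : ℝ, Complex.exp (Complex.I * u * y) * K (c + y * Complex.I))

lemma _root_.norm_exp_I_mul_mul (u y : ℝ) : ‖Complex.exp (Complex.I * u * y)‖ = 1 := by
  rw [show Complex.I * (u : ℂ) * y = ((u * y : ℝ) : ℂ) * Complex.I by push_cast; ring,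
    Complex.norm_exp_ofReal_mul_I]

lemma _root_.norm_invLaplace_le (K : ℂ → ℂ) (c u : ℝ) :
    ‖invLaplace K c u‖ ≤ Real.exp (c * u) * ∫ y : ℝ, ‖K (c + y * Complex.I)‖ := by
  rw [invLaplace, norm_mul, norm_mul, ← Complex.ofReal_mul, Complex.norm_exp, Complex.ofReal_re]
  have h1 : ‖(2 * Real.pi : ℂ)⁻¹‖ ≤ 1 := by
    rw [norm_inv, norm_mul, Complex.norm_real, Complex.norm_ofNat,
      Real.norm_of_nonneg Real.pi_pos.le]
    exact inv_le_one_of_one_le₀ (by linarith [Real.pi_gt_three])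
  have h2 : ‖∫ y : ℝ, Complex.exp (Complex.I * u * y) * K (c + y * Complex.I)‖
      ≤ ∫ y : ℝ, ‖K (c + y * Complex.I)‖ := by
    refine (norm_integral_le_integral_norm _).trans (le_of_eq ?_)
    congr 1; ext y
    rw [norm_mul, norm_exp_I_mul_mul, one_mul]
  calc _ ≤ 1 * (Real.exp (c * u) * ∫ y : ℝ, ‖K (c + y * Complex.I)‖) := by gcongr
    _ = _ := one_mul _

lemma _root_.invLaplace_eq (K : ℂ → ℂ) (c u : ℝ) : invLaplace K c u = (2 * Real.pi : ℂ)⁻¹ *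
    ∫ y : ℝ, (fun z => Complex.exp (z * u) * K z) (c + y * Complex.I) := by
  rw [invLaplace, ← integral_const_mul]
  congr 2; ext y
  rw [← mul_assoc, ← Complex.exp_add]
  congr 2; ring

lemma invLaplace_line_eq (hK : IsLaplaceImage α K) {c d : ℝ} (hc : α < c) (hcd : c ≤ d) (u : ℝ) :
    invLaplace K c u = invLaplace K d u := by
  rw [invLaplace_eq, invLaplace_eq]
  congr 1
  obtain ⟨C, hC, h⟩ := hK.decay c hc
  have hnorm : ∀ x y : ℝ, ‖Complex.exp ((x + y * Complex.I) * u)‖ = Real.exp (x * u) :=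
    fun x y => by rw [Complex.norm_exp]; congr 1; simp
  have hint : ∀ x : ℝ, α < x → Integrable fun y : ℝ =>
      (fun z => Complex.exp (z * u) * K z) (x + y * Complex.I) := fun x hx => by
    refine ((hK.integrable_line hx).norm.const_mul (Real.exp (x * u))).mono' ?_
      (Eventually.of_forall fun y => by rw [norm_mul, hnorm])
    exact (Continuous.mul (by fun_prop) (hK.continuous_line hx)).aestronglyMeasurable
  refine integral_vertical_line_eq (f := fun z => Complex.exp (z * u) * K z) hcd (b := fun T => Real.exp (max (c * u) (d * u)) *
    (C * (1 + |T|) ^ (-(3 / 2) : ℝ))) ?_ (hint c hc) (hint d (by linarith)) ?_ ?_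
  · refine DifferentiableOn.mul (by fun_prop) (hK.diff.mono fun z hz => ?_)
    exact lt_of_lt_of_le hc hz.1
  · have h1 : Tendsto (fun T : ℝ => (1 + |T|) ^ (-(3 / 2) : ℝ)) atTop (𝓝 0) :=
      (tendsto_rpow_neg_atTop (by norm_num)).comp
        (tendsto_atTop_add_const_left _ _ tendsto_abs_atTop_atTop)
    simpa using (h1.const_mul C).const_mul (Real.exp (max (c * u) (d * u)))
  · refine Eventually.of_forall fun T x hx => ?_
    have hxu : Real.exp (x * u) ≤ Real.exp (max (c * u) (d * u)) := by
      apply Real.exp_le_exp.2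
      rcases le_total 0 u with hu | hu
      · exact (mul_le_mul_of_nonneg_right hx.2 hu).trans (le_max_right _ _)
      · exact (mul_le_mul_of_nonpos_right hx.1 hu).trans (le_max_left _ _)
    constructor
    · rw [norm_mul, hnorm]
      have := norm_le_line hC h hx.1 T
      gcongr
    · rw [norm_mul, hnorm]
      have := norm_le_line hC h hx.1 (-T)
      rw [abs_neg] at this
      gcongr

lemma continuous_invLaplace (hK : IsLaplaceImage α K) {c : ℝ} (hc : α < c) :
    Continuous (invLaplace K c) := by
  unfold invLaplace
  refine continuous_const.mul (Continuous.mul (by fun_prop) ?_)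
  refine continuous_of_dominated (bound := fun y => ‖K (c + y * Complex.I)‖) (fun u => ?_)
    (fun u => Eventually.of_forall fun y => ?_) (hK.integrable_line hc).norm
    (Eventually.of_forall fun y => by fun_prop)
  · exact (Continuous.mul (by fun_prop) (hK.continuous_line hc)).aestronglyMeasurable
  · rw [norm_mul, norm_exp_I_mul_mul, one_mul]

/-- For u < 0 the line is pushed to Re z = d → +∞: e^{du} → 0 while the L¹ norms on the lines stay
bounded. The case u = 0 follows by continuity. -/
lemma invLaplace_of_nonpos (hK : IsLaplaceImage α K) {c : ℝ} (hc : α < c) {u : ℝ} (hu : u ≤ 0) :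
    invLaplace K c u = 0 := by
  have hneg : EqOn (invLaplace K c) (fun _ => 0) (Iio 0) := fun u (hu : u < 0) => by
    obtain ⟨C, hC, h⟩ := hK.decay c hc
    set J := ∫ y : ℝ, C * (1 + |y|) ^ (-(3 / 2) : ℝ)
    have hb : ∀ d, c ≤ d → ‖invLaplace K c u‖ ≤ Real.exp (d * u) * J := fun d hd => by
      rw [hK.invLaplace_line_eq hc hd]
      refine (norm_invLaplace_le K d u).trans ?_
      refine mul_le_mul_of_nonneg_left ?_ (Real.exp_pos _).le
      exact integral_mono (hK.integrable_line (by linarith)).norm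
        ((integrable_one_add_abs (by norm_num)).const_mul C) (fun y => norm_le_line hC h hd y)
    have hlim : Tendsto (fun d : ℝ => Real.exp (d * u) * J) atTop (𝓝 0) := by
      simpa using (Real.tendsto_exp_atBot.comp
        (tendsto_id.atTop_mul_const_of_neg hu)).mul_const J
    refine norm_le_zero_iff.1 (ge_of_tendsto hlim ?_)
    filter_upwards [eventually_ge_atTop c] with d hd using hb d hd
  have := hneg.closure (hK.continuous_invLaplace hc) continuous_const
  rw [closure_Iio] at this
  exact this hu

lemma exists_norm_invLaplace_le (hK : IsLaplaceImage α K) {c d : ℝ} (hc : α < c) (hd : α < d) :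
    ∃ C > 0, ∀ u, ‖invLaplace K c u‖ ≤ C * Real.exp (d * u) := by
  refine ⟨(∫ y : ℝ, ‖K (d + y * Complex.I)‖) + 1, ?_, fun u => ?_⟩
  · have : 0 ≤ ∫ y : ℝ, ‖K (d + y * Complex.I)‖ := integral_nonneg fun y => norm_nonneg _
    linarith
  · have e : invLaplace K c u = invLaplace K d u := by
      rcases le_total c d with h | h
      · exact hK.invLaplace_line_eq hc h u
      · exact (hK.invLaplace_line_eq hd h u).symm
    rw [e, mul_comm]
    refine (norm_invLaplace_le K d u).trans ?_
    gcongr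
    linarith

/-- On the line Re z = 1/u the exponential equals e. Of the decay exponent 3/2 = 1/4 + 5/4, the part
1/4 yields u^{1/4} because |z| ≥ 1/u, and 5/4 > 1 keeps the integral finite. -/
lemma exists_norm_invLaplace_le_rpow (hK : IsLaplaceImage α K) {c : ℝ} (hc : α < c) (hα : α < 1) :
    ∃ C > 0, ∀ u, 0 < u → u ≤ 1 → ‖invLaplace K c u‖ ≤ C * u ^ (1 / 4 : ℝ) := by
  obtain ⟨C, hC, h⟩ := hK.decay 1 hα
  set J := ∫ y : ℝ, (1 + |y|) ^ (-(5 / 4) : ℝ) with hJ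
  have hJ0 : 0 ≤ J := integral_nonneg fun y => by positivity
  refine ⟨Real.exp 1 * (C * (J + 1)), by positivity, fun u hu hu1 => ?_⟩
  have hu' : 1 ≤ u⁻¹ := (one_le_inv₀ hu).2 hu1
  have e : invLaplace K c u = invLaplace K u⁻¹ u := by
    rcases le_total c u⁻¹ with h | h
    · exact hK.invLaplace_line_eq hc h u
    · exact (hK.invLaplace_line_eq (by linarith) h u).symm
  rw [e]
  refine (norm_invLaplace_le K _ u).trans ?_
  rw [inv_mul_cancel₀ hu.ne', mul_assoc]
  gcongr
  have hb : ∀ y : ℝ, ‖K ((u⁻¹ : ℝ) + y * Complex.I)‖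
      ≤ C * u ^ (1 / 4 : ℝ) * (1 + |y|) ^ (-(5 / 4) : ℝ) := fun y => by
    refine (h _ (by rw [line_re]; exact hu')).trans ?_
    rw [mul_assoc]
    refine mul_le_mul_of_nonneg_left ?_ hC.le
    set n := ‖((u⁻¹ : ℝ) : ℂ) + y * Complex.I‖
    have h1 : u⁻¹ ≤ 1 + n := by
      have := Complex.re_le_norm (((u⁻¹ : ℝ) : ℂ) + y * Complex.I)
      rw [line_re] at this
      linarith
    have h2 : 1 + |y| ≤ 1 + n := by linarith [abs_le_norm_line u⁻¹ y]
    have hn : 0 < 1 + n := by linarith [abs_nonneg y]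
    rw [show (-(3 / 2) : ℝ) = -(1 / 4) + -(5 / 4) by norm_num, Real.rpow_add hn]
    refine mul_le_mul ?_ (Real.rpow_le_rpow_of_nonpos (by positivity) h2 (by norm_num))
      (by positivity) (by positivity)
    calc (1 + n) ^ (-(1 / 4) : ℝ) ≤ (u⁻¹) ^ (-(1 / 4) : ℝ) :=
          Real.rpow_le_rpow_of_nonpos (by positivity) h1 (by norm_num)
      _ = u ^ (1 / 4 : ℝ) := by rw [Real.inv_rpow hu.le, Real.rpow_neg hu.le, inv_inv]
  calc ∫ y : ℝ, ‖K ((u⁻¹ : ℝ) + y * Complex.I)‖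
      ≤ ∫ y : ℝ, C * u ^ (1 / 4 : ℝ) * (1 + |y|) ^ (-(5 / 4) : ℝ) :=
        integral_mono (hK.integrable_line (by linarith)).norm
          ((integrable_one_add_abs (by norm_num)).const_mul _) hb
    _ = C * u ^ (1 / 4 : ℝ) * J := integral_const_mul _ _
    _ ≤ C * u ^ (1 / 4 : ℝ) * (J + 1) := by gcongr; linarith
    _ = C * ((J + 1) * u ^ (1 / 4 : ℝ)) := by ring
    _ = C * (J + 1) * u ^ (1 / 4 : ℝ) := by ring

/-- The Laplace transform of the inverse Laplace transform. -/
theorem laplace_invLaplace (hK : IsLaplaceImage α K) {c s : ℝ} (hc : α < c) (hs : α < s) :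
    IntegrableOn (fun u : ℝ => Complex.exp (-(s * u)) * invLaplace K c u) (Ioi 0) ∧
    ∫ u in Ioi (0 : ℝ), Complex.exp (-(s * u)) * invLaplace K c u = K s := by
  have hcont : Continuous fun u : ℝ => Complex.exp (-(s * u)) * invLaplace K c u :=
    Continuous.mul (by fun_prop) (hK.continuous_invLaplace hc)
  have hI : IntegrableOn (fun u : ℝ => Complex.exp (-(s * u)) * invLaplace K c u) (Ioi 0) := by
    obtain ⟨C, hC, h⟩ := hK.exists_norm_invLaplace_le hc (d := (α + s) / 2) (by linarith)
    have hi := (exp_neg_integrableOn_Ioi 0 (b := (s - α) / 2) (by linarith)).const_mul C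
    refine hi.mono' hcont.aestronglyMeasurable (Eventually.of_forall fun u => ?_)
    rw [norm_mul, ← Complex.ofReal_mul, ← Complex.ofReal_neg, Complex.norm_exp, Complex.ofReal_re]
    calc _ ≤ Real.exp (-(s * u)) * (C * Real.exp ((α + s) / 2 * u)) := by gcongr; exact h u
      _ = C * (Real.exp (-(s * u)) * Real.exp ((α + s) / 2 * u)) := by ring
      _ = _ := by rw [← Real.exp_add]; congr 2; ring
  refine ⟨hI, ?_⟩
  have hzero : ∀ u ∉ Ioi (0 : ℝ), Complex.exp (-(s * u)) * invLaplace K c u = 0 := fun u hu => by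
    rw [hK.invLaplace_of_nonpos hc (not_lt.1 hu), mul_zero]
  rw [setIntegral_eq_integral_of_forall_compl_eq_zero hzero]
  rw [integrableOn_iff_integrable_of_support_subset (fun u hu => by
    by_contra hn; exact hu (hzero u hn))] at hI
  -- Up to 2π, the damped inverse transform at -t is the Fourier transform of v ↦ K(s + iv). Fourier
  -- inversion at the origin then reads as the Laplace integral on one side and K(s) on the other.
  have hh : ∀ t : ℝ, (∫ v : ℝ, Complex.exp (-Complex.I * t * v) * K (s + v * Complex.I))
      = 2 * Real.pi * (Complex.exp (-(s * (-t : ℝ))) * invLaplace K c (-t)) := fun t => by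
    have e : invLaplace K c (-t) = invLaplace K s (-t) := by
      rcases le_total c s with h | h
      · exact hK.invLaplace_line_eq hc h _
      · exact (hK.invLaplace_line_eq hs h _).symm
    rw [e, invLaplace]
    have hpi : (2 * Real.pi : ℂ) ≠ 0 := by simp
    rw [show ∀ a b c d : ℂ, a * (b * (a⁻¹ * (c * d))) = (a * a⁻¹) * ((b * c) * d) by intros; ring,
      mul_inv_cancel₀ hpi, ← Complex.exp_add, neg_add_cancel, Complex.exp_zero, one_mul, one_mul]
    congr 1; ext v; congr 2; push_cast; ring
  have hH : Integrable fun t : ℝ =>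
      ∫ v : ℝ, Complex.exp (-Complex.I * t * v) * K (s + v * Complex.I) := by
    simp only [hh]
    exact (hI.comp_neg).const_mul _
  have := fourier_inversion_angular (hK.integrable_line hs) hH (u := 0)
    (hK.continuous_line hs).continuousAt
  simp only [hh, Complex.ofReal_zero, mul_zero, zero_mul, Complex.exp_zero, one_mul, add_zero]
    at this
  rw [integral_const_mul] at this
  have h3 := mul_left_cancel₀ (by simp) this
  rw [← h3]
  exact (integral_neg_eq_self (fun u : ℝ => Complex.exp (-(s * u)) * invLaplace K c u) volume).symm

end IsLaplaceImage

/-- Inversion of the Laplace transform of a continuous function. -/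
theorem invLaplace_laplace {r : ℝ → ℂ} {L : ℂ → ℂ} {c u : ℝ} (hr : ContinuousAt r u)
    (hi : Integrable fun u : ℝ => Complex.exp (-(c * u)) * r u)
    (hL : ∀ y : ℝ, ∫ u : ℝ, Complex.exp (-((c + y * Complex.I) * u)) * r u
      = L (c + y * Complex.I))
    (hLi : Integrable fun y : ℝ => L (c + y * Complex.I)) : invLaplace L c u = r u := by
  have hh : ∀ y : ℝ, (∫ v : ℝ, Complex.exp (-Complex.I * y * v) * (Complex.exp (-(c * v)) * r v))
      = L (c + y * Complex.I) := fun y => by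
    rw [← hL]
    congr 1; ext v
    rw [← mul_assoc, ← Complex.exp_add]; congr 2; ring
  have := fourier_inversion_angular hi (by simpa only [hh] using hLi) (u := u)
    (ContinuousAt.mul (by fun_prop) hr)
  simp only [hh] at this
  rw [invLaplace, this]
  have hpi : (2 * Real.pi : ℂ) ≠ 0 := by simp
  rw [show ∀ a b c d : ℂ, a⁻¹ * (b * (a * (c * d))) = (a⁻¹ * a) * ((b * c) * d) by intros; ring,
    inv_mul_cancel₀ hpi, ← Complex.exp_add]
  simp

lemma norm_exp_neg_mul (s : ℂ) (u : ℝ) : ‖Complex.exp (-(s * u))‖ = Real.exp (-(s.re * u)) := by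
  rw [Complex.norm_exp]; congr 1; simp

/-! ### Differentiability and uniqueness of Laplace transforms -/

/-- The Laplace transform can be differentiated under the integral sign. -/
theorem hasDerivAt_laplace {f : ℝ → ℂ}
    (hf : ∀ s : ℝ, 0 < s → IntegrableOn (fun u : ℝ => Complex.exp (-(s * u)) * f u) (Ioi 0))
    (hm : AEStronglyMeasurable f (volume.restrict (Ioi 0)))
    {s : ℂ} (hs : 0 < s.re) :
    HasDerivAt (fun s : ℂ => ∫ u in Ioi (0 : ℝ), Complex.exp (-(s * u)) * f u)
      (∫ u in Ioi (0 : ℝ), -(u * (Complex.exp (-(s * u)) * f u))) s := by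
  obtain ⟨C, hC, hC'⟩ := exists_pow_mul_exp_neg_le 1 (b := s.re / 4) (by linarith)
  have hfn : ∀ σ : ℝ, 0 < σ → IntegrableOn (fun u : ℝ => Real.exp (-(σ * u)) * ‖f u‖) (Ioi 0) :=
    fun σ hσ => (hf σ hσ).norm.congr (Eventually.of_forall fun u => by
      simp only [norm_mul, norm_exp_neg_mul, Complex.ofReal_re])
  refine (hasDerivAt_integral_of_dominated_loc_of_deriv_le (𝕜 := ℂ) (s := {z | s.re / 2 < z.re})
    (F := fun (s : ℂ) (u : ℝ) => Complex.exp (-(s * u)) * f u)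
    (F' := fun (s : ℂ) (u : ℝ) => -(u * (Complex.exp (-(s * u)) * f u)))
    (bound := fun u => C * (Real.exp (-((s.re / 4) * u)) * ‖f u‖))
    ((isOpen_lt continuous_const Complex.continuous_re).mem_nhds (by simp [hs]))
    (Eventually.of_forall fun z => ?_) ?_ ?_ ?_ ((hfn _ (by linarith)).const_mul C) ?_).2
  · exact AEStronglyMeasurable.mul (by fun_prop) hm
  · exact (hfn _ hs).mono' (AEStronglyMeasurable.mul (by fun_prop) hm)
      (Eventually.of_forall fun u => by rw [norm_mul, norm_exp_neg_mul])
  · exact (AEStronglyMeasurable.mul (by fun_prop)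
      (AEStronglyMeasurable.mul (by fun_prop) hm)).neg
  · refine (ae_restrict_iff' measurableSet_Ioi).2 (Eventually.of_forall fun u hu z hz => ?_)
    have hu' : (0 : ℝ) ≤ u := le_of_lt hu
    have hz' : s.re / 2 < z.re := hz
    rw [norm_neg, norm_mul, norm_mul, norm_exp_neg_mul, Complex.norm_real, Real.norm_of_nonneg hu',
      ← mul_assoc, ← mul_assoc]
    refine mul_le_mul_of_nonneg_right ?_ (norm_nonneg _)
    have h1 := hC' u hu'
    calc u * Real.exp (-(z.re * u)) ≤ u * Real.exp (-(s.re / 2 * u)) := by gcongr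
      _ = u ^ 1 * Real.exp (-(s.re / 4) * u) * Real.exp (-(s.re / 4 * u)) := by
          rw [mul_assoc, ← Real.exp_add, pow_one]; congr 2; ring
      _ ≤ _ := by gcongr
  · refine Eventually.of_forall fun u z _ => ?_
    exact ((((hasDerivAt_id z).mul_const (u : ℂ)).fun_neg.cexp).mul_const (f u)).congr_deriv
      (by simp; ring)

/-- Uniqueness for the Laplace transform. -/
theorem eq_zero_of_laplace_eq_zero {f : ℝ → ℝ} (hc : ContinuousOn f (Ioi 0))
    (hi : ∀ s : ℝ, 0 < s → IntegrableOn (fun u : ℝ => Real.exp (-(s * u)) * f u) (Ioi 0))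
    (h0 : ∀ s : ℝ, 0 < s → ∫ u in Ioi (0 : ℝ), Real.exp (-(s * u)) * f u = 0) :
    ∀ u, 0 < u → f u = 0 := by
  have hcast : ∀ s u : ℝ, Complex.exp (-((s : ℂ) * u)) * (f u : ℂ)
      = ((Real.exp (-(s * u)) * f u : ℝ) : ℂ) := fun s u => by push_cast; rfl
  have hf : ∀ s : ℝ, 0 < s →
      IntegrableOn (fun u : ℝ => Complex.exp (-((s : ℂ) * u)) * (f u : ℂ)) (Ioi 0) :=
    fun s hs => by simp only [hcast]; exact (hi s hs).ofReal
  have hm : AEStronglyMeasurable (fun u => (f u : ℂ)) (volume.restrict (Ioi 0)) :=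
    (Complex.continuous_ofReal.comp_continuousOn hc).aestronglyMeasurable measurableSet_Ioi
  set Φ : ℂ → ℂ := fun s => ∫ u in Ioi (0 : ℝ), Complex.exp (-(s * u)) * (f u : ℂ) with hΦ
  have ho : IsOpen {w : ℂ | 0 < w.re} := isOpen_lt continuous_const Complex.continuous_re
  have ha : AnalyticOnNhd ℂ Φ {w : ℂ | 0 < w.re} :=
    DifferentiableOn.analyticOnNhd (fun w hw =>
      (hasDerivAt_laplace hf hm hw).differentiableAt.differentiableWithinAt) ho
  have hreal : ∀ s : ℝ, 0 < s → Φ s = 0 := fun s hs => by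
    simp only [hΦ, hcast]
    rw [integral_complex_ofReal, h0 s hs, Complex.ofReal_zero]
  -- Vanishing for real s extends to the half plane by analyticity; Fourier inversion on the line Re
  -- z = 1 then recovers f.
  have hzero : ∀ w : ℂ, 0 < w.re → Φ w = 0 := fun w hw => by
    refine ha.eqOn_of_preconnected_of_frequently_eq (analyticOnNhd_const (v := 0))
      (convex_halfSpace_re_gt 0).isPreconnected (z₀ := 1) (by simp) ?_ hw
    have ht : Tendsto (fun n : ℕ => ((1 + 1 / ((n : ℝ) + 1) : ℝ) : ℂ)) atTop (𝓝[≠] 1) := by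
      refine tendsto_nhdsWithin_iff.2 ⟨?_, Eventually.of_forall fun n => ?_⟩
      · have := (tendsto_one_div_add_atTop_nhds_zero_nat (𝕜 := ℝ)).const_add 1
        rw [add_zero] at this
        exact (Complex.continuous_ofReal.tendsto' 1 1 Complex.ofReal_one).comp this
      · have : (0 : ℝ) < 1 / ((n : ℝ) + 1) := by positivity
        simp only [mem_compl_iff, mem_singleton_iff]
        exact_mod_cast (by linarith : (1 + 1 / ((n : ℝ) + 1)) > 1).ne'
    exact ht.frequently (Frequently.of_forall fun n => hreal _ (by positivity))
  intro u hu
  set h : ℝ → ℂ := (Ioi (0 : ℝ)).indicator fun u => Complex.exp (-(((1 : ℝ) : ℂ) * u)) * (f u : ℂ)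
    with hh
  have hint : Integrable h := (hf 1 one_pos).integrable_indicator measurableSet_Ioi
  have hH : ∀ y : ℝ, (∫ v : ℝ, Complex.exp (-Complex.I * y * v) * h v) = 0 := fun y => by
    have e : ∀ v : ℝ, Complex.exp (-Complex.I * y * v) * h v = (Ioi (0 : ℝ)).indicator
        (fun v : ℝ => Complex.exp (-((1 + y * Complex.I) * v)) * (f v : ℂ)) v := fun v => by
      by_cases hv : v ∈ Ioi (0 : ℝ)
      · rw [hh, indicator_of_mem hv, indicator_of_mem hv, ← mul_assoc, ← Complex.exp_add]
        congr 2; push_cast; ring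
      · rw [hh, indicator_of_notMem hv, indicator_of_notMem hv, mul_zero]
    simp only [e]
    rw [integral_indicator measurableSet_Ioi]
    exact hzero _ (by simp)
  have hcu : ContinuousAt h u := by
    have : h =ᶠ[𝓝 u] fun u => Complex.exp (-(((1 : ℝ) : ℂ) * u)) * (f u : ℂ) := by
      filter_upwards [Ioi_mem_nhds hu] with v hv
      rw [hh, indicator_of_mem hv]
    refine ContinuousAt.congr ?_ this.symm
    refine ContinuousAt.mul (by fun_prop) ?_
    exact Complex.continuous_ofReal.continuousAt.comp (hc.continuousAt (Ioi_mem_nhds hu))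
  have := fourier_inversion_angular hint (by simp only [hH]; exact integrable_zero _ _ _) hcu
  simp only [hH, mul_zero, integral_zero] at this
  have h2 : h u = 0 := by
    have := this.symm
    simpa using this
  rw [hh, indicator_of_mem (show u ∈ Ioi (0 : ℝ) from hu)] at h2
  have h3 := (mul_eq_zero.1 h2).resolve_left (Complex.exp_ne_zero _)
  exact_mod_cast h3

/-! ### Removing the leading pole from Ai'/Ai -/

/-- `a` is a real zero of `Ai`, the only zero in the half plane `Re z > a - ε`. -/
structure IsLeadingZero (a ε : ℝ) : Prop where
  neg : a < 0
  zero : airyAi a = 0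
  pos : 0 < ε
  unique : ∀ z : ℂ, a - ε < z.re → airyAi z = 0 → z = a

/-- The Airy function with its zero `a` divided out. -/
noncomputable def airyQuot (a : ℝ) : ℂ → ℂ := dslope airyAi a

lemma differentiable_airyQuot (a : ℝ) : Differentiable ℂ (airyQuot a) := by
  rw [← differentiableOn_univ]
  exact (Complex.differentiableOn_dslope univ_mem).2 differentiable_airyAi.differentiableOn

namespace IsLeadingZero

variable {a ε : ℝ}

lemma airyAi_eq (h : IsLeadingZero a ε) (z : ℂ) : airyAi z = (z - a) * airyQuot a z := by
  have := sub_smul_dslope airyAi (a : ℂ) z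
  rw [h.zero, sub_zero, smul_eq_mul] at this
  exact this.symm

lemma _root_.airyQuot_self (a : ℝ) : airyQuot a a = airyAi' a := by
  rw [airyQuot, dslope_same, deriv_airyAi]

lemma airyQuot_ne_zero (h : IsLeadingZero a ε) {z : ℂ} (hz : z = a ∨ airyAi z ≠ 0) :
    airyQuot a z ≠ 0 := by
  rcases hz with rfl | hz
  · rw [airyQuot_self]; exact airyAi'_ne_zero h.zero
  · intro h0; apply hz; rw [h.airyAi_eq, h0, mul_zero]

lemma airyQuot_ne_zero_of_re (h : IsLeadingZero a ε) {z : ℂ} (hz : a - ε < z.re) :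
    airyQuot a z ≠ 0 := by
  by_cases h0 : airyAi z = 0
  · exact h.airyQuot_ne_zero (Or.inl (h.unique z hz h0))
  · exact h.airyQuot_ne_zero (Or.inr h0)

lemma logDeriv_eq (h : IsLeadingZero a ε) {z : ℂ} (hz : airyAi z ≠ 0) :
    airyAi' z / airyAi z = 1 / (z - a) + deriv (airyQuot a) z / airyQuot a z := by
  have hq := h.airyQuot_ne_zero (Or.inr hz)
  have hza : z - a ≠ 0 := by
    intro h0; apply hz; rw [h.airyAi_eq, h0, zero_mul]
  have hd : HasDerivAt airyAi (1 * airyQuot a z + (z - a) * deriv (airyQuot a) z) z := by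
    have : airyAi = fun z => (z - a) * airyQuot a z := funext h.airyAi_eq
    rw [this]
    exact ((hasDerivAt_id z).sub_const _).fun_mul (differentiable_airyQuot a z).hasDerivAt
  rw [(hasDerivAt_airyAi z).unique hd, h.airyAi_eq z]
  field_simp

end IsLeadingZero

/-- The open region `Re z > -|z| / 4`, together with the half plane `Re z > α`. -/
def bigRegion (α : ℝ) : Set ℂ := {z | α < z.re} ∪ {z | -‖z‖ / 4 < z.re}

lemma isOpen_bigRegion (α : ℝ) : IsOpen (bigRegion α) :=
  (isOpen_lt continuous_const Complex.continuous_re).union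
    (isOpen_lt (by fun_prop) Complex.continuous_re)

lemma airyAi_ne_zero_of_slitPlane {z : ℂ} (hz : z ∈ Complex.slitPlane) : airyAi z ≠ 0 := by
  intro h
  obtain ⟨h1, h2⟩ := airyAi_zero_real h
  rw [Complex.mem_slitPlane_iff] at hz
  rcases hz with hz | hz
  · linarith
  · exact hz h1

lemma mem_slitPlane_of_lt {z : ℂ} (hz : -‖z‖ / 4 < z.re) : z ∈ Complex.slitPlane := by
  refine wideSector_slitPlane (le_of_lt hz) ?_
  rintro rfl
  simp at hz

namespace IsLeadingZero

variable {a ε : ℝ}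

/-- A shift `β` such that `z + β` has positive real part when `Re z > a - ε`. -/
def shift (a ε : ℝ) : ℝ := 1 - a + ε

lemma shift_pos (h : IsLeadingZero a ε) : 0 < shift a ε := by
  have := h.neg; have := h.pos; rw [shift]; linarith

/-- The regular part of `Ai' / Ai`, with its leading behaviour at infinity removed. -/
noncomputable def regPart (a ε : ℝ) (z : ℂ) : ℂ :=
  deriv (airyQuot a) z / airyQuot a z + csqrt (z + shift a ε)

lemma add_shift_mem (h : IsLeadingZero a ε) {z : ℂ} (hz : z ∈ bigRegion (a - ε)) :
    z + shift a ε ∈ Complex.slitPlane := by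
  rw [Complex.mem_slitPlane_iff]
  have hs : (z + shift a ε).re = z.re + shift a ε := by simp
  rcases hz with hz | hz
  · left
    have hz' : a - ε < z.re := hz
    rw [hs, shift]; linarith [h.neg, h.pos]
  · rcases (Complex.mem_slitPlane_iff.1 (mem_slitPlane_of_lt hz)) with h1 | h1
    · left; rw [hs]; linarith [h.shift_pos]
    · right; simpa using h1

lemma differentiableOn_regPart (h : IsLeadingZero a ε) :
    DifferentiableOn ℂ (regPart a ε) (bigRegion (a - ε)) := by
  intro z hz
  refine DifferentiableAt.differentiableWithinAt (DifferentiableAt.add (DifferentiableAt.div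
    ((differentiable_airyQuot a).contDiff.differentiable_deriv_two z)
    (differentiable_airyQuot a z) ?_) ?_)
  · rcases hz with hz | hz
    · exact h.airyQuot_ne_zero_of_re hz
    · exact h.airyQuot_ne_zero (Or.inr (airyAi_ne_zero_of_slitPlane (mem_slitPlane_of_lt hz)))
  · exact (hasDerivAt_csqrt (h.add_shift_mem hz)).differentiableAt.comp z
      (differentiableAt_id.add_const _)

/-- Besides Ai'/Ai + √z = O(1/|z|) and the pole 1/(z - a), the error is √(z+β) - √z = β/(√(z+β) +
√z), which dominates with order |z|^{-1/2}. -/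
lemma norm_regPart_le (h : IsLeadingZero a ε) : ∃ R > 1, ∃ C > 0, ∀ z ∈ wideSector, R ≤ ‖z‖ →
    ‖regPart a ε z‖ ≤ C / Real.sqrt ‖z‖ := by
  obtain ⟨R, hR, C, hC, hb⟩ := airy_logDeriv_bound
  have hsp := h.shift_pos
  refine ⟨R + 2 * |a|, by linarith [abs_nonneg a], C + 2 + 2 * shift a ε, by positivity,
    fun z hz hzR => ?_⟩
  obtain ⟨h0, h1⟩ := hb z hz (by linarith [abs_nonneg a])
  have hz1 : 1 < ‖z‖ := by linarith [abs_nonneg a]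
  have hz0 : z ≠ 0 := norm_pos_iff.1 (by linarith)
  have hs0 : 0 < Real.sqrt ‖z‖ := Real.sqrt_pos.2 (by linarith)
  have hs1 : Real.sqrt ‖z‖ ≤ ‖z‖ := by
    rw [Real.sqrt_le_left (by linarith)]; nlinarith
  have e : regPart a ε z = (airyAi' z / airyAi z + csqrt z) - 1 / (z - a)
      + (csqrt (z + shift a ε) - csqrt z) := by
    rw [h.logDeriv_eq h0, regPart]; ring
  have t1 : C / ‖z‖ ≤ C / Real.sqrt ‖z‖ := by gcongr
  have t2 : ‖1 / (z - a)‖ ≤ 2 / Real.sqrt ‖z‖ := by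
    have : ‖z‖ / 2 ≤ ‖z - a‖ := by
      have := norm_sub_norm_le z (a : ℂ)
      rw [Complex.norm_real, Real.norm_eq_abs] at this
      linarith
    rw [norm_div, norm_one]
    calc 1 / ‖z - a‖ ≤ 1 / (‖z‖ / 2) := by gcongr
      _ = 2 / ‖z‖ := by rw [one_div_div]
      _ ≤ _ := by gcongr
  have hsl := wideSector_slitPlane hz hz0
  have t3 : ‖csqrt (z + shift a ε) - csqrt z‖ ≤ 2 * shift a ε / Real.sqrt ‖z‖ := by
    have hre : ‖csqrt z‖ / 2 ≤ ‖csqrt (z + shift a ε) + csqrt z‖ := by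
      refine (csqrt_wideSector hz).trans (le_trans ?_ (Complex.re_le_norm _))
      rw [Complex.add_re]
      linarith [csqrt_re_nonneg (z + shift a ε)]
    have hmul : (csqrt (z + shift a ε) - csqrt z) * (csqrt (z + shift a ε) + csqrt z)
        = shift a ε := by
      have e1 := csqrt_sq (z + shift a ε)
      have e2 := csqrt_sq z
      linear_combination e1 - e2
    have hn := congrArg norm hmul
    rw [norm_mul, Complex.norm_real, Real.norm_of_nonneg hsp.le] at hn
    rw [norm_csqrt] at hre
    rw [le_div_iff₀ hs0]
    have := mul_le_mul_of_nonneg_left hre (norm_nonneg (csqrt (z + shift a ε) - csqrt z))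
    linarith
  rw [e]
  calc _ ≤ C / Real.sqrt ‖z‖ + 2 / Real.sqrt ‖z‖ + 2 * shift a ε / Real.sqrt ‖z‖ := by
        refine (norm_add_le _ _).trans (add_le_add ((norm_sub_le _ _).trans
          (add_le_add (h1.trans t1) t2)) t3)
    _ = _ := by ring

/-- Cauchy's estimate on a disc of radius |z|/16 gains a full power of |z|. Such a disc may leave
the half plane Re w > a - ε but stays in the sector once |z| is large compared with |c|; hence
holomorphy on `bigRegion`. -/
lemma norm_deriv_regPart_le (h : IsLeadingZero a ε) (c : ℝ) : ∃ R > 1, ∃ C > 0, ∀ z : ℂ,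
    c ≤ z.re → R ≤ ‖z‖ → ‖deriv (regPart a ε) z‖ ≤ C / (‖z‖ * Real.sqrt ‖z‖) := by
  obtain ⟨R, hR, C, hC, hb⟩ := h.norm_regPart_le
  refine ⟨2 * R + 16 * |c|, by linarith [abs_nonneg c], 32 * C, by positivity,
    fun z hz hzR => ?_⟩
  have hn : 1 < ‖z‖ := by linarith [abs_nonneg c]
  have hball : ∀ w ∈ Metric.closedBall z (‖z‖ / 16), -‖w‖ / 4 < w.re ∧ ‖z‖ / 2 ≤ ‖w‖ := by
    intro w hw
    rw [Metric.mem_closedBall, dist_eq_norm] at hw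
    have h1 := norm_sub_norm_le z w
    rw [norm_sub_rev] at h1
    have h2 := Complex.abs_re_le_norm (w - z)
    rw [Complex.sub_re] at h2
    have h3 := neg_abs_le (w.re - z.re)
    have h4 := neg_abs_le c
    constructor <;> linarith
  have hd : DiffContOnCl ℂ (regPart a ε) (Metric.ball z (‖z‖ / 16)) := by
    refine (h.differentiableOn_regPart.mono fun w hw => ?_).diffContOnCl
    rw [closure_ball _ (by positivity)] at hw
    exact Or.inr (hball w hw).1
  have hs0 : 0 < Real.sqrt ‖z‖ := Real.sqrt_pos.2 (by linarith)
  have := Complex.norm_deriv_le_of_forall_mem_sphere_norm_le (C := 2 * C / Real.sqrt ‖z‖)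
    (by positivity) hd fun w hw => by
    obtain ⟨h1, h2⟩ := hball w (Metric.sphere_subset_closedBall hw)
    refine (hb w h1.le (by linarith [abs_nonneg c])).trans ?_
    have h3 : Real.sqrt ‖z‖ / 2 ≤ Real.sqrt ‖w‖ := by
      rw [Real.le_sqrt' (by positivity), div_pow, Real.sq_sqrt (by linarith)]; linarith
    calc C / Real.sqrt ‖w‖ ≤ C / (Real.sqrt ‖z‖ / 2) := by gcongr
      _ = _ := by field_simp
  refine this.trans (le_of_eq ?_)
  field_simp
  norm_num

end IsLeadingZero

lemma decay_of_decay_at_infinity {α : ℝ} {K : ℂ → ℂ} (hK : ContinuousOn K {z | α < z.re})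
    {c : ℝ} (hc : α < c) (h : ∃ R > 1, ∃ C > 0, ∀ z : ℂ, c ≤ z.re → R ≤ ‖z‖ →
      ‖K z‖ ≤ C / (‖z‖ * Real.sqrt ‖z‖)) :
    ∃ C > 0, ∀ z : ℂ, c ≤ z.re → ‖K z‖ ≤ C * (1 + ‖z‖) ^ (-(3 / 2) : ℝ) := by
  obtain ⟨R, hR, C, hC, hb⟩ := h
  have hcomp : IsCompact (Metric.closedBall (0 : ℂ) R ∩ {z | c ≤ z.re}) :=
    (isCompact_closedBall _ _).inter_right (isClosed_le continuous_const Complex.continuous_re)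
  obtain ⟨M, hM⟩ := hcomp.exists_bound_of_continuousOn (hK.mono fun z hz => lt_of_lt_of_le hc hz.2)
  have e32 : ∀ x : ℝ, 0 < x → x ^ (-(3 / 2) : ℝ) = (x * Real.sqrt x)⁻¹ := fun x hx => by
    rw [Real.rpow_neg hx.le, show (3 / 2 : ℝ) = 1 + 1 / 2 by norm_num, Real.rpow_add hx,
      Real.rpow_one, Real.sqrt_eq_rpow]
  refine ⟨|M| * ((1 + R) * Real.sqrt (1 + R)) + 4 * C, by positivity, fun z hz => ?_⟩
  have hz0 := norm_nonneg z
  rw [e32 _ (by positivity), ← div_eq_mul_inv, le_div_iff₀ (by positivity)]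
  rcases le_total ‖z‖ R with hzR | hzR
  · have h1 : ‖K z‖ ≤ |M| :=
      (hM z ⟨mem_closedBall_zero_iff.2 hzR, hz⟩).trans (le_abs_self M)
    calc ‖K z‖ * ((1 + ‖z‖) * Real.sqrt (1 + ‖z‖)) ≤ |M| * ((1 + R) * Real.sqrt (1 + R)) := by
          gcongr
      _ ≤ _ := by linarith
  · have h1 := hb z hz hzR
    have hz1 : 1 < ‖z‖ := by linarith
    have hs0 : 0 < Real.sqrt ‖z‖ := Real.sqrt_pos.2 (by linarith)
    rw [le_div_iff₀ (by positivity)] at h1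
    have h2 : Real.sqrt (1 + ‖z‖) ≤ 2 * Real.sqrt ‖z‖ := by
      rw [Real.sqrt_le_left (by positivity), mul_pow, Real.sq_sqrt hz0]; linarith
    calc ‖K z‖ * ((1 + ‖z‖) * Real.sqrt (1 + ‖z‖))
        ≤ ‖K z‖ * ((2 * ‖z‖) * (2 * Real.sqrt ‖z‖)) := by gcongr; linarith
      _ = 4 * (‖K z‖ * (‖z‖ * Real.sqrt ‖z‖)) := by ring
      _ ≤ 4 * C := by linarith
      _ ≤ _ := by
        have : 0 ≤ |M| * ((1 + R) * Real.sqrt (1 + R)) := by positivity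
        linarith

/-- Passing to the derivative is what makes the inversion integral converge absolutely: order -1/2
becomes -3/2. On the other side it multiplies the density by u. -/
theorem IsLeadingZero.isLaplaceImage {a ε : ℝ} (h : IsLeadingZero a ε) :
    IsLaplaceImage (a - ε) fun z => -deriv (IsLeadingZero.regPart a ε) z := by
  have hd : DifferentiableOn ℂ (fun z => -deriv (IsLeadingZero.regPart a ε) z)
      {z | a - ε < z.re} :=
    ((h.differentiableOn_regPart.deriv (isOpen_bigRegion _)).neg).mono fun z hz => Or.inl hz
  refine ⟨hd, fun c hc => decay_of_decay_at_infinity hd.continuousOn hc ?_⟩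
  obtain ⟨R, hR, C, hC, hb⟩ := h.norm_deriv_regPart_le c
  exact ⟨R, hR, C, hC, fun z hz hzR => by rw [norm_neg]; exact hb z hz hzR⟩

/-! ### Elementary Laplace transforms -/

lemma integrableOn_exp_mul_rpow {σ s : ℝ} (hs : 0 < s) (hσ : -1 < σ) :
    IntegrableOn (fun u : ℝ => Real.exp (-(s * u)) * u ^ σ) (Ioi 0) := by
  have := integrableOn_rpow_mul_exp_neg_mul_rpow (p := 1) hσ one_pos hs
  refine IntegrableOn.congr_fun this (fun u _ => ?_) measurableSet_Ioi
  simp only [Real.rpow_one, neg_mul]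
  ring

lemma inv_sqrt_four_pi_mul {u : ℝ} (hu : 0 < u) :
    (Real.sqrt (4 * Real.pi * u))⁻¹ = (2 * Real.sqrt Real.pi)⁻¹ * u ^ (-(1 / 2) : ℝ) := by
  rw [show 4 * Real.pi * u = 2 ^ 2 * (Real.pi * u) by ring, Real.sqrt_mul (by norm_num),
    Real.sqrt_sq (by norm_num), Real.sqrt_mul Real.pi_pos.le, Real.rpow_neg hu.le,
    ← Real.sqrt_eq_rpow, ← mul_assoc, mul_inv]

lemma integrableOn_exp_mul_inv_sqrt {s : ℝ} (hs : 0 < s) :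
    IntegrableOn (fun u : ℝ => Real.exp (-(s * u)) * (Real.sqrt (4 * Real.pi * u))⁻¹) (Ioi 0) := by
  refine IntegrableOn.congr_fun ((integrableOn_exp_mul_rpow (σ := -(1 / 2)) hs
    (by norm_num)).const_mul (2 * Real.sqrt Real.pi)⁻¹) (fun u hu => ?_) measurableSet_Ioi
  simp only [inv_sqrt_four_pi_mul hu]
  ring

lemma laplace_inv_sqrt {s : ℝ} (hs : 0 < s) :
    ∫ u in Ioi (0 : ℝ), Real.exp (-(s * u)) * (Real.sqrt (4 * Real.pi * u))⁻¹
      = 1 / (2 * Real.sqrt s) := by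
  have h := Real.integral_rpow_mul_exp_neg_mul_Ioi (a := 1 / 2) (by norm_num) hs
  have e : ∫ u in Ioi (0 : ℝ), Real.exp (-(s * u)) * (Real.sqrt (4 * Real.pi * u))⁻¹
      = ∫ u in Ioi (0 : ℝ), (2 * Real.sqrt Real.pi)⁻¹ *
        (u ^ ((1 / 2 : ℝ) - 1) * Real.exp (-(s * u))) := by
    refine setIntegral_congr_fun measurableSet_Ioi fun u hu => ?_
    simp only [inv_sqrt_four_pi_mul hu]
    rw [show ((1 / 2 : ℝ) - 1) = -(1 / 2) by norm_num]
    ring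
  rw [e, integral_const_mul, h, Real.Gamma_one_half_eq, ← Real.sqrt_eq_rpow, one_div s,
    Real.sqrt_inv]
  have := Real.sqrt_pos.2 Real.pi_pos
  have := Real.sqrt_pos.2 hs
  field_simp

lemma laplace_mul_exp {s a : ℝ} (hs : a < s) :
    ∫ u in Ioi (0 : ℝ), Real.exp (-(s * u)) * (u * Real.exp (a * u)) = 1 / (s - a) ^ 2 := by
  have h := Real.integral_rpow_mul_exp_neg_mul_Ioi (a := 2) (r := s - a) (by norm_num)
    (by linarith)
  have e : ∫ u in Ioi (0 : ℝ), Real.exp (-(s * u)) * (u * Real.exp (a * u))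
      = ∫ u in Ioi (0 : ℝ), u ^ ((2 : ℝ) - 1) * Real.exp (-((s - a) * u)) := by
    refine setIntegral_congr_fun measurableSet_Ioi fun u _ => ?_
    rw [show ((2 : ℝ) - 1) = 1 by norm_num, Real.rpow_one,
      show -((s - a) * u) = -(s * u) + a * u by ring, Real.exp_add]
    ring
  rw [e, h, show (2 : ℝ) = ((2 : ℕ) : ℝ) by norm_num, Real.rpow_natCast, one_div_pow,
    show (((2 : ℕ) : ℝ)) = ((1 : ℕ) : ℝ) + 1 by norm_num, Real.Gamma_nat_eq_factorial]
  simp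

lemma integrableOn_exp_mul_mul_exp {s a : ℝ} (hs : a < s) :
    IntegrableOn (fun u : ℝ => Real.exp (-(s * u)) * (u * Real.exp (a * u))) (Ioi 0) := by
  refine IntegrableOn.congr_fun (integrableOn_exp_mul_rpow (σ := 1) (s := s - a) (by linarith)
    (by norm_num)) (fun u _ => ?_) measurableSet_Ioi
  rw [Real.rpow_one, show -((s - a) * u) = -(s * u) + a * u by ring, Real.exp_add]
  ring

lemma csqrt_ofReal {s : ℝ} (hs : 0 ≤ s) : csqrt s = (Real.sqrt s : ℂ) := by
  rw [csqrt, Real.sqrt_eq_rpow, Complex.ofReal_cpow hs]; norm_num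

/-! ### The jump density: construction, transform and asymptotics -/

namespace IsLeadingZero

variable {a ε : ℝ}

/-- The inverse Laplace transform of the derivative of the regular part. -/
noncomputable def remainder (a ε : ℝ) (u : ℝ) : ℝ :=
  (invLaplace (fun z => -deriv (regPart a ε) z) 1 u).re

/-- `u` times the jump density, in normalized variables. -/
noncomputable def sizeBiased (a ε : ℝ) (u : ℝ) : ℝ :=
  remainder a ε u + Real.exp (-(shift a ε * u)) * (Real.sqrt (4 * Real.pi * u))⁻¹
    + u * Real.exp (a * u)

lemma lt_one (h : IsLeadingZero a ε) : a - ε < 1 := by linarith [h.neg, h.pos]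

lemma continuous_remainder (h : IsLeadingZero a ε) : Continuous (remainder a ε) :=
  Complex.continuous_re.comp (h.isLaplaceImage.continuous_invLaplace h.lt_one)

lemma abs_remainder_le (h : IsLeadingZero a ε) :
    ∃ C > 0, ∀ u, |remainder a ε u| ≤ C * Real.exp ((a - ε / 2) * u) := by
  obtain ⟨C, hC, hb⟩ := h.isLaplaceImage.exists_norm_invLaplace_le h.lt_one (d := a - ε / 2)
    (by linarith [h.pos])
  exact ⟨C, hC, fun u => (Complex.abs_re_le_norm _).trans (hb u)⟩

lemma abs_remainder_le_rpow (h : IsLeadingZero a ε) :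
    ∃ C > 0, ∀ u, 0 < u → |remainder a ε u| ≤ C * u ^ (1 / 4 : ℝ) := by
  obtain ⟨C, hC, hb⟩ := h.isLaplaceImage.exists_norm_invLaplace_le_rpow h.lt_one h.lt_one
  obtain ⟨D, hD, hb'⟩ := h.abs_remainder_le
  refine ⟨C + D, by positivity, fun u hu => ?_⟩
  have hp : 0 < u ^ (1 / 4 : ℝ) := by positivity
  rcases le_total u 1 with h1 | h1
  · refine ((Complex.abs_re_le_norm _).trans (hb u hu h1)).trans ?_
    gcongr; linarith
  · refine (hb' u).trans ?_
    have e1 : Real.exp ((a - ε / 2) * u) ≤ 1 := by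
      rw [Real.exp_le_one_iff]
      exact mul_nonpos_of_nonpos_of_nonneg (by linarith [h.neg, h.pos]) hu.le
    have e2 : 1 ≤ u ^ (1 / 4 : ℝ) := Real.one_le_rpow h1 (by norm_num)
    calc D * Real.exp ((a - ε / 2) * u) ≤ D * u ^ (1 / 4 : ℝ) := by gcongr; linarith
      _ ≤ _ := by gcongr; linarith

lemma laplace_remainder (h : IsLeadingZero a ε) {s : ℝ} (hs : 0 < s) :
    IntegrableOn (fun u : ℝ => Real.exp (-(s * u)) * remainder a ε u) (Ioi 0) ∧
    ∫ u in Ioi (0 : ℝ), Real.exp (-(s * u)) * remainder a ε u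
      = (-deriv (regPart a ε) s).re := by
  obtain ⟨h1, h2⟩ := h.isLaplaceImage.laplace_invLaplace h.lt_one (s := s)
    (by linarith [h.neg, h.pos])
  have e : ∀ u : ℝ, Real.exp (-(s * u)) * remainder a ε u = (Complex.exp (-(s * u)) *
      invLaplace (fun z => -deriv (regPart a ε) z) 1 u).re := fun u => by
    rw [← Complex.ofReal_mul, ← Complex.ofReal_neg, ← Complex.ofReal_exp, Complex.re_ofReal_mul,
      remainder]
  simp only [e]
  refine ⟨h1.re, ?_⟩
  have := integral_re h1
  simp only [RCLike.re_to_complex] at this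
  rw [this, h2]

lemma abs_sizeBiased_le (h : IsLeadingZero a ε) : ∃ C > 0, ∀ u, 0 < u →
    |sizeBiased a ε u| ≤ C * ((Real.sqrt u)⁻¹ + u) * Real.exp (a * u) := by
  obtain ⟨C, hC, hb⟩ := h.abs_remainder_le
  refine ⟨C + 2, by positivity, fun u hu => ?_⟩
  have hs : 0 < Real.sqrt u := Real.sqrt_pos.2 hu
  have hone : 1 ≤ (Real.sqrt u)⁻¹ + u := by
    rcases le_total u 1 with h1 | h1
    · have : 1 ≤ (Real.sqrt u)⁻¹ := (one_le_inv₀ hs).2 (Real.sqrt_le_one.2 h1)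
      linarith
    · have : 0 < (Real.sqrt u)⁻¹ := inv_pos.2 hs
      linarith
  have e1 : Real.exp ((a - ε / 2) * u) ≤ Real.exp (a * u) := by
    apply Real.exp_le_exp.2; nlinarith [h.pos]
  have e2 : Real.exp (-(shift a ε * u)) ≤ Real.exp (a * u) := by
    apply Real.exp_le_exp.2; rw [shift]; nlinarith [h.pos]
  have e3 : (Real.sqrt (4 * Real.pi * u))⁻¹ ≤ (Real.sqrt u)⁻¹ := by
    refine inv_anti₀ hs (Real.sqrt_le_sqrt ?_)
    nlinarith [Real.pi_gt_three]
  have hE := Real.exp_pos (a * u)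
  rw [sizeBiased]
  refine (abs_add_three _ _ _).trans ?_
  rw [abs_of_nonneg (a := u * Real.exp (a * u)) (by positivity),
    abs_of_nonneg (a := Real.exp (-(shift a ε * u)) * _) (by positivity)]
  have h1 : |remainder a ε u| ≤ C * ((Real.sqrt u)⁻¹ + u) * Real.exp (a * u) := by
    refine (hb u).trans ?_
    calc C * Real.exp ((a - ε / 2) * u) ≤ C * Real.exp (a * u) := by gcongr
      _ = C * 1 * Real.exp (a * u) := by ring
      _ ≤ _ := by gcongr
  have h2 : Real.exp (-(shift a ε * u)) * (Real.sqrt (4 * Real.pi * u))⁻¹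
      ≤ ((Real.sqrt u)⁻¹ + u) * Real.exp (a * u) := by
    rw [mul_comm]
    gcongr
    linarith
  have h3 : u * Real.exp (a * u) ≤ ((Real.sqrt u)⁻¹ + u) * Real.exp (a * u) := by
    gcongr
    have : 0 < (Real.sqrt u)⁻¹ := inv_pos.2 hs
    linarith
  linarith

lemma sqrt_four_pi_cube {u : ℝ} (hu : 0 < u) :
    (Real.sqrt (4 * Real.pi * u ^ 3))⁻¹ = (Real.sqrt (4 * Real.pi * u))⁻¹ / u := by
  rw [show 4 * Real.pi * u ^ 3 = u ^ 2 * (4 * Real.pi * u) by ring,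
    Real.sqrt_mul (by positivity), Real.sqrt_sq hu.le, mul_inv]
  field_simp

/-- The jump density minus its singular part, in normalized variables. -/
noncomputable def regDensity (a ε : ℝ) (u : ℝ) : ℝ :=
  sizeBiased a ε u / u - (Real.sqrt (4 * Real.pi * u ^ 3))⁻¹

lemma mul_regDensity {u : ℝ} (hu : 0 < u) : u * regDensity a ε u = remainder a ε u +
    Real.exp (-(shift a ε * u)) * (Real.sqrt (4 * Real.pi * u))⁻¹
    - (Real.sqrt (4 * Real.pi * u))⁻¹ + u * Real.exp (a * u) := by
  rw [regDensity, sqrt_four_pi_cube hu, sizeBiased]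
  field_simp
  ring

lemma continuousOn_sizeBiased (h : IsLeadingZero a ε) : ContinuousOn (sizeBiased a ε) (Ioi 0) := by
  unfold sizeBiased
  refine ContinuousOn.add (ContinuousOn.add h.continuous_remainder.continuousOn
    (ContinuousOn.mul (by fun_prop) (ContinuousOn.inv₀ (by fun_prop) fun u hu => ?_)))
    (by fun_prop)
  have hu' : (0 : ℝ) < u := hu
  positivity

lemma continuousOn_regDensity (h : IsLeadingZero a ε) : ContinuousOn (regDensity a ε) (Ioi 0) := by
  unfold regDensity
  refine ContinuousOn.sub (h.continuousOn_sizeBiased.div continuousOn_id fun u hu => ne_of_gt hu)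
    (ContinuousOn.inv₀ (by fun_prop) fun u hu => ?_)
  have hu' : (0 : ℝ) < u := hu
  positivity

/-- After division by u, the bound u^{1/4} on the remainder becomes u^{-3/4}, and (e^{-βu} -
1)u^{-1/2} becomes u^{-1/2}. Both are integrable at 0, so the singular part subtracted in the
problem is the right one. -/
lemma abs_regDensity_le (h : IsLeadingZero a ε) : ∃ C > 0, ∀ u, 0 < u →
    |regDensity a ε u| ≤ C * (u ^ (-(3 / 4) : ℝ) + u ^ (-(1 / 2) : ℝ) + 1) := by
  obtain ⟨C, hC, hb⟩ := h.abs_remainder_le_rpow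
  have hsp := h.shift_pos
  refine ⟨C + shift a ε + 1, by positivity, fun u hu => ?_⟩
  have e : |u| * |regDensity a ε u| ≤ C * u ^ (1 / 4 : ℝ) + shift a ε * u * u ^ (-(1 / 2) : ℝ)
      + u := by
    rw [← abs_mul, mul_regDensity hu, show ∀ x y z w : ℝ, x + y * z - z + w
      = x + (y - 1) * z + w by intros; ring]
    refine (abs_add_three _ _ _).trans ?_
    have h1 := hb u hu
    have h2 : |(Real.exp (-(shift a ε * u)) - 1) * (Real.sqrt (4 * Real.pi * u))⁻¹|
        ≤ shift a ε * u * u ^ (-(1 / 2) : ℝ) := by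
      rw [abs_mul, abs_of_nonneg (a := (Real.sqrt (4 * Real.pi * u))⁻¹) (by positivity)]
      have e1 : |Real.exp (-(shift a ε * u)) - 1| ≤ shift a ε * u := by
        have hp : 0 ≤ shift a ε * u := by positivity
        rw [abs_sub_comm, abs_of_nonneg (by
          have : Real.exp (-(shift a ε * u)) ≤ 1 := Real.exp_le_one_iff.2 (by linarith)
          linarith)]
        linarith [Real.add_one_le_exp (-(shift a ε * u))]
      have e2 : (Real.sqrt (4 * Real.pi * u))⁻¹ ≤ u ^ (-(1 / 2) : ℝ) := by
        rw [inv_sqrt_four_pi_mul hu]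
        refine mul_le_of_le_one_left (by positivity) (inv_le_one_of_one_le₀ ?_)
        have : 1 ≤ Real.sqrt Real.pi := by
          rw [Real.one_le_sqrt]; linarith [Real.pi_gt_three]
        linarith
      gcongr
    have h3 : |u * Real.exp (a * u)| ≤ u := by
      rw [abs_of_nonneg (by positivity)]
      refine mul_le_of_le_one_right hu.le (Real.exp_le_one_iff.2 ?_)
      nlinarith [h.neg]
    linarith
  rw [abs_of_pos hu] at e
  have e4 : u ^ (1 / 4 : ℝ) = u * u ^ (-(3 / 4) : ℝ) := by
    rw [← Real.rpow_one_add' hu.le (by norm_num)]; norm_num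
  rw [e4] at e
  have e5 : |regDensity a ε u| ≤ C * u ^ (-(3 / 4) : ℝ) + shift a ε * u ^ (-(1 / 2) : ℝ) + 1 := by
    have : u * |regDensity a ε u| ≤ u * (C * u ^ (-(3 / 4) : ℝ) + shift a ε * u ^ (-(1 / 2) : ℝ)
        + 1) := by linarith
    exact le_of_mul_le_mul_left this hu
  refine e5.trans ?_
  have p1 : 0 ≤ u ^ (-(3 / 4) : ℝ) := by positivity
  have p2 : 0 ≤ u ^ (-(1 / 2) : ℝ) := by positivity
  have q1 : 0 ≤ (shift a ε + 1) * u ^ (-(3 / 4) : ℝ) := by positivity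
  have q2 : 0 ≤ (C + 1) * u ^ (-(1 / 2) : ℝ) := by positivity
  linarith

lemma integrableOn_regDensity (h : IsLeadingZero a ε) {s : ℝ} (hs : 0 < s) :
    IntegrableOn (fun u : ℝ => Real.exp (-(s * u)) * regDensity a ε u) (Ioi 0) := by
  obtain ⟨C, hC, hb⟩ := h.abs_regDensity_le
  have hi := (((integrableOn_exp_mul_rpow (σ := -(3 / 4)) hs (by norm_num)).add
    (integrableOn_exp_mul_rpow (σ := -(1 / 2)) hs (by norm_num))).add
    (integrableOn_exp_mul_rpow (σ := 0) hs (by norm_num))).const_mul C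
  refine Integrable.mono' hi (ContinuousOn.aestronglyMeasurable (ContinuousOn.mul (by fun_prop)
    h.continuousOn_regDensity) measurableSet_Ioi)
    ((ae_restrict_iff' measurableSet_Ioi).2 (Eventually.of_forall fun u hu => ?_))
  rw [norm_mul, Real.norm_of_nonneg (Real.exp_pos _).le, Real.norm_eq_abs]
  calc _ ≤ Real.exp (-(s * u)) * (C * (u ^ (-(3 / 4) : ℝ) + u ^ (-(1 / 2) : ℝ) + 1)) := by
        gcongr; exact hb u hu
    _ = _ := by simp only [Pi.add_apply, Real.rpow_zero]; ring

lemma laplace_mul_regDensity (h : IsLeadingZero a ε) {s : ℝ} (hs : 0 < s) :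
    ∫ u in Ioi (0 : ℝ), Real.exp (-(s * u)) * (u * regDensity a ε u)
      = (-deriv (regPart a ε) s).re + 1 / (2 * Real.sqrt (s + shift a ε)) - 1 / (2 * Real.sqrt s)
        + 1 / (s - a) ^ 2 := by
  obtain ⟨h1, h2⟩ := h.laplace_remainder hs
  have hsp := h.shift_pos
  have hs' : 0 < s + shift a ε := by linarith
  have e : ∀ u ∈ Ioi (0 : ℝ), Real.exp (-(s * u)) * (u * regDensity a ε u)
      = Real.exp (-(s * u)) * remainder a ε u
      + Real.exp (-((s + shift a ε) * u)) * (Real.sqrt (4 * Real.pi * u))⁻¹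
      - Real.exp (-(s * u)) * (Real.sqrt (4 * Real.pi * u))⁻¹
      + Real.exp (-(s * u)) * (u * Real.exp (a * u)) := fun u hu => by
    rw [mul_regDensity hu, show -((s + shift a ε) * u) = -(s * u) + -(shift a ε * u) by ring,
      Real.exp_add]
    ring
  have i2 := integrableOn_exp_mul_inv_sqrt hs'
  have i3 := integrableOn_exp_mul_inv_sqrt hs
  have i4 := integrableOn_exp_mul_mul_exp (s := s) (a := a) (by linarith [h.neg])
  have i12 : IntegrableOn (fun u : ℝ => Real.exp (-(s * u)) * remainder a ε u
      + Real.exp (-((s + shift a ε) * u)) * (Real.sqrt (4 * Real.pi * u))⁻¹) (Ioi 0) := h1.add i2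
  have i123 : IntegrableOn (fun u : ℝ => Real.exp (-(s * u)) * remainder a ε u
      + Real.exp (-((s + shift a ε) * u)) * (Real.sqrt (4 * Real.pi * u))⁻¹
      - Real.exp (-(s * u)) * (Real.sqrt (4 * Real.pi * u))⁻¹) (Ioi 0) := i12.sub i3
  rw [setIntegral_congr_fun measurableSet_Ioi e, integral_add i123 i4, integral_sub i12 i3, integral_add h1 i2, h2, laplace_inv_sqrt hs',
    laplace_inv_sqrt hs, laplace_mul_exp (by linarith [h.neg])]

/-- Term by term, the derivatives of 1/(z - a), r(z), -√(z + β) and √z are minus the transforms of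
the four summands of u times the regularized density. -/
lemma hasDerivAt_logDeriv_add_csqrt (h : IsLeadingZero a ε) {s : ℝ} (hs : 0 < s) :
    HasDerivAt (fun x : ℝ => (airyAi' x / airyAi x + csqrt x).re)
    (-∫ u in Ioi (0 : ℝ), Real.exp (-(s * u)) * (u * regDensity a ε u)) s := by
  have hsp := h.shift_pos
  have hsl : (s : ℂ) ∈ Complex.slitPlane := Or.inl (by simpa using hs)
  have hU : (s : ℂ) ∈ bigRegion (a - ε) := Or.inl (by
    simp only [mem_ofPred_eq, Complex.ofReal_re]; linarith [h.neg, h.pos])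
  have hsa : (s : ℂ) - a ≠ 0 := by
    rw [← Complex.ofReal_sub]; exact_mod_cast (by linarith [h.neg] : s - a > 0).ne'
  have d1 : HasDerivAt (fun z : ℂ => 1 / (z - a)) (-1 / ((s : ℂ) - a) ^ 2) s := by
    have := ((hasDerivAt_id (s : ℂ)).sub_const (a : ℂ)).fun_inv hsa
    simpa [one_div] using this
  have d2 := (h.differentiableOn_regPart.differentiableAt
    ((isOpen_bigRegion _).mem_nhds hU)).hasDerivAt
  have d3 : HasDerivAt (fun z : ℂ => csqrt (z + shift a ε))
      (1 / (2 * csqrt ((s : ℂ) + shift a ε))) s := by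
    simpa [Function.comp_def] using
      (hasDerivAt_csqrt (h.add_shift_mem hU)).comp_add_const (s : ℂ) (shift a ε : ℂ)
  have d4 := hasDerivAt_csqrt hsl
  have hd := ((d1.fun_add d2).fun_sub d3).fun_add d4
  have hev : (fun z : ℂ => airyAi' z / airyAi z + csqrt z) =ᶠ[𝓝 (s : ℂ)] fun z =>
      1 / (z - a) + regPart a ε z - csqrt (z + shift a ε) + csqrt z := by
    filter_upwards [Complex.isOpen_slitPlane.mem_nhds hsl] with z hz
    rw [h.logDeriv_eq (airyAi_ne_zero_of_slitPlane hz), regPart]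
    ring
  have hre := (hd.congr_of_eventuallyEq hev).real_of_complex
  refine hre.congr_deriv ?_
  rw [h.laplace_mul_regDensity hs, csqrt_ofReal hs.le, ← Complex.ofReal_add,
    csqrt_ofReal (by linarith : 0 ≤ s + shift a ε)]
  have e1 : (-1 / ((s : ℂ) - a) ^ 2) = ((-1 / (s - a) ^ 2 : ℝ) : ℂ) := by push_cast; ring
  have e2 : ∀ x : ℝ, (1 / (2 * (x : ℂ))) = ((1 / (2 * x) : ℝ) : ℂ) := fun x => by push_cast; ring
  rw [e1, e2, e2, Complex.add_re, Complex.sub_re, Complex.add_re, Complex.ofReal_re,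
    Complex.ofReal_re, Complex.ofReal_re, Complex.neg_re]
  ring

lemma hasDerivAt_laplace_regDensity (h : IsLeadingZero a ε) {s : ℝ} (hs : 0 < s) :
    HasDerivAt (fun s : ℝ => ∫ u in Ioi (0 : ℝ), Real.exp (-(s * u)) * regDensity a ε u)
    (-∫ u in Ioi (0 : ℝ), Real.exp (-(s * u)) * (u * regDensity a ε u)) s := by
  have hcast : ∀ s u : ℝ, Complex.exp (-((s : ℂ) * u)) * (regDensity a ε u : ℂ)
      = ((Real.exp (-(s * u)) * regDensity a ε u : ℝ) : ℂ) := fun s u => by push_cast; rfl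
  have := (hasDerivAt_laplace (f := fun u => (regDensity a ε u : ℂ)) (s := s) (fun σ hσ => by
    simp only [hcast]; exact (h.integrableOn_regDensity hσ).ofReal)
    ((Complex.continuous_ofReal.comp_continuousOn
      h.continuousOn_regDensity).aestronglyMeasurable measurableSet_Ioi)
    (by simpa using hs)).real_of_complex
  simp only [hcast] at this
  simp only [← Complex.ofReal_mul, ← Complex.ofReal_neg] at this
  simp only [integral_complex_ofReal, Complex.ofReal_re] at this
  refine this.congr_deriv ?_
  rw [← integral_neg]
  congr 1; ext u; ring

lemma tendsto_laplace_regDensity (h : IsLeadingZero a ε) :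
    Tendsto (fun s : ℝ => ∫ u in Ioi (0 : ℝ), Real.exp (-(s * u)) * regDensity a ε u)
    atTop (𝓝 0) := by
  suffices Tendsto (fun s : ℝ => ∫ u in Ioi (0 : ℝ), Real.exp (-(s * u)) * regDensity a ε u)
      atTop (𝓝 (∫ u in Ioi (0 : ℝ), (0 : ℝ))) by simpa using this
  refine tendsto_integral_filter_of_dominated_convergence
    (fun u => ‖Real.exp (-(1 * u)) * regDensity a ε u‖) ?_ ?_
    (h.integrableOn_regDensity one_pos).norm ?_
  · filter_upwards [eventually_gt_atTop 0] with s hs using (h.integrableOn_regDensity hs).1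
  · filter_upwards [eventually_ge_atTop 1] with s hs
    refine (ae_restrict_iff' measurableSet_Ioi).2 (Eventually.of_forall fun u hu => ?_)
    have hu' : (0 : ℝ) < u := hu
    rw [norm_mul, norm_mul, Real.norm_of_nonneg (Real.exp_pos _).le,
      Real.norm_of_nonneg (Real.exp_pos _).le]
    gcongr
  · refine (ae_restrict_iff' measurableSet_Ioi).2 (Eventually.of_forall fun u hu => ?_)
    have hu' : (0 : ℝ) < u := hu
    have : Tendsto (fun s : ℝ => Real.exp (-(s * u))) atTop (𝓝 0) :=
      Real.tendsto_exp_atBot.comp (tendsto_neg_atTop_atBot.comp (tendsto_id.atTop_mul_const hu'))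
    simpa using this.mul_const (regDensity a ε u)

lemma _root_.tendsto_logDeriv_add_csqrt :
    Tendsto (fun x : ℝ => (airyAi' x / airyAi x + csqrt x).re) atTop (𝓝 0) := by
  obtain ⟨R, hR, C, hC, hb⟩ := airy_logDeriv_bound
  have hlim : Tendsto (fun x : ℝ => C / x) atTop (𝓝 0) := tendsto_const_nhds.div_atTop tendsto_id
  refine squeeze_zero_norm' ?_ hlim
  filter_upwards [eventually_ge_atTop R] with x hx
  have hn : ‖(x : ℂ)‖ = x := by rw [Complex.norm_real, Real.norm_of_nonneg (by linarith)]
  have := (hb x (by rw [wideSector, mem_ofPred_eq, hn, Complex.ofReal_re]; linarith)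
    (by rw [hn]; exact hx)).2
  rw [hn] at this
  exact (Complex.abs_re_le_norm _).trans this

/-- The Laplace transform of the regularized jump density. -/
theorem laplace_regDensity (h : IsLeadingZero a ε) {s : ℝ} (hs : 0 < s) :
    ((∫ u in Ioi (0 : ℝ), Real.exp (-(s * u)) * regDensity a ε u : ℝ) : ℂ)
      = airyAi' s / airyAi s + csqrt s := by
  -- Only derivatives have been matched so far. The constant of integration is 0 because both sides
  -- tend to 0 as s → ∞.
  set D : ℝ → ℝ := fun s => (∫ u in Ioi (0 : ℝ), Real.exp (-(s * u)) * regDensity a ε u)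
    - (airyAi' s / airyAi s + csqrt s).re with hD
  have hd : ∀ s ∈ Ioi (0 : ℝ), HasDerivAt D 0 s := fun s hs =>
    ((h.hasDerivAt_laplace_regDensity hs).fun_sub
      (h.hasDerivAt_logDeriv_add_csqrt hs)).congr_deriv (sub_self _)
  have hconst : ∀ t ∈ Ioi (0 : ℝ), D t = D s := fun t ht =>
    isOpen_Ioi.is_const_of_deriv_eq_zero isPreconnected_Ioi
      (fun t ht => (hd t ht).differentiableAt.differentiableWithinAt)
      (fun t ht => (hd t ht).deriv) ht hs
  have hlim : Tendsto D atTop (𝓝 0) := by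
    have := h.tendsto_laplace_regDensity.sub tendsto_logDeriv_add_csqrt
    rwa [sub_zero] at this
  have hlim' : Tendsto D atTop (𝓝 (D s)) := by
    refine tendsto_const_nhds.congr' ?_
    filter_upwards [eventually_gt_atTop 0] with t ht using (hconst t ht).symm
  have h0 := tendsto_nhds_unique hlim' hlim
  have hreal : airyAi' s / airyAi s + csqrt s
      = (((airyAi' s / airyAi s + csqrt s).re : ℝ) : ℂ) := by
    rw [csqrt_ofReal hs.le, airyAi'_ofReal, airyAi_ofReal, ← Complex.ofReal_div,
      ← Complex.ofReal_add, Complex.ofReal_re]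
  rw [hreal]
  exact_mod_cast sub_eq_zero.1 h0

lemma isEquivalent_sizeBiased_atTop (h : IsLeadingZero a ε) :
    Tendsto (fun u => sizeBiased a ε u / (u * Real.exp (a * u))) atTop (𝓝 1) := by
  obtain ⟨C, hC, hb⟩ := h.abs_remainder_le
  have hε := h.pos
  have l1 : Tendsto (fun u : ℝ => remainder a ε u / (u * Real.exp (a * u))) atTop (𝓝 0) := by
    have hlim : Tendsto (fun u : ℝ => C * u⁻¹) atTop (𝓝 0) := by
      simpa using tendsto_inv_atTop_zero.const_mul C
    refine squeeze_zero_norm' ?_ hlim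
    filter_upwards [eventually_gt_atTop 0] with u hu
    rw [norm_div, Real.norm_eq_abs, Real.norm_of_nonneg (by positivity),
      div_le_iff₀ (by positivity)]
    refine (hb u).trans ?_
    rw [show C * u⁻¹ * (u * Real.exp (a * u)) = C * Real.exp (a * u) by field_simp]
    gcongr
    linarith
  have l2 : Tendsto (fun u : ℝ => Real.exp (-(shift a ε * u)) * (Real.sqrt (4 * Real.pi * u))⁻¹ /
      (u * Real.exp (a * u))) atTop (𝓝 0) := by
    refine squeeze_zero_norm' ?_ tendsto_inv_atTop_zero
    filter_upwards [eventually_ge_atTop 1] with u hu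
    have hu0 : 0 < u := by linarith
    rw [Real.norm_of_nonneg (by positivity), div_le_iff₀ (by positivity),
      inv_mul_cancel_left₀ hu0.ne']
    have e1 : Real.exp (-(shift a ε * u)) ≤ Real.exp (a * u) := by
      apply Real.exp_le_exp.2; rw [shift]; nlinarith
    have e2 : (Real.sqrt (4 * Real.pi * u))⁻¹ ≤ 1 := by
      refine inv_le_one_of_one_le₀ ?_
      rw [Real.one_le_sqrt]; nlinarith [Real.pi_gt_three]
    calc _ ≤ Real.exp (a * u) * 1 := by gcongr
      _ = _ := mul_one _
  have := (l1.add l2).add_const 1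
  simp only [add_zero, zero_add] at this
  refine this.congr' ?_
  filter_upwards [eventually_gt_atTop 0] with u hu
  rw [sizeBiased]
  have := Real.exp_pos (a * u)
  field_simp

/-- Multiplied by √(4πu), the expression extends continuously to u = 0, where only e^{-βu} survives.
-/
lemma isEquivalent_sizeBiased_zero (h : IsLeadingZero a ε) :
    Tendsto (fun u => sizeBiased a ε u * Real.sqrt (4 * Real.pi * u)) (𝓝[>] 0) (𝓝 1) := by
  have hc : Tendsto (fun u : ℝ => (remainder a ε u + u * Real.exp (a * u)) *
      Real.sqrt (4 * Real.pi * u) + Real.exp (-(shift a ε * u))) (𝓝 0) (𝓝 1) := by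
    have : Continuous (fun u : ℝ => (remainder a ε u + u * Real.exp (a * u)) *
      Real.sqrt (4 * Real.pi * u) + Real.exp (-(shift a ε * u))) := by
      have := h.continuous_remainder
      fun_prop
    simpa using this.tendsto 0
  refine (hc.mono_left nhdsWithin_le_nhds).congr' ?_
  filter_upwards [self_mem_nhdsWithin] with u hu
  have hu' : (0 : ℝ) < u := hu
  have : Real.sqrt (4 * Real.pi * u) ≠ 0 := (Real.sqrt_pos.2 (by positivity)).ne'
  rw [sizeBiased]
  field_simp
  ring

end IsLeadingZero

/-! ### The function with bilateral transform 1/Ai -/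

/-- Holomorphic on `Re z > α`, with decay of order `2` on closed vertical strips. -/
structure IsStripDecay (α : ℝ) (K : ℂ → ℂ) : Prop where
  diff : DifferentiableOn ℂ K {z | α < z.re}
  decay : ∀ c d : ℝ, α < c → ∃ C > 0, ∀ z : ℂ, c ≤ z.re → z.re ≤ d →
    ‖K z‖ ≤ C * (1 + |z.im|) ^ (-2 : ℝ)

namespace IsStripDecay

variable {α : ℝ} {K : ℂ → ℂ}

lemma of_decay_at_infinity (hK : DifferentiableOn ℂ K {z | α < z.re})
    (h : ∀ c d : ℝ, α < c → ∃ R > 0, ∃ C > 0, ∀ z : ℂ, c ≤ z.re → z.re ≤ d → R ≤ ‖z‖ →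
      ‖K z‖ ≤ C / ‖z‖ ^ 2) : IsStripDecay α K := by
  refine ⟨hK, fun c d hc => ?_⟩
  obtain ⟨R, hR, C, hC, hb⟩ := h c d hc
  have hcomp : IsCompact (Metric.closedBall (0 : ℂ) (R + 1) ∩ {z | c ≤ z.re}) :=
    (isCompact_closedBall _ _).inter_right (isClosed_le continuous_const Complex.continuous_re)
  obtain ⟨M, hM⟩ := hcomp.exists_bound_of_continuousOn
    (hK.continuousOn.mono fun z hz => lt_of_lt_of_le hc hz.2)
  refine ⟨|M| * (2 + R) ^ 2 + 4 * C, by positivity, fun z hz hz' => ?_⟩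
  have hi := Complex.abs_im_le_norm z
  have hi0 := abs_nonneg z.im
  rw [Real.rpow_neg (by positivity), ← div_eq_mul_inv, Real.rpow_two, le_div_iff₀ (by positivity)]
  rcases le_total ‖z‖ (R + 1) with hzR | hzR
  · have h1 : ‖K z‖ ≤ |M| :=
      (hM z ⟨mem_closedBall_zero_iff.2 hzR, hz⟩).trans (le_abs_self M)
    calc ‖K z‖ * (1 + |z.im|) ^ 2 ≤ |M| * (2 + R) ^ 2 := by gcongr ?_ * ?_ ^ 2; linarith
      _ ≤ _ := by linarith
  · have h1 := hb z hz hz' (by linarith)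
    rw [le_div_iff₀ (by nlinarith)] at h1
    calc ‖K z‖ * (1 + |z.im|) ^ 2 ≤ ‖K z‖ * (2 * ‖z‖) ^ 2 := by gcongr; linarith
      _ = 4 * (‖K z‖ * ‖z‖ ^ 2) := by ring
      _ ≤ 4 * C := by linarith
      _ ≤ _ := by
        have : 0 ≤ |M| * (2 + R) ^ 2 := by positivity
        linarith

lemma continuous_line (hK : IsStripDecay α K) {c : ℝ} (hc : α < c) :
    Continuous fun y : ℝ => K (c + y * Complex.I) :=
  _root_.continuous_line hK.diff.continuousOn fun y => by simpa using hc

lemma integrable_line (hK : IsStripDecay α K) {c : ℝ} (hc : α < c) :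
    Integrable fun y : ℝ => K (c + y * Complex.I) := by
  obtain ⟨C, hC, h⟩ := hK.decay c c hc
  refine Integrable.mono' ((integrable_one_add_abs (r := 2) (by norm_num)).const_mul C)
    (hK.continuous_line hc).aestronglyMeasurable (Eventually.of_forall fun y => ?_)
  have := h (c + y * Complex.I) (by simp) (by simp)
  rwa [line_im] at this

lemma invLaplace_line_le (hK : IsStripDecay α K) {c d : ℝ} (hc : α < c) (hcd : c ≤ d) (u : ℝ) :
    invLaplace K c u = invLaplace K d u := by
  rw [invLaplace_eq, invLaplace_eq]
  congr 1
  obtain ⟨C, hC, h⟩ := hK.decay c d hc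
  have hnorm : ∀ x y : ℝ, ‖Complex.exp ((x + y * Complex.I) * u)‖ = Real.exp (x * u) :=
    fun x y => by rw [Complex.norm_exp]; congr 1; simp
  have hint : ∀ x : ℝ, α < x → Integrable fun y : ℝ =>
      (fun z => Complex.exp (z * u) * K z) (x + y * Complex.I) := fun x hx => by
    refine ((hK.integrable_line hx).norm.const_mul (Real.exp (x * u))).mono' ?_
      (Eventually.of_forall fun y => by rw [norm_mul, hnorm])
    exact (Continuous.mul (by fun_prop) (hK.continuous_line hx)).aestronglyMeasurable
  refine integral_vertical_line_eq (f := fun z => Complex.exp (z * u) * K z) hcd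
    (b := fun T => Real.exp (max (c * u) (d * u)) * (C * (1 + |T|) ^ (-2 : ℝ)))
    ?_ (hint c hc) (hint d (by linarith)) ?_ ?_
  · refine DifferentiableOn.mul (by fun_prop) (hK.diff.mono fun z hz => ?_)
    exact lt_of_lt_of_le hc hz.1
  · have h1 : Tendsto (fun T : ℝ => (1 + |T|) ^ (-2 : ℝ)) atTop (𝓝 0) :=
      (tendsto_rpow_neg_atTop (by norm_num)).comp
        (tendsto_atTop_add_const_left _ _ tendsto_abs_atTop_atTop)
    simpa using (h1.const_mul C).const_mul (Real.exp (max (c * u) (d * u)))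
  · refine Eventually.of_forall fun T x hx => ?_
    have hxu : Real.exp (x * u) ≤ Real.exp (max (c * u) (d * u)) := by
      apply Real.exp_le_exp.2
      rcases le_total 0 u with hu | hu
      · exact (mul_le_mul_of_nonneg_right hx.2 hu).trans (le_max_right _ _)
      · exact (mul_le_mul_of_nonpos_right hx.1 hu).trans (le_max_left _ _)
    have hT : ∀ T : ℝ, ‖K (x + T * Complex.I)‖ ≤ C * (1 + |T|) ^ (-2 : ℝ) := fun T => by
      have := h (x + T * Complex.I) (by simpa using hx.1) (by simpa using hx.2)
      rwa [line_im] at this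
    constructor
    · rw [norm_mul, hnorm]
      have := hT T
      gcongr
    · rw [norm_mul, hnorm]
      have := hT (-T)
      rw [abs_neg] at this
      gcongr

lemma invLaplace_line_eq (hK : IsStripDecay α K) {c d : ℝ} (hc : α < c) (hd : α < d) (u : ℝ) :
    invLaplace K c u = invLaplace K d u := by
  rcases le_total c d with h | h
  · exact hK.invLaplace_line_le hc h u
  · exact (hK.invLaplace_line_le hd h u).symm

lemma continuous_invLaplace (hK : IsStripDecay α K) {c : ℝ} (hc : α < c) :
    Continuous (invLaplace K c) := by
  unfold invLaplace
  refine continuous_const.mul (Continuous.mul (by fun_prop) ?_)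
  refine continuous_of_dominated (bound := fun y => ‖K (c + y * Complex.I)‖) (fun u => ?_)
    (fun u => Eventually.of_forall fun y => ?_) (hK.integrable_line hc).norm
    (Eventually.of_forall fun y => by fun_prop)
  · exact (Continuous.mul (by fun_prop) (hK.continuous_line hc)).aestronglyMeasurable
  · rw [norm_mul, norm_exp_I_mul_mul, one_mul]

lemma exists_norm_invLaplace_le (hK : IsStripDecay α K) {c d : ℝ} (hc : α < c) (hd : α < d) :
    ∃ C > 0, ∀ u, ‖invLaplace K c u‖ ≤ C * Real.exp (d * u) := by
  refine ⟨(∫ y : ℝ, ‖K (d + y * Complex.I)‖) + 1, ?_, fun u => ?_⟩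
  · have : 0 ≤ ∫ y : ℝ, ‖K (d + y * Complex.I)‖ := integral_nonneg fun y => norm_nonneg _
    linarith
  · rw [hK.invLaplace_line_eq hc hd, mul_comm]
    refine (norm_invLaplace_le K d u).trans ?_
    gcongr
    linarith

end IsStripDecay

/-- The function with bilateral Laplace transform `1 / Ai`. -/
noncomputable def airyRecip (x : ℝ) : ℝ := (invLaplace (fun z => (airyAi z)⁻¹) 0 (-x)).re

lemma strip_bound_airyAi_inv (c d : ℝ) : ∃ R > 0, ∃ C > 0, ∀ z : ℂ, c ≤ z.re → z.re ≤ d →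
    R ≤ ‖z‖ → ‖(airyAi z)⁻¹‖ ≤ C / ‖z‖ ^ 2 := by
  obtain ⟨R, hR, C, hC, h⟩ := airy_inv_strip_bound (max |c| |d|)
  refine ⟨R, hR, C, hC, fun z h1 h2 h3 => (h z ?_ h3).2⟩
  exact abs_le_max_abs_abs h1 h2

namespace IsLeadingZero

variable {a ε : ℝ}

lemma airyAi_ne_zero (h : IsLeadingZero a ε) {z : ℂ} (hz : a < z.re) : airyAi z ≠ 0 := by
  intro h0
  have := h.unique z (by linarith [h.pos]) h0
  rw [this, Complex.ofReal_re] at hz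
  exact lt_irrefl _ hz

lemma isStripDecay_inv (h : IsLeadingZero a ε) : IsStripDecay a fun z => (airyAi z)⁻¹ := by
  refine IsStripDecay.of_decay_at_infinity (fun z hz => ?_) fun c d _ => strip_bound_airyAi_inv c d
  exact ((differentiable_airyAi z).inv (h.airyAi_ne_zero hz)).differentiableWithinAt

/-- The inversion integral is real: 1/Ai commutes with conjugation, and y ↦ -y exchanges the
integral with its conjugate. -/
lemma _root_.ofReal_airyRecip (x : ℝ) :
    (airyRecip x : ℂ) = invLaplace (fun z => (airyAi z)⁻¹) 0 (-x) := by
  rw [airyRecip, ← Complex.conj_eq_iff_re]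
  simp only [invLaplace, map_mul, ← integral_conj, map_inv₀, Complex.conj_ofReal, Complex.conj_ofNat,
    ← Complex.exp_conj, ← airyAi_conj, map_add, Complex.conj_I]
  congr 2
  rw [← integral_neg_eq_self]
  congr 1; ext y
  congr 2
  · push_cast; ring_nf
  · congr 1; push_cast; ring

lemma airyRecip_eq (h : IsLeadingZero a ε) {c : ℝ} (hc : a < c) (x : ℝ) :
    (airyRecip x : ℂ) = invLaplace (fun z => (airyAi z)⁻¹) c (-x) := by
  rw [ofReal_airyRecip, h.isStripDecay_inv.invLaplace_line_eq h.neg hc]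

lemma continuous_airyRecip (h : IsLeadingZero a ε) : Continuous airyRecip :=
  Complex.continuous_re.comp
    ((h.isStripDecay_inv.continuous_invLaplace h.neg).comp continuous_neg)

lemma abs_airyRecip_le (h : IsLeadingZero a ε) {c : ℝ} (hc : a < c) : ∃ C > 0, ∀ x, |airyRecip x| ≤ C * Real.exp (-c * x) := by
  obtain ⟨C, hC, hb⟩ := h.isStripDecay_inv.exists_norm_invLaplace_le h.neg hc
  refine ⟨C, hC, fun x => ?_⟩
  have := hb (-x)
  rw [← ofReal_airyRecip, Complex.norm_real, Real.norm_eq_abs] at this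
  simpa using this

/-- The line Re z = 1 gives decay at +∞; the line Re z = a/2 < 0, still to the right of the pole,
gives decay at -∞. -/
lemma integrable_airyRecip (h : IsLeadingZero a ε) : Integrable airyRecip := by
  obtain ⟨C, hC, hb⟩ := h.abs_airyRecip_le (c := 1) (by linarith [h.neg])
  obtain ⟨D, hD, hb'⟩ := h.abs_airyRecip_le (c := a / 2) (by linarith [h.neg])
  have hm := h.continuous_airyRecip.aestronglyMeasurable (μ := volume)
  rw [← integrableOn_univ, ← Iic_union_Ioi (a := (0 : ℝ))]
  refine IntegrableOn.union ?_ ?_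
  · refine Integrable.mono' ((integrableOn_exp_mul_Iic (a := -(a / 2)) (by linarith [h.neg]) 0).const_mul D) hm.restrict
      (Eventually.of_forall fun x => ?_)
    exact hb' x
  · refine Integrable.mono' ((exp_neg_integrableOn_Ioi 0 one_pos).const_mul C) hm.restrict
      (Eventually.of_forall fun x => ?_)
    exact hb x

/-- The Fourier transform of `airyRecip`. -/
lemma fourier_airyRecip (h : IsLeadingZero a ε) (u : ℝ) : ∫ x : ℝ, Complex.exp (Complex.I * u * x) * (airyRecip x : ℂ)
    = (airyAi (Complex.I * u))⁻¹ := by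
  have hK := h.isStripDecay_inv
  have hi : Integrable fun y : ℝ => (airyAi (Complex.I * y))⁻¹ := by
    have := hK.integrable_line h.neg
    simpa [mul_comm] using this
  have hh : ∀ y : ℝ, (∫ v : ℝ, Complex.exp (-Complex.I * y * v) * (airyAi (Complex.I * v))⁻¹)
      = 2 * Real.pi * (airyRecip y : ℂ) := fun y => by
    rw [ofReal_airyRecip, invLaplace, ← mul_assoc, mul_inv_cancel₀ (by simp), one_mul]
    simp [mul_comm]
  have hcont : Continuous fun y : ℝ => (airyAi (Complex.I * y))⁻¹ := by
    have := hK.continuous_line h.neg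
    simpa [mul_comm] using this
  have := fourier_inversion_angular hi (u := u) (by
    simp only [hh]; exact h.integrable_airyRecip.ofReal.const_mul _) hcont.continuousAt
  simp only [hh] at this
  rw [← mul_right_inj' (a := (2 * Real.pi : ℂ)) (by simp), ← this, ← integral_const_mul]
  congr 1; ext y; ring

end IsLeadingZero

/-! ### Behaviour at -∞: the residue at the leading zero -/

lemma norm_sub_ofReal_ge {z : ℂ} {b : ℝ} (hz : 2 * |b| ≤ ‖z‖) : ‖z‖ / 2 ≤ ‖z - b‖ := by
  have := norm_sub_norm_le z (b : ℂ)
  rw [Complex.norm_real, Real.norm_eq_abs] at this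
  linarith

/-- A single pole decays only like 1/|z| and is not integrable on vertical lines; the difference of
two poles is. Hence the auxiliary pole b. -/
lemma norm_inv_sub_sub_inv_sub_le {z : ℂ} {a b : ℝ} (ha : 2 * |a| ≤ ‖z‖) (hb : 2 * |b| ≤ ‖z‖)
    (hz : 0 < ‖z‖) : ‖1 / (z - a) - 1 / (z - b)‖ ≤ 4 * |a - b| / ‖z‖ ^ 2 := by
  have h1 := norm_sub_ofReal_ge ha
  have h2 := norm_sub_ofReal_ge hb
  have h1' : z - a ≠ 0 := norm_pos_iff.1 (by linarith)
  have h2' : z - b ≠ 0 := norm_pos_iff.1 (by linarith)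
  have e : 1 / (z - a) - 1 / (z - b) = ((a - b : ℝ) : ℂ) / ((z - a) * (z - b)) := by
    push_cast; field_simp; ring
  rw [e, norm_div, norm_mul, Complex.norm_real, Real.norm_eq_abs]
  calc |a - b| / (‖z - a‖ * ‖z - b‖) ≤ |a - b| / (‖z‖ / 2 * (‖z‖ / 2)) := by gcongr
    _ = _ := by field_simp; ring

/-- The inverse Laplace transform of `1 / (z - a) - 1 / (z - b)`. -/
lemma invLaplace_sub_inv {a b u : ℝ} (ha : a < 0) (hb : b < 0) (hu : 0 < u) :
    invLaplace (fun z => 1 / (z - a) - 1 / (z - b)) 0 u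
      = Complex.exp (a * u) - Complex.exp (b * u) := by
  set r : ℝ → ℂ := (Ioi (0 : ℝ)).indicator fun u => Complex.exp (a * u) - Complex.exp (b * u)
    with hr
  have hru : r u = Complex.exp (a * u) - Complex.exp (b * u) := indicator_of_mem hu _
  have he : ∀ (z : ℂ) (u : ℝ), Complex.exp (-(z * u)) * r u = (Ioi (0 : ℝ)).indicator
      (fun u : ℝ => Complex.exp ((a - z) * u) - Complex.exp ((b - z) * u)) u := fun z u => by
    by_cases hu : u ∈ Ioi (0 : ℝ)
    · rw [hr, indicator_of_mem hu, indicator_of_mem hu, mul_sub, ← Complex.exp_add,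
        ← Complex.exp_add]
      congr 2 <;> ring
    · rw [hr, indicator_of_notMem hu, indicator_of_notMem hu, mul_zero]
  have hint : ∀ (a : ℝ) (z : ℂ), a < z.re →
      IntegrableOn (fun u : ℝ => Complex.exp ((a - z) * u)) (Ioi 0) := fun a z hz =>
    integrableOn_exp_mul_complex_Ioi (by simpa using hz) 0
  rw [← hru]
  refine invLaplace_laplace ?_ ?_ (fun y => ?_) ?_
  · have : r =ᶠ[𝓝 u] fun u => Complex.exp (a * u) - Complex.exp (b * u) := by
      filter_upwards [Ioi_mem_nhds hu] with v hv
      rw [hr, indicator_of_mem hv]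
    exact ContinuousAt.congr (by fun_prop) this.symm
  · simp only [he]
    rw [integrable_indicator_iff measurableSet_Ioi]
    exact (hint a _ (by simpa using ha)).sub (hint b _ (by simpa using hb))
  · simp only [he]
    have h1 : a < (((0 : ℝ) : ℂ) + y * Complex.I).re := by simpa using ha
    have h2 : b < (((0 : ℝ) : ℂ) + y * Complex.I).re := by simpa using hb
    rw [integral_indicator measurableSet_Ioi, integral_sub (hint a _ h1) (hint b _ h2),
      integral_exp_mul_complex_Ioi (by rw [Complex.sub_re, Complex.ofReal_re]; linarith),
      integral_exp_mul_complex_Ioi (by rw [Complex.sub_re, Complex.ofReal_re]; linarith)]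
    simp only [Complex.ofReal_zero, mul_zero, Complex.exp_zero, neg_div, ← div_neg, neg_sub]
  · have hs : IsStripDecay (max a b) fun z => 1 / (z - a) - 1 / (z - b) := by
      refine IsStripDecay.of_decay_at_infinity (fun z hz => ?_) fun c d _ =>
        ⟨2 * |a| + 2 * |b| + 1, by positivity, 4 * |a - b| + 1, by positivity, fun z _ _ hz => ?_⟩
      · have h1 : z - a ≠ 0 := fun h0 => by
          have := (le_max_left a b).trans_lt hz
          rw [sub_eq_zero.1 h0, Complex.ofReal_re] at this
          exact lt_irrefl _ this
        have h2 : z - b ≠ 0 := fun h0 => by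
          have := (le_max_right a b).trans_lt hz
          rw [sub_eq_zero.1 h0, Complex.ofReal_re] at this
          exact lt_irrefl _ this
        exact DifferentiableAt.differentiableWithinAt (by fun_prop (disch := assumption))
      · refine (norm_inv_sub_sub_inv_sub_le (by linarith [abs_nonneg b])
          (by linarith [abs_nonneg a]) (by linarith [abs_nonneg a, abs_nonneg b])).trans ?_
        gcongr; linarith
    exact hs.integrable_line (max_lt ha hb)

namespace IsLeadingZero

variable {a ε : ℝ}

/-- The residue of `1 / Ai` at its leading pole. -/
noncomputable def _root_.airyRes (a : ℝ) : ℝ := (airyAi' a).re⁻¹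

lemma ofReal_airyRes (a : ℝ) : (airyRes a : ℂ) = (airyAi' a)⁻¹ := by
  rw [airyRes, Complex.ofReal_inv, ← airyAi'_ofReal]

lemma airyRes_ne_zero (h : IsLeadingZero a ε) : airyRes a ≠ 0 := by
  rw [← Complex.ofReal_ne_zero, ofReal_airyRes]
  exact inv_ne_zero (airyAi'_ne_zero h.zero)

/-- `1 / Ai` with its leading pole replaced by a pole further left. -/
noncomputable def recipRem (a b : ℝ) (z : ℂ) : ℂ :=
  dslope (fun z => (airyQuot a z)⁻¹) a z + airyRes a / (z - b)

lemma recipRem_eq (h : IsLeadingZero a ε) (b : ℝ) {z : ℂ} (hz : z ≠ a) :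
    (airyAi z)⁻¹ = airyRes a * (1 / (z - a) - 1 / (z - b)) + recipRem a b z := by
  rw [recipRem, dslope_of_ne _ hz, slope_def_field, airyQuot_self, ← ofReal_airyRes,
    h.airyAi_eq, mul_inv]
  ring

/-- With the singularity at a removed and b no further right than a - ε, the line of integration may
move to the left of a. -/
lemma isStripDecay_recipRem (h : IsLeadingZero a ε) {b : ℝ} (hb : b ≤ a - ε) :
    IsStripDecay (a - ε) (recipRem a b) := by
  have ho : IsOpen {z : ℂ | a - ε < z.re} := isOpen_lt continuous_const Complex.continuous_re
  refine IsStripDecay.of_decay_at_infinity ?_ fun c d _ => ?_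
  · refine DifferentiableOn.add ?_ fun z hz => ?_
    · refine (Complex.differentiableOn_dslope (ho.mem_nhds ?_)).2 fun z hz => ?_
      · have := h.pos
        simpa using this
      · exact ((differentiable_airyQuot a z).inv
          (h.airyQuot_ne_zero_of_re hz)).differentiableWithinAt
    · have h2 : z - b ≠ 0 := fun h0 => by
        have hz' : a - ε < z.re := hz
        rw [sub_eq_zero.1 h0, Complex.ofReal_re] at hz'
        linarith
      exact DifferentiableAt.differentiableWithinAt (by fun_prop (disch := assumption))
  · obtain ⟨R, hR, C, hC, hb'⟩ := strip_bound_airyAi_inv c d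
    refine ⟨R + 2 * |a| + 2 * |b| + 1, by positivity, C + |airyRes a| * (4 * |a - b|),
      by positivity, fun z h1 h2 h3 => ?_⟩
    have ha0 := abs_nonneg a
    have hb0 := abs_nonneg b
    have hz0 : 0 < ‖z‖ := by linarith
    have hza : z ≠ a := by
      rintro rfl
      rw [Complex.norm_real, Real.norm_eq_abs] at h3
      linarith
    have e : recipRem a b z = (airyAi z)⁻¹ - airyRes a * (1 / (z - a) - 1 / (z - b)) := by
      rw [h.recipRem_eq b hza]; ring
    have t1 := norm_inv_sub_sub_inv_sub_le (z := z) (a := a) (b := b) (by linarith) (by linarith) hz0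
    have t2 := hb' z h1 h2 (by linarith)
    rw [e]
    refine (norm_sub_le _ _).trans ?_
    rw [norm_mul, Complex.norm_real, Real.norm_eq_abs, add_div, mul_div_assoc]
    exact add_le_add t2 (mul_le_mul_of_nonneg_left t1 (abs_nonneg _))

lemma airyRecip_eq_add_recipRem (h : IsLeadingZero a ε) {b : ℝ} (hb : b ≤ a - ε) {x : ℝ} (hx : x < 0) :
    (airyRecip x : ℂ) = airyRes a * (Complex.exp (a * (-x : ℝ)) - Complex.exp (b * (-x : ℝ)))
      + invLaplace (recipRem a b) 0 (-x) := by
  have hp := h.pos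
  have hn := h.neg
  rw [← invLaplace_sub_inv hn (by linarith) (neg_pos.2 hx), ofReal_airyRecip]
  have hK := h.isStripDecay_recipRem hb
  have hi2 := hK.integrable_line (c := 0) (by linarith)
  have hi1 := h.isStripDecay_inv.integrable_line hn
  have hne : ∀ y : ℝ, ((0 : ℝ) : ℂ) + y * Complex.I ≠ a := fun y h0 => by
    have := congrArg Complex.re h0
    rw [line_re, Complex.ofReal_re] at this
    linarith
  have hexp : ∀ {f : ℝ → ℂ}, Integrable f → Integrable fun y : ℝ =>
      Complex.exp (Complex.I * (-x : ℝ) * y) * f y := fun {f} hf => by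
    refine hf.norm.mono' (Continuous.aestronglyMeasurable (by fun_prop) |>.mul
      hf.aestronglyMeasurable) (Eventually.of_forall fun y => ?_)
    rw [norm_mul, norm_exp_I_mul_mul, one_mul]
  have e : ∫ y : ℝ, Complex.exp (Complex.I * (-x : ℝ) * y) * (airyAi ((0 : ℝ) + y * Complex.I))⁻¹
      = airyRes a * (∫ y : ℝ, Complex.exp (Complex.I * (-x : ℝ) * y) *
          (1 / ((0 : ℝ) + y * Complex.I - a) - 1 / ((0 : ℝ) + y * Complex.I - b)))
        + ∫ y : ℝ, Complex.exp (Complex.I * (-x : ℝ) * y) * recipRem a b ((0 : ℝ) + y * Complex.I) := by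
    rw [← integral_const_mul, ← integral_add _ (hexp hi2)]
    · congr 1; ext y
      rw [h.recipRem_eq b (hne y)]; ring
    · have := (hexp hi1).sub (hexp hi2)
      refine this.congr (Eventually.of_forall fun y => ?_)
      simp only [Pi.sub_apply]
      rw [h.recipRem_eq b (hne y)]; ring
  simp only [invLaplace]
  rw [e]; ring

/-- Relative to e^{-ax}, the auxiliary pole at b = a - ε contributes e^{εx} and the line Re z = a -
ε/2 contributes e^{εx/2}. -/
lemma exists_abs_airyRecip_sub_le (h : IsLeadingZero a ε) : ∃ C > 0, ∀ x < 0,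
    |airyRecip x * Real.exp (a * x) - airyRes a| ≤ C * Real.exp (ε / 2 * x) := by
  have hp := h.pos
  obtain ⟨C, hC, hb⟩ := (h.isStripDecay_recipRem le_rfl).exists_norm_invLaplace_le (c := 0)
    (d := a - ε / 2) (by linarith [h.neg]) (by linarith)
  refine ⟨|airyRes a| + C, by positivity, fun x hx => ?_⟩
  have e := h.airyRecip_eq_add_recipRem le_rfl hx
  have e2 : ((airyRecip x * Real.exp (a * x) - airyRes a : ℝ) : ℂ)
      = -(airyRes a * Complex.exp ((ε * x : ℝ)))
        + invLaplace (recipRem a (a - ε)) 0 (-x) * Complex.exp ((a * x : ℝ)) := by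
    have h1 : Complex.exp (a * (-x : ℝ)) * Complex.exp ((a * x : ℝ)) = 1 := by
      rw [← Complex.exp_add, ← Complex.exp_zero]; congr 1; push_cast; ring
    have h2 : Complex.exp ((a - ε : ℝ) * (-x : ℝ)) * Complex.exp ((a * x : ℝ))
        = Complex.exp ((ε * x : ℝ)) := by
      rw [← Complex.exp_add]; congr 1; push_cast; ring
    rw [Complex.ofReal_sub, Complex.ofReal_mul, e, Complex.ofReal_exp]
    linear_combination (airyRes a : ℂ) * h1 - (airyRes a : ℂ) * h2
  rw [← Real.norm_eq_abs, ← Complex.norm_real, e2]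
  refine (norm_add_le _ _).trans ?_
  rw [norm_neg, norm_mul, norm_mul, Complex.norm_exp_ofReal, Complex.norm_exp_ofReal,
    Complex.norm_real, Real.norm_eq_abs, add_mul]
  refine add_le_add ?_ ?_
  · exact mul_le_mul_of_nonneg_left (Real.exp_le_exp.2 (by nlinarith)) (abs_nonneg _)
  · calc _ ≤ C * Real.exp ((a - ε / 2) * -x) * Real.exp (a * x) := by gcongr; exact hb _
      _ = _ := by rw [mul_assoc, ← Real.exp_add]; congr 2; ring

lemma tendsto_airyRecip_atBot (h : IsLeadingZero a ε) :
    Tendsto (fun x => airyRecip x * Real.exp (a * x)) atBot (𝓝 (airyRes a)) := by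
  obtain ⟨C, hC, hb⟩ := h.exists_abs_airyRecip_sub_le
  rw [tendsto_iff_norm_sub_tendsto_zero]
  refine squeeze_zero' (Eventually.of_forall fun x => norm_nonneg _)
    (by filter_upwards [eventually_lt_atBot 0] with x hx using hb x hx) ?_
  have h1 : Tendsto (fun x : ℝ => Real.exp (ε / 2 * x)) atBot (𝓝 0) :=
    Real.tendsto_exp_atBot.comp (tendsto_id.const_mul_atBot (by linarith [h.pos]))
  simpa using h1.const_mul C

/-- Majorants for the dominated convergence below: the constant serves for arguments below 0, the
exponential (line Re z = a + 1) for those above. -/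
lemma exists_abs_airyRecip_mul_exp_le (h : IsLeadingZero a ε) : ∃ C > 0, ∀ x,
    |airyRecip x| * Real.exp (a * x) ≤ C ∧ |airyRecip x| * Real.exp (a * x) ≤ C * Real.exp (-x) := by
  obtain ⟨C, hC, hb⟩ := h.exists_abs_airyRecip_sub_le
  obtain ⟨D, hD, hb'⟩ := h.abs_airyRecip_le (c := a + 1) (by linarith)
  refine ⟨|airyRes a| + C + D, by positivity, fun x => ?_⟩
  have h2 : |airyRecip x| * Real.exp (a * x) ≤ D * Real.exp (-x) := by
    calc _ ≤ D * Real.exp (-(a + 1) * x) * Real.exp (a * x) := by gcongr; exact hb' x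
      _ = _ := by rw [mul_assoc, ← Real.exp_add]; congr 2; ring
  refine ⟨?_, h2.trans (by gcongr; linarith [abs_nonneg (airyRes a)])⟩
  rcases lt_or_ge x 0 with hx | hx
  · have h3 := hb x hx
    have h4 : Real.exp (ε / 2 * x) ≤ 1 := Real.exp_le_one_iff.2 (by nlinarith [h.pos])
    have h5 := abs_sub_abs_le_abs_sub (airyRecip x * Real.exp (a * x)) (airyRes a)
    rw [abs_mul, Real.abs_exp] at h5
    nlinarith
  · have : Real.exp (-x) ≤ 1 := Real.exp_le_one_iff.2 (by linarith)
    nlinarith [abs_nonneg (airyRes a)]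

end IsLeadingZero

/-! ### Behaviour at +∞: the saddle point -/

lemma eq_of_sq_eq_of_re_pos {x y : ℂ} (h : x ^ 2 = y ^ 2) (hx : 0 < x.re) (hy : 0 < y.re) :
    x = y := by
  rcases sq_eq_sq_iff_eq_or_eq_neg.1 h with h | h
  · exact h
  · rw [h, Complex.neg_re] at hx
    linarith

lemma csqrt_sq_mul {X : ℝ} (hX : 0 < X) {z : ℂ} (hz : z ∈ Complex.slitPlane) :
    csqrt ((X : ℂ) ^ 2 * z) = X * csqrt z := by
  have h2 : (X : ℂ) ^ 2 * z ∈ Complex.slitPlane := by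
    rw [← Complex.ofReal_pow, Complex.mem_slitPlane_iff, Complex.re_ofReal_mul,
      Complex.im_ofReal_mul]
    rcases Complex.mem_slitPlane_iff.1 hz with h | h
    · left; positivity
    · right; positivity
  refine eq_of_sq_eq_of_re_pos ?_ (csqrt_re_pos h2) ?_
  · rw [csqrt_sq, mul_pow, csqrt_sq]
  · rw [Complex.re_ofReal_mul]
    exact mul_pos hX (csqrt_re_pos hz)

/-- The point `1 + iθ`. -/
noncomputable def onePlus (θ : ℝ) : ℂ := 1 + θ * Complex.I

lemma onePlus_re (θ : ℝ) : (onePlus θ).re = 1 := by simp [onePlus]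
lemma onePlus_im (θ : ℝ) : (onePlus θ).im = θ := by simp [onePlus]

lemma onePlus_mem_slitPlane (θ : ℝ) : onePlus θ ∈ Complex.slitPlane := by
  rw [Complex.mem_slitPlane_iff, onePlus_re]; left; norm_num

lemma norm_onePlus_le (θ : ℝ) : ‖onePlus θ‖ ≤ 1 + |θ| := by
  refine (norm_add_le _ _).trans ?_
  simp

lemma one_le_norm_onePlus (θ : ℝ) : 1 ≤ ‖onePlus θ‖ := by
  have := Complex.re_le_norm (onePlus θ)
  rwa [onePlus_re] at this

/-- With p = Re √(1+iθ) ≥ 1, θ² = 4p²(p² - 1) and the left side is a cubic in p with a double zero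
at p = 1 when p² - 1 is added. The bound is quadratic near the saddle and linear far away. -/
lemma csqrt_onePlus_cube_re_le (θ : ℝ) :
    (2 / 3 * csqrt (onePlus θ) ^ 3 - onePlus θ + 1 / 3).re ≤ -(θ ^ 2 / (4 + 2 * |θ|)) := by
  set p := (csqrt (onePlus θ)).re with hp
  have hp2 := two_mul_csqrt_re_sq (onePlus θ)
  have hp0 := csqrt_re_nonneg (onePlus θ)
  have hn := norm_onePlus_le θ
  have hn1 := one_le_norm_onePlus θ
  rw [onePlus_re, ← hp] at hp2
  rw [← hp] at hp0
  have hp1 : 1 ≤ p := by nlinarith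
  have hns : ‖onePlus θ‖ ^ 2 = 1 + θ ^ 2 := by
    rw [Complex.sq_norm, Complex.normSq_apply, onePlus_re, onePlus_im]; ring
  have hθ : θ ^ 2 = 4 * p ^ 2 * (p ^ 2 - 1) := by
    have : ‖onePlus θ‖ = 2 * p ^ 2 - 1 := by linarith
    rw [this] at hns
    linarith
  have hre : (2 / 3 * csqrt (onePlus θ) ^ 3 - onePlus θ + 1 / 3).re
      = 2 * p - 4 / 3 * p ^ 3 - 2 / 3 := by
    have h1 := re_csqrt_cube (onePlus θ)
    rw [onePlus_re, ← hp] at h1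
    have e : (2 / 3 * csqrt (onePlus θ) ^ 3 - onePlus θ + 1 / 3)
        = ((2 / 3 : ℝ) : ℂ) * csqrt (onePlus θ) ^ 3 - onePlus θ + ((1 / 3 : ℝ) : ℂ) := by
      push_cast; ring
    rw [e, Complex.add_re, Complex.sub_re, Complex.re_ofReal_mul, h1, onePlus_re,
      Complex.ofReal_re]
    ring
  rw [hre, le_neg, div_le_iff₀ (by positivity), hθ]
  have h4 : 4 * p ^ 2 ≤ 4 + 2 * |θ| := by linarith
  have h5 : p ^ 2 - 1 ≤ -(2 * p - 4 / 3 * p ^ 3 - 2 / 3) := by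
    nlinarith [mul_nonneg (sub_nonneg.2 hp1) (sub_nonneg.2 hp1)]
  have h6 : 0 ≤ p ^ 2 - 1 := by nlinarith
  calc 4 * p ^ 2 * (p ^ 2 - 1) ≤ (4 + 2 * |θ|) * -(2 * p - 4 / 3 * p ^ 3 - 2 / 3) := by gcongr
    _ = _ := by ring

/-- With w = √(1+iθ) the exponent is (w-1)²(2w+1)/3 and θ² = -(w²-1)². Factoring out θ² leaves a
quotient with value 1/4 at w = 1, the coefficient of the limiting Gaussian. -/
lemma csqrt_onePlus_exponent (θ : ℝ) :
    2 / 3 * csqrt (onePlus θ) ^ 3 - onePlus θ + 1 / 3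
      = -(θ : ℂ) ^ 2 * ((2 * csqrt (onePlus θ) + 1) / (3 * (csqrt (onePlus θ) + 1) ^ 2)) := by
  have hw := csqrt_sq (onePlus θ)
  set w := csqrt (onePlus θ) with hwd
  have hne : w + 1 ≠ 0 := fun h0 => by
    have := congrArg Complex.re h0
    have h1 := csqrt_re_nonneg (onePlus θ)
    rw [← hwd] at h1
    simp only [Complex.add_re, Complex.one_re, Complex.zero_re] at this
    linarith
  have hθ : (θ : ℂ) ^ 2 = -(w ^ 2 - 1) ^ 2 := by
    rw [hw, onePlus]
    linear_combination ((θ : ℂ) ^ 2) * Complex.I_sq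
  rw [hθ, ← hw]
  field_simp
  ring

/-- The integrand of `airyRecip X * exp (X ^ 3 / 3) / X` in the scaled variable. -/
noncomputable def recipScaled (X τ : ℝ) : ℂ :=
  (2 * Real.pi * Real.sqrt X : ℂ)⁻¹ * (Complex.exp (X ^ 3 / 3) *
    (Complex.exp (-(X * ((X : ℂ) ^ 2 + Real.sqrt X * τ * Complex.I))) *
      (airyAi ((X : ℂ) ^ 2 + Real.sqrt X * τ * Complex.I))⁻¹))

lemma IsLeadingZero.airyRecip_eq_integral_recipScaled {a ε : ℝ} (h : IsLeadingZero a ε) {X : ℝ}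
    (hX : 0 < X) :
    ((airyRecip X * Real.exp (X ^ 3 / 3) / X : ℝ) : ℂ) = ∫ τ : ℝ, recipScaled X τ := by
  have hs : 0 < Real.sqrt X := Real.sqrt_pos.2 hX
  -- The line Re z = X² passes through the saddle of 2z^{3/2}/3 - zX; the ordinate is then rescaled
  -- by √X.
  have e1 := h.airyRecip_eq (c := X ^ 2) (by nlinarith [h.neg]) X
  rw [invLaplace_eq] at e1
  have e2 := Measure.integral_comp_mul_left (fun y : ℝ =>
    (fun z => Complex.exp (z * (-X : ℝ)) * (airyAi z)⁻¹) ((X ^ 2 : ℝ) + y * Complex.I)) (Real.sqrt X)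
  rw [abs_of_pos (inv_pos.2 hs), Complex.real_smul, eq_comm, Complex.ofReal_inv,
    inv_mul_eq_iff_eq_mul₀ (by exact_mod_cast hs.ne')] at e2
  rw [e2] at e1
  simp only [recipScaled]
  rw [integral_const_mul, integral_const_mul]
  have e3 : ∫ τ : ℝ, Complex.exp (-(X * ((X : ℂ) ^ 2 + Real.sqrt X * τ * Complex.I))) *
      (airyAi ((X : ℂ) ^ 2 + Real.sqrt X * τ * Complex.I))⁻¹
      = ∫ τ : ℝ, (fun z => Complex.exp (z * (-X : ℝ)) * (airyAi z)⁻¹)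
        ((X ^ 2 : ℝ) + (Real.sqrt X * τ : ℝ) * Complex.I) := by
    congr 1; ext τ
    push_cast
    congr 2; ring
  rw [e3, Complex.ofReal_div, Complex.ofReal_mul, e1]
  have hss : (X : ℂ) = (Real.sqrt X : ℂ) * Real.sqrt X := by
    rw [← Complex.ofReal_mul, Real.mul_self_sqrt hX.le]
  have hsc : (Real.sqrt X : ℂ) ≠ 0 := by exact_mod_cast hs.ne'
  have hpi : (Real.pi : ℂ) ≠ 0 := by exact_mod_cast Real.pi_ne_zero
  generalize (∫ τ : ℝ, (fun z => Complex.exp (z * (-X : ℝ)) * (airyAi z)⁻¹)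
        ((X ^ 2 : ℝ) + (Real.sqrt X * τ : ℝ) * Complex.I)) = J
  have hE : ((Real.exp (X ^ 3 / 3) : ℝ) : ℂ) = Complex.exp ((X : ℂ) ^ 3 / 3) := by push_cast; rfl
  rw [hE, div_eq_iff (by exact_mod_cast hX.ne')]
  generalize Complex.exp ((X : ℂ) ^ 3 / 3) = E
  rw [hss]
  field_simp

/-- The scaled angle. -/
noncomputable def scaledAngle (X τ : ℝ) : ℝ := τ / (X * Real.sqrt X)

lemma abs_scaledAngle_le {X : ℝ} (hX : 1 ≤ X) (τ : ℝ) : |scaledAngle X τ| ≤ |τ| := by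
  rw [scaledAngle, abs_div]
  refine div_le_self (abs_nonneg _) ?_
  rw [abs_of_nonneg (by positivity)]
  exact one_le_mul_of_one_le_of_one_le hX (Real.one_le_sqrt.2 hX)

/-- The scale √X is chosen for this identity: the exponent X³θ² turns into τ². -/
lemma cube_mul_scaledAngle_sq {X : ℝ} (hX : 0 < X) (τ : ℝ) :
    X ^ 3 * scaledAngle X τ ^ 2 = τ ^ 2 := by
  rw [scaledAngle, div_pow, mul_pow, Real.sq_sqrt hX.le]
  field_simp

lemma recipScaled_eq {X : ℝ} (hX : 0 < X) (τ : ℝ) : recipScaled X τ =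
    Complex.exp ((X : ℂ) ^ 3 * (2 / 3 * csqrt (onePlus (scaledAngle X τ)) ^ 3
      - onePlus (scaledAngle X τ) + 1 / 3)) *
      (Real.sqrt X * airyGauss (X * csqrt (onePlus (scaledAngle X τ))))⁻¹ := by
  set θ := scaledAngle X τ with hθ
  have hs : 0 < Real.sqrt X := Real.sqrt_pos.2 hX
  have hsc : (Real.sqrt X : ℂ) ≠ 0 := by exact_mod_cast hs.ne'
  have hXc : (X : ℂ) ≠ 0 := by exact_mod_cast hX.ne'
  have hpi : (Real.pi : ℂ) ≠ 0 := by exact_mod_cast Real.pi_ne_zero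
  have hz : (X : ℂ) ^ 2 + Real.sqrt X * τ * Complex.I = (X : ℂ) ^ 2 * onePlus θ := by
    have h1 : Real.sqrt X * τ = X ^ 2 * θ := by
      rw [hθ, scaledAngle]
      have : X = Real.sqrt X * Real.sqrt X := (Real.mul_self_sqrt hX.le).symm
      field_simp
      rw [sq, Real.mul_self_sqrt hX.le, mul_comm]
    have h2 : (Real.sqrt X : ℂ) * τ = (X : ℂ) ^ 2 * θ := by exact_mod_cast h1
    rw [h2, onePlus]; ring
  have hsl : (X : ℂ) ^ 2 * onePlus θ ∈ Complex.slitPlane := by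
    rw [← Complex.ofReal_pow, Complex.mem_slitPlane_iff, Complex.re_ofReal_mul, onePlus_re]
    left; positivity
  rw [recipScaled, hz, airyAi_eq_airyGauss hsl, csqrt_sq_mul hX (onePlus_mem_slitPlane θ)]
  set w := csqrt (onePlus θ)
  simp only [mul_inv, inv_inv, ← Complex.exp_neg]
  have hE : Complex.exp ((X : ℂ) ^ 3 * (2 / 3 * w ^ 3 - onePlus θ + 1 / 3))
      = Complex.exp ((X : ℂ) ^ 3 / 3) * Complex.exp (-(X * ((X : ℂ) ^ 2 * onePlus θ)))
        * Complex.exp (-(-2 * (X * w) ^ 3 / 3)) := by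
    rw [← Complex.exp_add, ← Complex.exp_add]; congr 1; ring
  rw [hE]
  field_simp

lemma tendsto_scaledAngle (τ : ℝ) : Tendsto (fun X => scaledAngle X τ) atTop (𝓝 0) :=
  tendsto_const_nhds.div_atTop (tendsto_id.atTop_mul_atTop₀ Real.tendsto_sqrt_atTop)

lemma csqrt_onePlus_half_le (θ : ℝ) : ‖csqrt (onePlus θ)‖ / 2 ≤ (csqrt (onePlus θ)).re := by
  refine csqrt_wideSector ?_
  rw [wideSector, mem_ofPred_eq, onePlus_re]
  linarith [norm_nonneg (onePlus θ)]

lemma one_le_norm_csqrt_onePlus (θ : ℝ) : 1 ≤ ‖csqrt (onePlus θ)‖ := by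
  rw [norm_csqrt]
  exact Real.one_le_sqrt.2 (one_le_norm_onePlus θ)

lemma exists_norm_recipScaled_le : ∃ R ≥ 1, ∃ C > 0, ∀ X ≥ R, ∀ τ,
    ‖recipScaled X τ‖ ≤ C * (1 + |τ|) ^ (-2 : ℝ) := by
  obtain ⟨R, hR, _, _, hb⟩ := airyGauss_sector_bounds
  -- One power of 1 + |τ| bounds the reciprocal Gaussian factor and two are the decay wanted. Below,
  -- 1 - |τ|/2 = 3/2 - (1 + |τ|)/2 explains e^{3/2} and the rate 1/2.
  obtain ⟨C, hC, hC'⟩ := exists_pow_mul_exp_neg_le 3 (b := 1 / 2) (by norm_num)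
  refine ⟨R, hR.le, Real.exp (3 / 2) * C, by positivity, fun X hX τ => ?_⟩
  have hX1 : 1 ≤ X := by linarith
  have hX0 : 0 < X := by linarith
  have hs : 0 < Real.sqrt X := Real.sqrt_pos.2 hX0
  rw [recipScaled_eq hX0]
  set θ := scaledAngle X τ with hθ
  set w := csqrt (onePlus θ) with hw
  have hw1 : 1 ≤ ‖w‖ := one_le_norm_csqrt_onePlus θ
  have hθτ : |θ| ≤ |τ| := abs_scaledAngle_le hX1 τ
  have hnXw : ‖(X : ℂ) * w‖ = X * ‖w‖ := by
    rw [norm_mul, Complex.norm_real, Real.norm_of_nonneg hX0.le]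
  have hG := (hb (X * w) (by
    rw [hnXw, Complex.re_ofReal_mul]
    have := mul_le_mul_of_nonneg_left (csqrt_onePlus_half_le θ) hX0.le
    linarith) (by rw [hnXw]; nlinarith)).1
  rw [hnXw, Real.sqrt_mul hX0.le] at hG
  have hsw : 0 < Real.sqrt ‖w‖ := Real.sqrt_pos.2 (by linarith)
  have hw2 : Real.sqrt ‖w‖ ≤ 1 + |τ| := by
    have h1 : ‖w‖ ≤ 1 + |τ| := by
      rw [hw, norm_csqrt, Real.sqrt_le_left (by positivity)]
      nlinarith [norm_onePlus_le θ, abs_nonneg τ]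
    rw [Real.sqrt_le_left (by positivity)]
    nlinarith [abs_nonneg τ]
  have hGinv : ‖((Real.sqrt X : ℂ) * airyGauss (X * w))⁻¹‖ ≤ 1 + |τ| := by
    rw [norm_inv, norm_mul, Complex.norm_real, Real.norm_of_nonneg hs.le]
    refine le_trans ?_ hw2
    rw [inv_le_comm₀ (mul_pos hs (lt_of_lt_of_le (by positivity) hG)) hsw]
    calc (Real.sqrt ‖w‖)⁻¹ = Real.sqrt X * (1 / (Real.sqrt X * Real.sqrt ‖w‖)) := by field_simp
      _ ≤ _ := by gcongr
  have hexp : ‖Complex.exp ((X : ℂ) ^ 3 * (2 / 3 * w ^ 3 - onePlus θ + 1 / 3))‖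
      ≤ Real.exp (3 / 2) * Real.exp (-(1 / 2) * (1 + |τ|)) := by
    rw [Complex.norm_exp, ← Complex.ofReal_pow, Complex.re_ofReal_mul, ← Real.exp_add]
    apply Real.exp_le_exp.2
    have h1 := mul_le_mul_of_nonneg_left (csqrt_onePlus_cube_re_le θ) (pow_pos hX0 3).le
    refine h1.trans ?_
    have h2 : X ^ 3 * -(θ ^ 2 / (4 + 2 * |θ|)) = -(τ ^ 2 / (4 + 2 * |θ|)) := by
      rw [← cube_mul_scaledAngle_sq hX0 τ]; ring
    rw [h2]
    have h3 : τ ^ 2 / (4 + 2 * |τ|) ≤ τ ^ 2 / (4 + 2 * |θ|) := by gcongr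
    have h4 : |τ| / 2 - 1 ≤ τ ^ 2 / (4 + 2 * |τ|) := by
      rw [le_div_iff₀ (by positivity)]
      nlinarith [sq_abs τ]
    linarith
  rw [norm_mul]
  have hfin := hC' (1 + |τ|) (by positivity)
  rw [Real.rpow_neg (by positivity), Real.rpow_two]
  calc _ ≤ Real.exp (3 / 2) * Real.exp (-(1 / 2) * (1 + |τ|)) * (1 + |τ|) := by gcongr
    _ = Real.exp (3 / 2) * ((1 + |τ|) ^ 3 * Real.exp (-(1 / 2) * (1 + |τ|))) * ((1 + |τ|) ^ 2)⁻¹ := by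
        field_simp
    _ ≤ _ := by gcongr

lemma continuousAt_csqrt {z : ℂ} (hz : z ∈ Complex.slitPlane) : ContinuousAt csqrt z :=
  (hasDerivAt_csqrt hz).continuousAt

lemma tendsto_csqrt_onePlus_scaledAngle (τ : ℝ) :
    Tendsto (fun X => csqrt (onePlus (scaledAngle X τ))) atTop (𝓝 1) := by
  have h0 : csqrt (onePlus 0) = 1 := by simp [onePlus, csqrt]
  rw [← h0]
  refine (continuousAt_csqrt (onePlus_mem_slitPlane 0)).tendsto.comp ?_
  have : Continuous onePlus := by unfold onePlus; fun_prop
  exact (this.tendsto 0).comp (tendsto_scaledAngle τ)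

lemma tendsto_sqrt_mul_airyGauss (τ : ℝ) : Tendsto (fun X : ℝ => (Real.sqrt X : ℂ) *
    airyGauss (X * csqrt (onePlus (scaledAngle X τ)))) atTop (𝓝 (Real.sqrt Real.pi)) := by
  obtain ⟨R, hR, C, hC, hb⟩ := airyGauss_sector_bounds
  set w : ℝ → ℂ := fun X => csqrt (onePlus (scaledAngle X τ)) with hw
  have hwt : Tendsto w atTop (𝓝 1) := tendsto_csqrt_onePlus_scaledAngle τ
  have hpis : (Real.pi / 1 : ℂ) ∈ Complex.slitPlane := by
    rw [div_one, Complex.ofReal_mem_slitPlane]; exact Real.pi_pos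
  have hlim : Tendsto (fun X => csqrt (Real.pi / w X)) atTop (𝓝 (Real.sqrt Real.pi)) := by
    rw [← csqrt_ofReal Real.pi_pos.le]
    have := (continuousAt_csqrt hpis).tendsto.comp (tendsto_const_nhds.div hwt one_ne_zero)
    rwa [div_one] at this
  have hdiff : Tendsto (fun X : ℝ => (Real.sqrt X : ℂ) * airyGauss (X * w X)
      - csqrt (Real.pi / w X)) atTop (𝓝 0) := by
    have hC0 : Tendsto (fun X : ℝ => C / X) atTop (𝓝 0) := tendsto_const_nhds.div_atTop tendsto_id
    refine squeeze_zero_norm' ?_ hC0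
    filter_upwards [eventually_ge_atTop R] with X hX
    have hX1 : 1 ≤ X := by linarith
    have hX0 : 0 < X := by linarith
    have hs : 0 < Real.sqrt X := Real.sqrt_pos.2 hX0
    have hw1 : 1 ≤ ‖w X‖ := one_le_norm_csqrt_onePlus _
    have hwre : 0 < (w X).re := csqrt_re_pos (onePlus_mem_slitPlane _)
    have hnXw : ‖(X : ℂ) * w X‖ = X * ‖w X‖ := by
      rw [norm_mul, Complex.norm_real, Real.norm_of_nonneg hX0.le]
    have hG := (hb (X * w X) (by
      rw [hnXw, Complex.re_ofReal_mul]
      have := mul_le_mul_of_nonneg_left (csqrt_onePlus_half_le (scaledAngle X τ)) hX0.le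
      linarith) (by rw [hnXw]; nlinarith)).2.2.2
    have hsl : (Real.pi / w X : ℂ) ∈ Complex.slitPlane := by
      rw [Complex.mem_slitPlane_iff]
      left
      rw [Complex.div_re, Complex.ofReal_re, Complex.ofReal_im, zero_mul, zero_div, add_zero]
      have := Real.pi_pos
      have : 0 < Complex.normSq (w X) := Complex.normSq_pos.2 (norm_pos_iff.1 (by linarith))
      positivity
    have e : csqrt (Real.pi / w X) = Real.sqrt X * (Real.pi / (X * w X) : ℂ) ^ (1 / 2 : ℂ) := by
      have hinv : 0 < (Real.sqrt X)⁻¹ := inv_pos.2 hs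
      have h1 := csqrt_sq_mul hinv hsl
      have h2 : (((Real.sqrt X)⁻¹ : ℝ) : ℂ) ^ 2 * (Real.pi / w X) = Real.pi / (X * w X) := by
        rw [← Complex.ofReal_pow, inv_pow, Real.sq_sqrt hX0.le, Complex.ofReal_inv]
        rw [div_mul_eq_div_div_swap, div_eq_mul_inv _ (X : ℂ), mul_comm]
      rw [h2] at h1
      rw [show ∀ z : ℂ, z ^ (1 / 2 : ℂ) = csqrt z from fun z => rfl, h1, ← mul_assoc,
        ← Complex.ofReal_mul, mul_inv_cancel₀ hs.ne', Complex.ofReal_one, one_mul]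
    rw [e, ← mul_sub, norm_mul, Complex.norm_real, Real.norm_of_nonneg hs.le]
    calc Real.sqrt X * _ ≤ X * (C / ‖(X : ℂ) * w X‖ ^ 2) := by
          gcongr
          rw [Real.sqrt_le_left hX0.le]; nlinarith
      _ ≤ X * (C / X ^ 2) := by
          gcongr
          rw [hnXw]; nlinarith
      _ = C / X := by field_simp
  simpa using hdiff.add hlim

lemma tendsto_recipScaled (τ : ℝ) : Tendsto (fun X => recipScaled X τ) atTop
    (𝓝 (((Real.sqrt Real.pi)⁻¹ * Real.exp (-(1 / 4) * τ ^ 2) : ℝ) : ℂ)) := by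
  have hw := tendsto_csqrt_onePlus_scaledAngle τ
  have hG := (tendsto_sqrt_mul_airyGauss τ).inv₀
    (by exact_mod_cast (Real.sqrt_pos.2 Real.pi_pos).ne')
  have hE : Tendsto (fun X : ℝ => Complex.exp (-(τ : ℂ) ^ 2 *
      ((2 * csqrt (onePlus (scaledAngle X τ)) + 1) /
        (3 * (csqrt (onePlus (scaledAngle X τ)) + 1) ^ 2)))) atTop
      (𝓝 (Complex.exp (-(τ : ℂ) ^ 2 * ((2 * 1 + 1) / (3 * (1 + 1) ^ 2))))) := by
    refine (Complex.continuous_exp.tendsto _).comp (Tendsto.const_mul _ ?_)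
    refine Tendsto.div ((hw.const_mul 2).add_const 1) (((hw.add_const 1).pow 2).const_mul 3) ?_
    norm_num
  have := hE.mul hG
  have e : Complex.exp (-(τ : ℂ) ^ 2 * ((2 * 1 + 1) / (3 * (1 + 1) ^ 2))) *
      (Real.sqrt Real.pi : ℂ)⁻¹
      = (((Real.sqrt Real.pi)⁻¹ * Real.exp (-(1 / 4) * τ ^ 2) : ℝ) : ℂ) := by
    push_cast
    rw [mul_comm]
    congr 2; ring
  rw [e] at this
  refine this.congr' ?_
  filter_upwards [eventually_gt_atTop 0] with X hX
  rw [recipScaled_eq hX, csqrt_onePlus_exponent]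
  congr 2
  have := cube_mul_scaledAngle_sq hX τ
  have h2 : (X : ℂ) ^ 3 * (scaledAngle X τ : ℂ) ^ 2 = (τ : ℂ) ^ 2 := by exact_mod_cast this
  rw [← h2]; ring

lemma IsLeadingZero.tendsto_airyRecip_atTop {a ε : ℝ} (h : IsLeadingZero a ε) :
    Tendsto (fun X => airyRecip X * Real.exp (X ^ 3 / 3) / X) atTop (𝓝 2) := by
  obtain ⟨R, hR, C, hC, hb⟩ := exists_norm_recipScaled_le
  have hlim := tendsto_integral_filter_of_dominated_convergence (l := atTop) (μ := volume)
    (F := fun X τ => recipScaled X τ)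
    (f := fun τ => (((Real.sqrt Real.pi)⁻¹ * Real.exp (-(1 / 4) * τ ^ 2) : ℝ) : ℂ))
    (fun τ => C * (1 + |τ|) ^ (-2 : ℝ)) ?_ ?_
    ((integrable_one_add_abs (r := 2) (by norm_num)).const_mul C)
    (Eventually.of_forall fun τ => tendsto_recipScaled τ)
  · rw [integral_complex_ofReal, integral_const_mul, integral_gaussian] at hlim
    -- The mass of the limiting integrand: √(4π)/√π = 2.
    have hval : (Real.sqrt Real.pi)⁻¹ * Real.sqrt (Real.pi / (1 / 4)) = 2 := by
      rw [show Real.pi / (1 / 4) = 2 ^ 2 * Real.pi by ring, Real.sqrt_mul (by norm_num),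
        Real.sqrt_sq (by norm_num)]
      have := (Real.sqrt_pos.2 Real.pi_pos).ne'
      field_simp
    rw [hval] at hlim
    have hre := (Complex.continuous_re.tendsto _).comp hlim
    rw [Complex.ofReal_re] at hre
    refine hre.congr' ?_
    filter_upwards [eventually_gt_atTop 0] with X hX
    rw [Function.comp_apply, ← h.airyRecip_eq_integral_recipScaled hX, Complex.ofReal_re]
  · filter_upwards [eventually_gt_atTop 0] with X hX
    refine Continuous.aestronglyMeasurable ?_
    have hc : Continuous fun τ : ℝ => (airyAi ((X : ℂ) ^ 2 + Real.sqrt X * τ * Complex.I))⁻¹ := by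
      refine Continuous.inv₀ (differentiable_airyAi.continuous.comp (by fun_prop)) fun τ => ?_
      refine h.airyAi_ne_zero ?_
      rw [← Complex.ofReal_pow, ← Complex.ofReal_mul, line_re]
      nlinarith [h.neg]
    unfold recipScaled
    fun_prop
  · filter_upwards [eventually_ge_atTop R] with X hX
    exact Eventually.of_forall fun τ => hb X hX τ

/-! ### The integrated intensity in normalized variables -/

lemma integrableOn_inv_sqrt_add_mul_exp {s : ℝ} (hs : 0 < s) :
    IntegrableOn (fun v : ℝ => ((Real.sqrt v)⁻¹ + v) * Real.exp (-(s * v))) (Ioi 0) := by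
  have hi := (integrableOn_exp_mul_rpow (σ := -(1 / 2)) hs (by norm_num)).add
    (integrableOn_exp_mul_rpow (σ := 1) hs (by norm_num))
  refine IntegrableOn.congr_fun hi (fun v hv => ?_) measurableSet_Ioi
  have hv' : (0 : ℝ) < v := hv
  simp only [Pi.add_apply]
  rw [Real.rpow_one, Real.rpow_neg hv'.le, ← Real.sqrt_eq_rpow]
  ring

namespace IsLeadingZero

variable {a ε : ℝ}

/-- The integrated jump intensity in normalized variables. -/
noncomputable def normIntensity (a ε x : ℝ) : ℝ :=
  ∫ t in Ioi (0 : ℝ), airyRecip (x + t) * sizeBiased a ε t / airyRecip x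

/-- Applied with b = |x| as x → -∞ and with b = x^{-2} as x → +∞, the sizes of the jumps that
matter. -/
lemma normIntensity_eq_scaled (a ε x : ℝ) {b : ℝ} (hb : 0 < b) : normIntensity a ε x =
    b * ∫ v in Ioi (0 : ℝ), airyRecip (x + b * v) * sizeBiased a ε (b * v) / airyRecip x := by
  have := integral_comp_mul_left_Ioi
    (fun t => airyRecip (x + t) * sizeBiased a ε t / airyRecip x) 0 hb
  rw [this, mul_zero, smul_eq_mul, ← mul_assoc, mul_inv_cancel₀ hb.ne', one_mul, normIntensity]

lemma continuousOn_scaled (h : IsLeadingZero a ε) (x c : ℝ) {b : ℝ} (hb : 0 < b) :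
    ContinuousOn (fun v => airyRecip (x + b * v) * sizeBiased a ε (b * v) / airyRecip x * c)
      (Ioi 0) := by
  refine ContinuousOn.mul (ContinuousOn.div_const (ContinuousOn.mul ?_ ?_) _) continuousOn_const
  · exact (h.continuous_airyRecip.comp (by fun_prop)).continuousOn
  · exact h.continuousOn_sizeBiased.comp (by fun_prop) fun v hv => mul_pos hb hv

lemma tendsto_sizeBiased_mul_exp_div (h : IsLeadingZero a ε) {v : ℝ} (hv : 0 < v) :
    Tendsto (fun Y => sizeBiased a ε (Y * v) * Real.exp (-(a * (Y * v))) / Y) atTop (𝓝 v) := by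
  have h1 := (h.isEquivalent_sizeBiased_atTop.comp (tendsto_id.atTop_mul_const hv)).const_mul v
  rw [mul_one] at h1
  refine h1.congr' ?_
  filter_upwards [eventually_gt_atTop 0] with Y hY
  simp only [Function.comp_apply, id]
  rw [Real.exp_neg]
  have := (Real.exp_pos (a * (Y * v))).ne'
  field_simp

lemma scaled_atBot_eq (Y v : ℝ) :
    airyRecip (-Y + Y * v) * sizeBiased a ε (Y * v) / airyRecip (-Y) * Y⁻¹
      = (airyRecip (-Y + Y * v) * Real.exp (a * (-Y + Y * v))) /
          (airyRecip (-Y) * Real.exp (a * -Y)) *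
        (sizeBiased a ε (Y * v) * Real.exp (-(a * (Y * v))) / Y) := by
  have h1 : Real.exp (a * (-Y + Y * v)) = Real.exp (a * -Y) * Real.exp (a * (Y * v)) := by
    rw [← Real.exp_add]; congr 1; ring
  have h2 := (Real.exp_pos (a * -Y)).ne'
  have h3 := (Real.exp_pos (a * (Y * v))).ne'
  rw [h1, Real.exp_neg]
  by_cases h4 : airyRecip (-Y) = 0
  · simp [h4]
  · field_simp

/-- Once the factors e^{a·} cancel, the sign of v - 1 decides. For v < 1 the argument -Y + Yv still
tends to -∞ and the ratio of G's tends to 1; for v > 1 it tends to +∞ and the numerator vanishes. -/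
lemma tendsto_scaled_atBot (h : IsLeadingZero a ε) {v : ℝ} (hv : 0 < v) (hv1 : v ≠ 1) :
    Tendsto (fun Y => airyRecip (-Y + Y * v) * sizeBiased a ε (Y * v) / airyRecip (-Y) * Y⁻¹)
      atTop (𝓝 ((Iio (1 : ℝ)).indicator id v)) := by
  simp only [scaled_atBot_eq]
  have hden : Tendsto (fun Y => airyRecip (-Y) * Real.exp (a * -Y)) atTop (𝓝 (airyRes a)) :=
    h.tendsto_airyRecip_atBot.comp tendsto_neg_atTop_atBot
  have hT := h.tendsto_sizeBiased_mul_exp_div hv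
  have e : ∀ Y : ℝ, -Y + Y * v = (v - 1) * Y := fun Y => by ring
  rcases lt_or_gt_of_ne hv1 with hlt | hgt
  · have hnum : Tendsto (fun Y : ℝ => airyRecip (-Y + Y * v) * Real.exp (a * (-Y + Y * v))) atTop
        (𝓝 (airyRes a)) := by
      refine h.tendsto_airyRecip_atBot.comp ?_
      simp only [e]
      exact tendsto_id.const_mul_atTop_of_neg (by linarith)
    have := (hnum.div hden h.airyRes_ne_zero).mul hT
    rw [div_self h.airyRes_ne_zero, one_mul] at this
    rwa [indicator_of_mem (show v ∈ Iio (1 : ℝ) from hlt), id]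
  · have hnum : Tendsto (fun Y : ℝ => airyRecip (-Y + Y * v) * Real.exp (a * (-Y + Y * v))) atTop
        (𝓝 0) := by
      obtain ⟨C, hC, hb⟩ := h.exists_abs_airyRecip_mul_exp_le
      have h0 : Tendsto (fun x : ℝ => C * Real.exp (-x)) atTop (𝓝 0) := by
        simpa using (Real.tendsto_exp_atBot.comp tendsto_neg_atTop_atBot).const_mul C
      have h1 : Tendsto (fun x => airyRecip x * Real.exp (a * x)) atTop (𝓝 0) := by
        refine squeeze_zero_norm (fun x => ?_) h0
        rw [norm_mul, Real.norm_eq_abs, Real.norm_of_nonneg (Real.exp_pos _).le]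
        exact (hb x).2
      refine h1.comp ?_
      simp only [e]
      exact tendsto_id.const_mul_atTop (by linarith)
    have := (hnum.div hden h.airyRes_ne_zero).mul hT
    rw [zero_div, zero_mul] at this
    rwa [indicator_of_notMem (by simpa using hgt.le)]

lemma exists_abs_scaled_atBot_le (h : IsLeadingZero a ε) : ∃ C > 0, ∀ᶠ Y in atTop, ∀ v, 0 < v →
    |airyRecip (-Y + Y * v) * sizeBiased a ε (Y * v) / airyRecip (-Y) * Y⁻¹|
      ≤ C * (((Real.sqrt v)⁻¹ + v) * Real.exp (-(1 * v))) := by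
  obtain ⟨C, hC, hb⟩ := h.exists_abs_airyRecip_mul_exp_le
  obtain ⟨D, hD, hb'⟩ := h.abs_sizeBiased_le
  have hden : Tendsto (fun Y => |airyRecip (-Y) * Real.exp (a * -Y)|) atTop (𝓝 |airyRes a|) :=
    (h.tendsto_airyRecip_atBot.comp tendsto_neg_atTop_atBot).abs
  have hρ : 0 < |airyRes a| := abs_pos.2 h.airyRes_ne_zero
  refine ⟨C * Real.exp 1 / (|airyRes a| / 2) * D, by positivity, ?_⟩
  filter_upwards [eventually_ge_atTop 1, hden.eventually (lt_mem_nhds (half_lt_self hρ))]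
    with Y hY hYd v hv
  have hY0 : 0 < Y := by linarith
  rw [scaled_atBot_eq, abs_mul, abs_div]
  have h1 : |airyRecip (-Y + Y * v) * Real.exp (a * (-Y + Y * v))|
      ≤ C * Real.exp 1 * Real.exp (-(1 * v)) := by
    rw [abs_mul, Real.abs_exp, mul_assoc, ← Real.exp_add]
    obtain ⟨b1, b2⟩ := hb (-Y + Y * v)
    -- For v ≤ 1 the constant bound suffices. For v ≥ 1 and Y ≥ 1, e^{-(v-1)Y} ≤ e · e^{-v}, the
    -- origin of the factor e.
    rcases le_total v 1 with hv1 | hv1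
    · refine b1.trans (le_mul_of_one_le_right hC.le (Real.one_le_exp (by linarith)))
    · refine b2.trans (mul_le_mul_of_nonneg_left (Real.exp_le_exp.2 ?_) hC.le)
      nlinarith
  have h2 : |sizeBiased a ε (Y * v) * Real.exp (-(a * (Y * v))) / Y|
      ≤ D * ((Real.sqrt v)⁻¹ + v) := by
    rw [abs_div, abs_mul, Real.abs_exp, abs_of_pos hY0, div_le_iff₀ hY0]
    have hsv : 0 < Real.sqrt v := Real.sqrt_pos.2 hv
    have h3 : (Real.sqrt (Y * v))⁻¹ ≤ (Real.sqrt v)⁻¹ * Y := by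
      have h5 : Real.sqrt v ≤ Real.sqrt (Y * v) := Real.sqrt_le_sqrt (by nlinarith)
      calc _ ≤ (Real.sqrt v)⁻¹ := by gcongr
        _ ≤ _ := le_mul_of_one_le_right (by positivity) hY
    calc _ ≤ D * ((Real.sqrt (Y * v))⁻¹ + Y * v) * Real.exp (a * (Y * v))
          * Real.exp (-(a * (Y * v))) := by gcongr; exact hb' _ (by positivity)
      _ = D * ((Real.sqrt (Y * v))⁻¹ + Y * v) := by
          rw [mul_assoc, ← Real.exp_add, add_neg_cancel, Real.exp_zero, mul_one]
      _ ≤ D * ((Real.sqrt v)⁻¹ * Y + Y * v) := by gcongr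
      _ = _ := by ring
  calc _ ≤ (C * Real.exp 1 * Real.exp (-(1 * v))) / (|airyRes a| / 2)
        * (D * ((Real.sqrt v)⁻¹ + v)) := by gcongr
    _ = _ := by ring

theorem tendsto_normIntensity_atBot (h : IsLeadingZero a ε) :
    Tendsto (fun x => normIntensity a ε x / x ^ 2) atBot (𝓝 (1 / 2)) := by
  obtain ⟨C, hC, hb⟩ := h.exists_abs_scaled_atBot_le
  have hlim := tendsto_integral_filter_of_dominated_convergence (l := atTop)
    (μ := volume.restrict (Ioi (0 : ℝ)))
    (F := fun Y v => airyRecip (-Y + Y * v) * sizeBiased a ε (Y * v) / airyRecip (-Y) * Y⁻¹)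
    (f := (Iio (1 : ℝ)).indicator id) _ ?_ ?_
    ((integrableOn_inv_sqrt_add_mul_exp one_pos).const_mul C) ?_
  · have hval : ∫ v in Ioi (0 : ℝ), (Iio (1 : ℝ)).indicator id v = 1 / 2 := by
      rw [setIntegral_indicator measurableSet_Iio, Ioi_inter_Iio, ← integral_Ioc_eq_integral_Ioo,
        ← intervalIntegral.integral_of_le zero_le_one]
      simp
    rw [hval] at hlim
    have h2 : Tendsto (fun Y => normIntensity a ε (-Y) / (-Y) ^ 2) atTop (𝓝 (1 / 2)) := by
      refine hlim.congr' ?_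
      filter_upwards [eventually_gt_atTop 0] with Y hY
      rw [normIntensity_eq_scaled a ε (-Y) hY, integral_mul_const]
      field_simp
    have := h2.comp tendsto_neg_atBot_atTop
    refine this.congr fun x => ?_
    simp
  · filter_upwards [eventually_gt_atTop 0] with Y hY
    exact (h.continuousOn_scaled _ _ hY).aestronglyMeasurable measurableSet_Ioi
  · filter_upwards [hb] with Y hY
    exact (ae_restrict_iff' measurableSet_Ioi).2 (Eventually.of_forall fun v hv => hY v hv)
  · rw [ae_restrict_iff' measurableSet_Ioi]
    have : ∀ᵐ v : ℝ, v ≠ 1 := by simp [ae_iff]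
    filter_upwards [this] with v hv1 hv
    exact h.tendsto_scaled_atBot hv hv1

/-- Expanding (X+t)³ isolates e^{-X²t}, which fixes the scale t = v/X²; the other exponents vanish
on that scale. -/
lemma airyRecip_div_eq {X t : ℝ} (hX : 0 < X) (ht : 0 < t) : airyRecip (X + t) / airyRecip X
    = (airyRecip (X + t) * Real.exp ((X + t) ^ 3 / 3) / (X + t)) /
        (airyRecip X * Real.exp (X ^ 3 / 3) / X)
      * (1 + t / X) * Real.exp (-(X ^ 2 * t + X * t ^ 2 + t ^ 3 / 3)) := by
  have h1 : Real.exp ((X + t) ^ 3 / 3)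
      = Real.exp (X ^ 3 / 3) * Real.exp (X ^ 2 * t + X * t ^ 2 + t ^ 3 / 3) := by
    rw [← Real.exp_add]; congr 1; ring
  have h2 := (Real.exp_pos (X ^ 3 / 3)).ne'
  have h3 := (Real.exp_pos (X ^ 2 * t + X * t ^ 2 + t ^ 3 / 3)).ne'
  have h5 : X + t ≠ 0 := by positivity
  rw [h1, Real.exp_neg]
  by_cases h4 : airyRecip X = 0
  · simp [h4]
  · field_simp

lemma tendsto_div_sq (v : ℝ) : Tendsto (fun X : ℝ => (X ^ 2)⁻¹ * v) atTop (𝓝 0) := by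
  simpa using (tendsto_inv_atTop_zero.comp (tendsto_pow_atTop two_ne_zero)).mul_const v

/-- Jumps of size v/X² see only the singularity (4πt)^{-1/2} of the size-biased density, which
contributes a factor X, balanced by X⁻¹. -/
lemma tendsto_scaled_atTop (h : IsLeadingZero a ε) {v : ℝ} (hv : 0 < v) :
    Tendsto (fun X => airyRecip (X + (X ^ 2)⁻¹ * v) * sizeBiased a ε ((X ^ 2)⁻¹ * v) / airyRecip X
      * X⁻¹) atTop (𝓝 (Real.exp (-(1 * v)) * (Real.sqrt (4 * Real.pi * v))⁻¹)) := by
  have hA := h.tendsto_airyRecip_atTop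
  have ht := tendsto_div_sq v
  have hXt : Tendsto (fun X : ℝ => X + (X ^ 2)⁻¹ * v) atTop atTop :=
    tendsto_id.atTop_add ht
  have hr := (hA.comp hXt).div hA two_ne_zero
  have hf : Tendsto (fun X : ℝ => 1 + (X ^ 2)⁻¹ * v / X) atTop (𝓝 (1 + 0)) :=
    (ht.div_atTop tendsto_id).const_add 1
  have he : Tendsto (fun X : ℝ => Real.exp (-(v + v ^ 2 * (X ^ 3)⁻¹ + v ^ 3 * (X ^ 6)⁻¹ / 3))) atTop
      (𝓝 (Real.exp (-(v + v ^ 2 * 0 + v ^ 3 * 0 / 3)))) := by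
    have hi : ∀ n : ℕ, n ≠ 0 → Tendsto (fun X : ℝ => (X ^ n)⁻¹) atTop (𝓝 0) := fun n hn =>
      tendsto_inv_atTop_zero.comp (tendsto_pow_atTop hn)
    refine (Real.continuous_exp.tendsto _).comp (Tendsto.neg ?_)
    exact (tendsto_const_nhds.add ((hi 3 (by norm_num)).const_mul _)).add
      (((hi 6 (by norm_num)).const_mul _).div_const 3)
  have hs : Tendsto (fun X : ℝ => sizeBiased a ε ((X ^ 2)⁻¹ * v) *
      Real.sqrt (4 * Real.pi * ((X ^ 2)⁻¹ * v))) atTop (𝓝 1) := by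
    refine h.isEquivalent_sizeBiased_zero.comp (tendsto_nhdsWithin_iff.2 ⟨ht, ?_⟩)
    filter_upwards [eventually_gt_atTop 0] with X hX
    exact mul_pos (by positivity) hv
  have := ((hr.mul hf).mul he).mul (hs.mul_const (Real.sqrt (4 * Real.pi * v))⁻¹)
  have e0 : (2 : ℝ) / 2 * (1 + 0) * Real.exp (-(v + v ^ 2 * 0 + v ^ 3 * 0 / 3))
      * (1 * (Real.sqrt (4 * Real.pi * v))⁻¹)
      = Real.exp (-(1 * v)) * (Real.sqrt (4 * Real.pi * v))⁻¹ := by norm_num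
  rw [e0] at this
  refine this.congr' ?_
  filter_upwards [eventually_gt_atTop 0] with X hX
  have ht0 : 0 < (X ^ 2)⁻¹ * v := by positivity
  have e1 : airyRecip (X + (X ^ 2)⁻¹ * v) * sizeBiased a ε ((X ^ 2)⁻¹ * v) / airyRecip X * X⁻¹
      = airyRecip (X + (X ^ 2)⁻¹ * v) / airyRecip X * (sizeBiased a ε ((X ^ 2)⁻¹ * v) * X⁻¹) := by
    ring
  have e2 : X ^ 2 * ((X ^ 2)⁻¹ * v) + X * ((X ^ 2)⁻¹ * v) ^ 2 + ((X ^ 2)⁻¹ * v) ^ 3 / 3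
      = v + v ^ 2 * (X ^ 3)⁻¹ + v ^ 3 * (X ^ 6)⁻¹ / 3 := by
    field_simp
  have e3 : Real.sqrt (4 * Real.pi * ((X ^ 2)⁻¹ * v)) = X⁻¹ * Real.sqrt (4 * Real.pi * v) := by
    rw [show 4 * Real.pi * ((X ^ 2)⁻¹ * v) = (X⁻¹) ^ 2 * (4 * Real.pi * v) by ring,
      Real.sqrt_mul (by positivity), Real.sqrt_sq (by positivity)]
  have hpos : 0 < Real.sqrt (4 * Real.pi * v) := Real.sqrt_pos.2 (by positivity)
  rw [e1, airyRecip_div_eq hX ht0, e2, e3]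
  congr 1
  field_simp

lemma exists_abs_scaled_atTop_le (h : IsLeadingZero a ε) : ∃ C > 0, ∀ᶠ X in atTop, ∀ v, 0 < v →
    |airyRecip (X + (X ^ 2)⁻¹ * v) * sizeBiased a ε ((X ^ 2)⁻¹ * v) / airyRecip X * X⁻¹|
      ≤ C * (((Real.sqrt v)⁻¹ + v) * Real.exp (-(1 / 2 * v))) := by
  obtain ⟨D, hD, hb'⟩ := h.abs_sizeBiased_le
  have hA := h.tendsto_airyRecip_atTop
  obtain ⟨R, hR⟩ := eventually_atTop.1 (hA.eventually (Icc_mem_nhds (a := 1) (b := 3)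
    (by norm_num) (by norm_num)))
  refine ⟨6 * D, by positivity, ?_⟩
  filter_upwards [eventually_ge_atTop (max R 1)] with X hX v hv
  have hX1 : 1 ≤ X := (le_max_right _ _).trans hX
  have hX0 : 0 < X := by linarith
  have hXR : R ≤ X := (le_max_left _ _).trans hX
  set t := (X ^ 2)⁻¹ * v with ht
  have ht0 : 0 < t := by positivity
  have hX2 : 1 ≤ X ^ 2 := one_le_pow₀ hX1
  have htv : t ≤ v := by
    rw [ht]
    exact mul_le_of_le_one_left hv.le (inv_le_one_of_one_le₀ hX2)
  obtain ⟨l1, u1⟩ := hR X hXR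
  obtain ⟨l2, u2⟩ := hR (X + t) (by linarith)
  have hXt : X ^ 2 * t = v := by rw [ht]; field_simp
  have hratio : |airyRecip (X + t) / airyRecip X| ≤ 6 * Real.exp (-(1 / 2 * v)) := by
    rw [airyRecip_div_eq hX0 ht0, abs_of_nonneg (by positivity)]
    have q1 : (airyRecip (X + t) * Real.exp ((X + t) ^ 3 / 3) / (X + t)) /
        (airyRecip X * Real.exp (X ^ 3 / 3) / X) ≤ 3 / 1 := by gcongr
    -- Half of the exponential decay is spent on the factor 1 + t/X. With the ratio at most 3, by
    -- the window [1,3] around the limit 2, this gives the constant 6.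
    have q2 : 1 + t / X ≤ 2 * Real.exp (1 / 2 * v) := by
      have q3 : t / X ≤ v := (div_le_self ht0.le hX1).trans htv
      have := Real.add_one_le_exp (1 / 2 * v)
      linarith
    have q4 : Real.exp (-(X ^ 2 * t + X * t ^ 2 + t ^ 3 / 3)) ≤ Real.exp (-v) := by
      apply Real.exp_le_exp.2
      have : 0 ≤ X * t ^ 2 + t ^ 3 / 3 := by positivity
      linarith
    calc _ ≤ 3 / 1 * (2 * Real.exp (1 / 2 * v)) * Real.exp (-v) := by gcongr
      _ = 6 * (Real.exp (1 / 2 * v) * Real.exp (-v)) := by ring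
      _ = _ := by rw [← Real.exp_add]; congr 2; ring
  have hsize : |sizeBiased a ε t * X⁻¹| ≤ D * ((Real.sqrt v)⁻¹ + v) := by
    rw [abs_mul, abs_of_pos (inv_pos.2 hX0), ← div_eq_mul_inv, div_le_iff₀ hX0]
    have he : Real.exp (a * t) ≤ 1 := Real.exp_le_one_iff.2 (by nlinarith [h.neg])
    have hst : (Real.sqrt t)⁻¹ = (Real.sqrt v)⁻¹ * X := by
      rw [ht, show (X ^ 2)⁻¹ * v = (X⁻¹) ^ 2 * v by ring,
      Real.sqrt_mul (by positivity), Real.sqrt_sq (by positivity), mul_inv, inv_inv, mul_comm]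
    calc _ ≤ D * ((Real.sqrt t)⁻¹ + t) * Real.exp (a * t) := hb' t ht0
      _ ≤ D * ((Real.sqrt t)⁻¹ + t) * 1 := by gcongr
      _ ≤ D * ((Real.sqrt v)⁻¹ * X + v * X) := by
          rw [hst, mul_one]
          gcongr
          nlinarith
      _ = _ := by ring
  have e1 : airyRecip (X + t) * sizeBiased a ε t / airyRecip X * X⁻¹
      = airyRecip (X + t) / airyRecip X * (sizeBiased a ε t * X⁻¹) := by
    ring
  rw [e1, abs_mul]
  calc _ ≤ 6 * Real.exp (-(1 / 2 * v)) * (D * ((Real.sqrt v)⁻¹ + v)) := by gcongr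
    _ = _ := by ring

theorem tendsto_normIntensity_atTop (h : IsLeadingZero a ε) :
    Tendsto (fun x => normIntensity a ε x * x) atTop (𝓝 (1 / 2)) := by
  obtain ⟨C, hC, hb⟩ := h.exists_abs_scaled_atTop_le
  have hlim := tendsto_integral_filter_of_dominated_convergence (l := atTop)
    (μ := volume.restrict (Ioi (0 : ℝ)))
    (F := fun X v => airyRecip (X + (X ^ 2)⁻¹ * v) * sizeBiased a ε ((X ^ 2)⁻¹ * v) / airyRecip X
      * X⁻¹)
    (f := fun v => Real.exp (-(1 * v)) * (Real.sqrt (4 * Real.pi * v))⁻¹) _ ?_ ?_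
    ((integrableOn_inv_sqrt_add_mul_exp (s := 1 / 2) (by norm_num)).const_mul C) ?_
  · rw [laplace_inv_sqrt one_pos, Real.sqrt_one, mul_one] at hlim
    refine hlim.congr' ?_
    filter_upwards [eventually_gt_atTop 0] with X hX
    rw [normIntensity_eq_scaled a ε X (b := (X ^ 2)⁻¹) (by positivity), integral_mul_const]
    field_simp
  · filter_upwards [eventually_gt_atTop 0] with X hX
    exact (h.continuousOn_scaled _ _ (by positivity)).aestronglyMeasurable measurableSet_Ioi
  · filter_upwards [hb] with X hX
    exact (ae_restrict_iff' measurableSet_Ioi).2 (Eventually.of_forall fun v hv => hX v hv)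
  · rw [ae_restrict_iff' measurableSet_Ioi]
    exact Eventually.of_forall fun v hv => h.tendsto_scaled_atTop hv

end IsLeadingZero

/-! ### Return to the original scale -/

/-- The cube root of `2`. -/
noncomputable def cbrtTwo : ℝ := (2 : ℝ) ^ (1 / 3 : ℝ)

lemma cbrtTwo_pos : 0 < cbrtTwo := Real.rpow_pos_of_pos two_pos _

lemma cbrtTwo_cube : cbrtTwo ^ 3 = 2 := by
  rw [cbrtTwo, ← Real.rpow_natCast, ← Real.rpow_mul two_pos.le]; norm_num

lemma two_rpow_two_thirds : (2 : ℝ) ^ (2 / 3 : ℝ) = cbrtTwo ^ 2 := by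
  rw [cbrtTwo, ← Real.rpow_natCast, ← Real.rpow_mul two_pos.le]; norm_num

lemma two_rpow_neg_third : (2 : ℝ) ^ (-(1 / 3) : ℝ) = cbrtTwo⁻¹ := by
  rw [cbrtTwo, Real.rpow_neg two_pos.le]

lemma isEquivalent_of_tendsto_div_one {l : Filter ℝ} {u v : ℝ → ℝ} (hv : ∀ᶠ x in l, v x ≠ 0)
    (h : Tendsto (fun x => u x / v x) l (𝓝 1)) : u ~[l] v :=
  (isEquivalent_iff_tendsto_one hv).2 h

/-- A function `g` as in `IsJumpG`. -/
noncomputable def jumpG (x : ℝ) : ℝ := cbrtTwo ^ 2 * airyRecip (cbrtTwo * x)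

namespace IsLeadingZero

variable {a ε : ℝ}

/-- A function `p` as in `IsJumpP`. -/
noncomputable def jumpP (a ε u : ℝ) : ℝ := 2 * (sizeBiased a ε (cbrtTwo * u) / (cbrtTwo * u))

lemma isJumpG (h : IsLeadingZero a ε) : IsJumpG jumpG := by
  have hk := cbrtTwo_pos
  refine ⟨continuous_const.mul (h.continuous_airyRecip.comp (by fun_prop)),
    (h.integrable_airyRecip.comp_mul_left' hk.ne').const_mul _, fun u => ?_⟩
  have e := Measure.integral_comp_mul_left (fun x : ℝ =>
    Complex.exp (Complex.I * (u / cbrtTwo : ℝ) * x) * (airyRecip x : ℂ)) cbrtTwo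
  have hkc : (cbrtTwo : ℂ) ≠ 0 := by exact_mod_cast hk.ne'
  rw [h.fourier_airyRecip, abs_of_pos (inv_pos.2 hk), Complex.real_smul] at e
  have e2 : ∀ x : ℝ, Complex.exp (Complex.I * u * x) * (jumpG x : ℂ) = (cbrtTwo : ℂ) ^ 2 *
      (Complex.exp (Complex.I * (u / cbrtTwo : ℝ) * (cbrtTwo * x : ℝ)) *
        (airyRecip (cbrtTwo * x) : ℂ)) := fun x => by
    have : Complex.I * (u / cbrtTwo : ℝ) * (cbrtTwo * x : ℝ) = Complex.I * u * x := by
      push_cast; field_simp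
    rw [this, jumpG]; push_cast; ring
  simp only [e2]
  rw [integral_const_mul, e, two_rpow_neg_third, ← cbrtTwo,
    show Complex.I * ((cbrtTwo⁻¹ : ℝ) : ℂ) * u = Complex.I * (u / cbrtTwo : ℝ) by push_cast; ring]
  push_cast
  field_simp

lemma jumpP_sub (a ε u : ℝ) :
    jumpP a ε u - (Real.sqrt (2 * Real.pi * u ^ 3))⁻¹ = 2 * regDensity a ε (cbrtTwo * u) := by
  have e : Real.sqrt (4 * Real.pi * (cbrtTwo * u) ^ 3) = 2 * Real.sqrt (2 * Real.pi * u ^ 3) := by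
    rw [mul_pow, cbrtTwo_cube, show 4 * Real.pi * (2 * u ^ 3) = 2 ^ 2 * (2 * Real.pi * u ^ 3) by ring,
      Real.sqrt_mul (by norm_num), Real.sqrt_sq two_pos.le]
  rw [regDensity, e, jumpP, mul_inv]
  ring

lemma isJumpP (h : IsLeadingZero a ε) : IsJumpP (jumpP a ε) := by
  have hk := cbrtTwo_pos
  have hmaps : MapsTo (fun u => cbrtTwo * u) (Ioi 0) (Ioi 0) := fun u hu => mul_pos hk hu
  have hfun : ∀ s : ℝ, EqOn (fun u : ℝ => Real.exp (-(s * u)) *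
      (jumpP a ε u - (Real.sqrt (2 * Real.pi * u ^ 3))⁻¹))
      (fun u => 2 * (fun v => Real.exp (-(s / cbrtTwo * v)) * regDensity a ε v) (cbrtTwo * u))
      (Ioi 0) := fun s u hu => by
    have : s / cbrtTwo * (cbrtTwo * u) = s * u := by field_simp
    simp only [jumpP_sub a ε u, this]
    ring
  refine ⟨?_, fun s hs => ?_, fun s hs => ?_⟩
  · exact continuousOn_const.mul ((h.continuousOn_sizeBiased.comp (by fun_prop) hmaps).div
      (by fun_prop) fun u hu => (mul_pos hk hu).ne')
  · refine IntegrableOn.congr_fun (Integrable.const_mul ?_ 2) (hfun s).symm measurableSet_Ioi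
    have := (integrableOn_Ioi_comp_mul_left_iff
      (fun v => Real.exp (-(s / cbrtTwo * v)) * regDensity a ε v) 0 hk).2
    rw [mul_zero] at this
    exact this (h.integrableOn_regDensity (div_pos hs hk))
  · have e := integral_comp_mul_left_Ioi
      (fun v => Real.exp (-(s / cbrtTwo * v)) * regDensity a ε v) 0 hk
    have hL := h.laplace_regDensity (div_pos hs hk)
    rw [setIntegral_congr_fun measurableSet_Ioi (hfun s), integral_const_mul, e, mul_zero,
      smul_eq_mul, Complex.ofReal_mul, Complex.ofReal_mul, hL, csqrt_ofReal (div_pos hs hk).le,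
      deriv_airyAi, two_rpow_two_thirds, two_rpow_neg_third, inv_mul_eq_div]
    have h1 : 2 * (cbrtTwo⁻¹) = cbrtTwo ^ 2 := by
      rw [← cbrtTwo_cube]; field_simp
    have h2 : cbrtTwo ^ 2 * Real.sqrt (s / cbrtTwo) = Real.sqrt 2 * Real.sqrt s := by
      have e1 : Real.sqrt 2 = cbrtTwo * Real.sqrt cbrtTwo := by
        rw [← cbrtTwo_cube, show cbrtTwo ^ 3 = cbrtTwo ^ 2 * cbrtTwo by ring,
          Real.sqrt_mul (by positivity), Real.sqrt_sq hk.le]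
      have e2 := Real.mul_self_sqrt hk.le
      have e3 : Real.sqrt cbrtTwo ≠ 0 := (Real.sqrt_pos.2 hk).ne'
      rw [e1, Real.sqrt_div hs.le]
      field_simp
      rw [sq, e2]
    have h1' : ((2 : ℝ) : ℂ) * ((cbrtTwo⁻¹ : ℝ) : ℂ) = ((cbrtTwo ^ 2 : ℝ) : ℂ) := by
      rw [← h1, Complex.ofReal_mul]
    rw [← h2, ← mul_assoc, h1', Complex.ofReal_mul, mul_add, mul_div_assoc]

end IsLeadingZero

/-! ### Uniqueness of g and p -/

lemma IsJumpG.eq {g G : ℝ → ℝ} (hg : IsJumpG g) (hG : IsJumpG G) : g = G := by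
  have hi : Integrable fun x => ((g x - G x : ℝ) : ℂ) := (hg.integrable.sub hG.integrable).ofReal
  have hexp : ∀ (f : ℝ → ℝ) (y : ℝ), Integrable f →
      Integrable fun x : ℝ => Complex.exp (Complex.I * y * x) * (f x : ℂ) := fun f y hf => by
    refine hf.norm.mono' (Continuous.aestronglyMeasurable (by fun_prop) |>.mul
      hf.ofReal.aestronglyMeasurable) (Eventually.of_forall fun x => ?_)
    rw [norm_mul, norm_exp_I_mul_mul, one_mul, Complex.norm_real]
  have h0 : ∀ y : ℝ, (∫ v : ℝ, Complex.exp (-Complex.I * y * v) * ((g v - G v : ℝ) : ℂ)) = 0 :=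
    fun y => by
    have e : ∀ v : ℝ, Complex.exp (-Complex.I * y * v) * ((g v - G v : ℝ) : ℂ)
        = Complex.exp (Complex.I * (-y : ℝ) * v) * (g v : ℂ)
          - Complex.exp (Complex.I * (-y : ℝ) * v) * (G v : ℂ) := fun v => by
      push_cast; ring_nf
    simp only [e]
    rw [integral_sub (hexp g _ hg.integrable) (hexp G _ hG.integrable), hg.fourier, hG.fourier,
      sub_self]
  funext u
  have := fourier_inversion_angular hi (u := u) (by simp only [h0]; exact integrable_zero _ _ _)
    (Complex.continuous_ofReal.comp (hg.continuous.sub hG.continuous)).continuousAt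
  simp only [h0, mul_zero, integral_zero] at this
  have h2 : ((g u - G u : ℝ) : ℂ) = 0 := by
    have := this.symm
    simpa using this
  have h3 : g u - G u = 0 := by exact_mod_cast h2
  linarith

lemma IsJumpP.eqOn {p P : ℝ → ℝ} (hp : IsJumpP p) (hP : IsJumpP P) : EqOn p P (Ioi 0) := by
  have e : ∀ s u : ℝ, Real.exp (-(s * u)) * (p u - P u)
      = Real.exp (-(s * u)) * (p u - (Real.sqrt (2 * Real.pi * u ^ 3))⁻¹)
        - Real.exp (-(s * u)) * (P u - (Real.sqrt (2 * Real.pi * u ^ 3))⁻¹) := fun s u => by ring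
  have h0 := eq_zero_of_laplace_eq_zero (f := fun u => p u - P u)
    (hp.continuousOn.sub hP.continuousOn)
    (fun s hs => by simp only [e]; exact (hp.integrableOn s hs).sub (hP.integrableOn s hs))
    (fun s hs => by
      simp only [e]
      rw [integral_sub (hp.integrableOn s hs) (hP.integrableOn s hs), sub_eq_zero]
      exact_mod_cast (hp.laplace s hs).trans (hP.laplace s hs).symm)
  exact fun u hu => by linarith [h0 u hu]

/-! ### Asymptotics in the original variables -/

namespace IsLeadingZero

variable {a ε : ℝ}

/-- With k³ = 2 the factor 4/k² turns (kx)²/2 into 2x² and 1/(2kx) into 1/x. -/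
lemma jumpIntensity_eq (a ε x : ℝ) : jumpIntensity jumpG (jumpP a ε) x
    = 4 / cbrtTwo ^ 2 * normIntensity a ε (cbrtTwo * x) := by
  have hk := cbrtTwo_pos
  have e : ∀ u ∈ Ioi (0 : ℝ), jumpG (x + u) * u * jumpP a ε u / jumpG x = 2 / cbrtTwo *
      (airyRecip (cbrtTwo * x + cbrtTwo * u) * sizeBiased a ε (cbrtTwo * u)
        / airyRecip (cbrtTwo * x)) := fun u hu => by
    have hu' : (0 : ℝ) < u := hu
    rw [jumpG, jumpG, jumpP, mul_add]
    by_cases h0 : airyRecip (cbrtTwo * x) = 0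
    · simp [h0]
    · field_simp
  rw [jumpIntensity, setIntegral_congr_fun measurableSet_Ioi e, integral_const_mul,
    normIntensity_eq_scaled a ε _ hk]
  field_simp
  ring

lemma isEquivalent_jumpP_atTop (h : IsLeadingZero a ε) :
    jumpP a ε ~[atTop] fun t : ℝ => 2 * Real.exp ((2 : ℝ) ^ (1 / 3 : ℝ) * a * t) := by
  refine isEquivalent_of_tendsto_div_one (Eventually.of_forall fun t => by positivity) ?_
  refine (h.isEquivalent_sizeBiased_atTop.comp
    (tendsto_id.const_mul_atTop cbrtTwo_pos)).congr' ?_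
  filter_upwards [eventually_gt_atTop 0] with t ht
  have hk := cbrtTwo_pos
  rw [← cbrtTwo, jumpP, Function.comp_apply, id, show cbrtTwo * a * t = a * (cbrtTwo * t) by ring]
  field_simp

lemma isEquivalent_jumpP_zero (h : IsLeadingZero a ε) :
    jumpP a ε ~[𝓝[>] 0] fun t : ℝ => (Real.sqrt (2 * Real.pi * t ^ 3))⁻¹ := by
  have hk := cbrtTwo_pos
  refine isEquivalent_of_tendsto_div_one ?_ ?_
  · filter_upwards [self_mem_nhdsWithin] with t ht
    have ht' : (0 : ℝ) < t := ht
    positivity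
  · have hl : Tendsto (fun t => cbrtTwo * t) (𝓝[>] 0) (𝓝[>] 0) := by
      refine tendsto_nhdsWithin_iff.2 ⟨?_, ?_⟩
      · have : Tendsto (fun t => cbrtTwo * t) (𝓝 0) (𝓝 0) := by
          simpa using (continuous_const_mul cbrtTwo).tendsto 0
        exact this.mono_left nhdsWithin_le_nhds
      · filter_upwards [self_mem_nhdsWithin] with t ht using mul_pos hk ht
    refine (h.isEquivalent_sizeBiased_zero.comp hl).congr' ?_
    filter_upwards [self_mem_nhdsWithin] with t ht
    have ht' : (0 : ℝ) < t := ht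
    have e : Real.sqrt (4 * Real.pi * (cbrtTwo * t)) * (cbrtTwo * t)
        = 2 * Real.sqrt (2 * Real.pi * t ^ 3) := by
      have h1 : 4 * Real.pi * (cbrtTwo * t) * (cbrtTwo * t) ^ 2
          = 2 ^ 2 * (2 * Real.pi * t ^ 3) := by
        linear_combination (4 * Real.pi * t ^ 3) * cbrtTwo_cube
      rw [← Real.sqrt_sq (mul_pos hk ht').le, ← Real.sqrt_mul (by positivity), Real.sqrt_sq
        (mul_pos hk ht').le, h1, Real.sqrt_mul (by norm_num), Real.sqrt_sq two_pos.le]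
    rw [Function.comp_apply, jumpP, div_inv_eq_mul]
    have h3 : cbrtTwo * t ≠ 0 := (mul_pos hk ht').ne'
    rw [mul_div_assoc', div_mul_eq_mul_div, eq_div_iff h3, mul_assoc, e]
    ring

lemma isEquivalent_jumpIntensity_atBot (h : IsLeadingZero a ε) :
    jumpIntensity jumpG (jumpP a ε) ~[atBot] fun t : ℝ => 2 * t ^ 2 := by
  have hk := cbrtTwo_pos
  refine isEquivalent_of_tendsto_div_one ?_ ?_
  · filter_upwards [eventually_lt_atBot 0] with t ht
    have := ht.ne
    positivity
  · have := (h.tendsto_normIntensity_atBot.comp (tendsto_id.const_mul_atBot hk)).const_mul 2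
    norm_num at this
    refine this.congr' ?_
    filter_upwards [eventually_lt_atBot 0] with t ht
    have ht' := ht.ne
    simp only [jumpIntensity_eq]
    field_simp
    norm_num [mul_comm]

lemma isEquivalent_jumpIntensity_atTop (h : IsLeadingZero a ε) :
    jumpIntensity jumpG (jumpP a ε) ~[atTop] fun t : ℝ => 1 / t := by
  have hk := cbrtTwo_pos
  refine isEquivalent_of_tendsto_div_one ?_ ?_
  · filter_upwards [eventually_gt_atTop 0] with t ht
    positivity
  · have := (h.tendsto_normIntensity_atTop.comp (tendsto_id.const_mul_atTop hk)).const_mul 2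
    norm_num at this
    refine this.congr' ?_
    filter_upwards [eventually_gt_atTop 0] with t ht
    simp only [jumpIntensity_eq]
    have := cbrtTwo_cube
    rw [show (4 : ℝ) = 2 * cbrtTwo ^ 3 by rw [this]; norm_num]
    field_simp

end IsLeadingZero

theorem mainTheorem11 :
    (∃ g : ℝ → ℝ, IsJumpG g) ∧ (∃ p : ℝ → ℝ, IsJumpP p) ∧
    ∀ g p : ℝ → ℝ, IsJumpG g → IsJumpP p →
      (∃ a₁ : ℝ, IsGreatest {x : ℝ | x < 0 ∧ airyAi (x : ℂ) = 0} a₁ ∧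
        p ~[atTop] fun t : ℝ => 2 * Real.exp ((2 : ℝ) ^ (1 / 3 : ℝ) * a₁ * t)) ∧
      (p ~[𝓝[>] 0] fun t : ℝ => (Real.sqrt (2 * Real.pi * t ^ 3))⁻¹) ∧
      (jumpIntensity g p ~[atBot] fun t : ℝ => 2 * t ^ 2) ∧
      (jumpIntensity g p ~[atTop] fun t : ℝ => 1 / t) := by
  obtain ⟨a, ha, ε, hε, hu⟩ := exists_largest_zero
  have h : IsLeadingZero a ε := ⟨ha.1.1, ha.1.2, hε, hu⟩
  refine ⟨⟨_, h.isJumpG⟩, ⟨_, h.isJumpP⟩, fun g p hg hp => ?_⟩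
  obtain rfl := hg.eq h.isJumpG
  have hpP := hp.eqOn h.isJumpP
  have hφ : jumpIntensity jumpG p = jumpIntensity jumpG (IsLeadingZero.jumpP a ε) := by
    funext x
    rw [jumpIntensity, jumpIntensity]
    congr 1
    exact setIntegral_congr_fun measurableSet_Ioi fun u hu => by rw [hpP hu]
  rw [hφ]
  refine ⟨⟨a, ha, h.isEquivalent_jumpP_atTop.congr_left ?_⟩,
    h.isEquivalent_jumpP_zero.congr_left ?_, h.isEquivalent_jumpIntensity_atBot,
    h.isEquivalent_jumpIntensity_atTop⟩
  · filter_upwards [eventually_gt_atTop 0] with t ht using (hpP ht).symm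
  · filter_upwards [self_mem_nhdsWithin] with t ht using (hpP ht).symm
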